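/- **Lemma (fast algebraic subroutines).** A *reversible arithmetic circuit* is a finite sequence of gates acting on wires that hold elements of a field $\mathbb F$; each gate adds to, or subtracts from, one target wire $x_t$ the value of one field operation, namely $1$, $x_j$, $x_jx_k$ or $x_j^{-1}$ (with $0^{-1}=0$), where the target wire is not among the wires being read. So every gate is a permutation. The description of a circuit involves no field elements besides $1$, hence it can be run over any field; its number of field operations is its number of gates. A circuit *reversibly computes* $v$ from $x$ if for every $y$ it maps $(x,y,0)$ to $(x,y+v,0)$ (input, output and ancilla wires). There are constants $A,a\in\mathbb N$ such that the following hold, where every circuit has at most $A\,m\,(\lfloor\log_2 m\rfloor+1)^a$ gates (that is, $\widetilde O(m)$), where $\lfloor\log_2 0\rfloor$ is read as $0$. 1. (Multipoint evaluation.) For every $m\ge 0$ there is a circuit which, over every finite field $\mathbb F_q$, for all $\alpha_1,\dots,\alpha_m\in\mathbb F_q$ and every polynomial $p\in\mathbb F_q[X]$ of degree $<m$, reversibly computes $(p(\alpha_1),\dots,p(\alpha_m))$ from the coefficients of $p$ and $\alpha_1,\dots,\alpha_m$. 2. (Reed–Solomon decoding.) (a) For all $1\le k\le m$ there is a circuit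 which, over every finite field $\mathbb F_q$ and for all pairwise distinct $\alpha_1,\dots,\alpha_m\in\mathbb F_q$, decodes the Reed–Solomon code $C=\{(p(\alpha_1),\dots,p(\alpha_m)) : p\in\mathbb F_q[X],\ \deg p<k\}$ up to half its minimum distance $d(C)$: whenever $w\in C$ and $r\in\mathbb F_q^m$ have Hamming distance less than $d(C)/2$, it reversibly computes $w$ from $\alpha_1,\dots,\alpha_m$ and $r$. (b) For all $0\le n<m$ there is a circuit which, over every finite field $\mathbb F_q$ and for all pairwise distinct $\alpha_1,\dots,\alpha_m\in\mathbb F_q$, with $B=(\alpha_i^{\,j})_{1\le i\le m,\,0\le j<n}$, performs syndrome decoding of the code $C'=\{d\in\mathbb F_q^m : B^{T}d=0\}$ up to half its minimum distance $d(C')$: whenever $e\in\mathbb F_q^m$ has Hamming weight less than $d(C')/2$, it reversibly computes $e$ from $\alpha_1,\dots,\alpha_m$ and the syndrome $B^Te$. -/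

import Mathlib

open Polynomial

/-- The field operations available to a reversible arithmetic circuit whose wires are indexed by
`W`: the constant `1`, reading a wire, the product of two wires, the inverse of a wire. -/
inductive FieldOp (W : Type) : Type where
  | one : FieldOp W
  | read (j : W) : FieldOp W
  | mul (j k : W) : FieldOp W
  | inv (j : W) : FieldOp W

namespace FieldOp

variable {W : Type}

/-- The wires that an operation reads. -/
def reads : FieldOp W → Set W
  | one => ∅
  | read j => {j}
  | mul j k => {j, k}
  | inv j => {j}

/-- The value of an operation when the wires hold the elements `x` of the field `F`. Inversion is
total, with the usual convention that the inverse of `0` is `0`. -/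
def eval {F : Type*} [Field F] (x : W → F) : FieldOp W → F
  | one => 1
  | read j => x j
  | mul j k => x j * x k
  | inv j => (x j)⁻¹

theorem eval_congr {F : Type*} [Field F] {x x' : W → F} (o : FieldOp W)
    (h : ∀ j ∈ o.reads, x j = x' j) : o.eval x = o.eval x' := by
  cases o <;> simp_all [reads, eval]

end FieldOp

/-- A reversible gate: the value of one field operation is added to (or, if `negated`, subtracted
from) a target wire which is not among the wires that the operation reads. The description of a
gate does not involve any field. -/
structure RevGate (W : Type) where
  target : W
  op : FieldOp W
  negated : Bool
  target_notMem : target ∉ op.reads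

namespace RevGate

variable {W : Type} [DecidableEq W]

/-- The contents of the wires after the gate. -/
def apply {F : Type*} [Field F] (g : RevGate W) (x : W → F) : W → F :=
  Function.update x g.target
    (if g.negated then x g.target - g.op.eval x else x g.target + g.op.eval x)

/-- The inverse gate. -/
def symm (g : RevGate W) : RevGate W := { g with negated := !g.negated }

theorem apply_symm_apply {F : Type*} [Field F] (g : RevGate W) (x : W → F) :
    g.symm.apply (g.apply x) = x := by
  have h : g.op.eval (g.apply x) = g.op.eval x := by
    refine FieldOp.eval_congr _ fun j hj => ?_
    have hne : j ≠ g.target := fun h => g.target_notMem (h ▸ hj)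
    simp [apply, hne]
  have h' : g.symm.op.eval (g.apply x) = g.op.eval x := h
  funext j
  by_cases hj : j = g.target
  · subst hj
    rw [apply, h']
    cases hn : g.negated <;> simp [symm, apply, hn]
  · simp [apply, symm, hj]

/-- A gate acts on the contents of the wires by a permutation. -/
def toPerm (F : Type*) [Field F] (g : RevGate W) : Equiv.Perm (W → F) where
  toFun := g.apply
  invFun := g.symm.apply
  left_inv := g.apply_symm_apply
  right_inv x := by
    have h : g.symm.symm = g := by cases g; simp [symm]
    have := g.symm.apply_symm_apply x
    rwa [h] at this

end RevGate

/-- A reversible arithmetic circuit with wires `W` is a list of gates, applied from left to right;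
the number of field operations it uses is the length of the list. -/
abbrev RevCircuit (W : Type) : Type := List (RevGate W)

/-- The permutation of the contents of the wires computed by a circuit over the field `F`. -/
def RevCircuit.toPerm {W : Type} [DecidableEq W] (F : Type*) [Field F] :
    RevCircuit W → Equiv.Perm (W → F)
  | [] => Equiv.refl _
  | g :: c => (g.toPerm F).trans (RevCircuit.toPerm F c)

/-- The circuit `c`, with input wires `I`, output wires `O` and `s` ancilla wires, reversibly
computes the output `v` from the input `x`: it leaves the input unchanged, adds `v` to the
output wires whatever they hold, and returns the ancillas, initially `0`, to `0`. -/
def RevCircuit.Computes {I O : Type} [DecidableEq I] [DecidableEq O] {s : ℕ} {F : Type*} [Field F]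
    (c : RevCircuit (I ⊕ O ⊕ Fin s)) (x : I → F) (v : O → F) : Prop :=
  ∀ y : O → F,
    RevCircuit.toPerm F c (Sum.elim x (Sum.elim y 0)) = Sum.elim x (Sum.elim (y + v) 0)

/-- The Reed–Solomon code of dimension `k` with evaluation points `α`: all the words
`(p(α₁), …, p(αₘ))` with `p` a polynomial of degree less than `k`. -/
noncomputable def reedSolomonCode {F : Type*} [Field F] {m : ℕ} (α : Fin m → F) (k : ℕ) :
    Submodule F (Fin m → F) :=
  (degreeLT F k).map (LinearMap.pi fun i => (leval (α i) : F[X] →ₗ[F] F))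

/-- The `m × n` Vandermonde matrix with entries `αᵢ ^ j`, `0 ≤ j < n`. -/
def vandermondeMatrix {F : Type*} [Field F] {m : ℕ} (α : Fin m → F) (n : ℕ) :
    Matrix (Fin m) (Fin n) F :=
  Matrix.of fun i j => α i ^ (j : ℕ)

/-- The code `{d : Bᵀ d = 0}` with parity checks given by the Vandermonde matrix `B`. -/
def vandermondeDualCode {F : Type*} [Field F] {m : ℕ} (α : Fin m → F) (n : ℕ) :
    Submodule F (Fin m → F) :=
  LinearMap.ker (Matrix.mulVecLin (vandermondeMatrix α n).transpose)

/-- The minimum (Hamming) distance of a code with at least two words. -/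
noncomputable def codeMinDist {F : Type*} [Field F] [DecidableEq F] {m : ℕ}
    (C : Submodule F (Fin m → F)) : ℕ :=
  sInf {d : ℕ | ∃ a ∈ C, ∃ b ∈ C, a ≠ b ∧ d = hammingDist a b}

/-! A circuit that serves all fields and all inputs at once is a straight-line program over one
ring, the product of the fields of all problem instances: an element of this ring is the family of
values that one wire holds in the various instances. Programs have no branches, so uniformity is
automatic. `exists_circuit` turns a program into a reversible circuit with a constant number of
gates per instruction. What remains is to bound the length of programs over products of fields,
where only `x * x⁻¹ * x = x` survives of division.

Multiplication of polynomials follows Schönhage–Strassen and Cantor–Kaltofen. For `p = 2` and `p =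
3`, blocks of coefficients are mapped to `R[y]/(y ^ Q - 1)` with `Q` a power of `p`, where powers of
`y` act as roots of unity and multiplication by them is a free rotation. Multiplying by `1 - y ^ (Q
/ p)` replaces the passage to a cyclotomic quotient. Recursion yields `p ^ J • (a * b)` over every
commutative ring in quasilinear time (`exists_mulBound`). The idempotent `2 * 2⁻¹` is `1` in the
factors of characteristic other than 2 and `0` in the others, where `3 = 1`, so the multiples by `2
^ J` and `3 ^ L` together give the product (`eq_two_part_add_three_part`). Newton inversion,
division with remainder, product trees and multipoint evaluation follow classically.

For decoding, let `T` be the generating series of the power sums `∑ e l * α l ^ j`. If `e` has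
weight `t` and `2 * t ≤ n`, then `Λ * T = Ω` for a locator `Λ` of degree at most `t` and some `Ω` of
smaller degree, and `n` terms of `T` determine it as a fraction. The fraction is found by steps that
eliminate one constant term each (`DivState`), grouped by divide and conquer because `n` steps
depend only on `n` coefficients. The one branch, on `0 < Δ` and a nonzero constant term, is made
arithmetic: `g * g⁻¹` tests for zero, and `Δ` is kept in binary as 0/1 elements. Neither roots nor
the error positions are ever extracted. `T` is extended to enough terms, multiplied by `∏ (1 - α j *
X)` over all nodes, reversed and evaluated at the nodes, which gives each `e j` up to a known
nonzero weight.

Received words reduce to syndromes by the duality between Reed–Solomon codes and weighted power sums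
(`sum_reedSolomonCode`). Explicit light codewords bound both minimum distances from above, so half
the minimum distance is within reach of the key equation. -/

/-- `SLP S n T`: starting from the elements of `S`, all elements of `T` are obtained by a
straight-line program with at most `n` instructions, each of which produces `1`, a sum, a
difference, a product or an inverse of elements that are already available. -/
inductive SLP {R : Type*} [Ring R] [Inv R] : Set R → ℕ → Set R → Prop where
  | done {S T : Set R} (n : ℕ) (h : T ⊆ S) : SLP S n T
  | one {S T : Set R} {n : ℕ} (h : SLP (insert 1 S) n T) : SLP S (n + 1) T
  | add {S T : Set R} {n : ℕ} {a b : R} (ha : a ∈ S) (hb : b ∈ S)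
      (h : SLP (insert (a + b) S) n T) : SLP S (n + 1) T
  | sub {S T : Set R} {n : ℕ} {a b : R} (ha : a ∈ S) (hb : b ∈ S)
      (h : SLP (insert (a - b) S) n T) : SLP S (n + 1) T
  | mul {S T : Set R} {n : ℕ} {a b : R} (ha : a ∈ S) (hb : b ∈ S)
      (h : SLP (insert (a * b) S) n T) : SLP S (n + 1) T
  | inv {S T : Set R} {n : ℕ} {a : R} (ha : a ∈ S)
      (h : SLP (insert a⁻¹ S) n T) : SLP S (n + 1) T

/-! ### Calculus of straight-line programs -/

namespace SLP

section

variable {R : Type*} [Ring R] [Inv R] {S S' T T' U : Set R} {n m : ℕ} {a b : R}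

theorem mono_left (h : SLP S n T) (hS : S ⊆ S') : SLP S' n T := by
  induction h generalizing S' with
  | done n h => exact .done n (h.trans hS)
  | one _ ih => exact .one (ih (Set.insert_subset_insert hS))
  | add ha hb _ ih => exact .add (hS ha) (hS hb) (ih (Set.insert_subset_insert hS))
  | sub ha hb _ ih => exact .sub (hS ha) (hS hb) (ih (Set.insert_subset_insert hS))
  | mul ha hb _ ih => exact .mul (hS ha) (hS hb) (ih (Set.insert_subset_insert hS))
  | inv ha _ ih => exact .inv (hS ha) (ih (Set.insert_subset_insert hS))

theorem mono_right (h : SLP S n T) (hT : T' ⊆ T) : SLP S n T' := by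
  induction h with
  | done n h => exact .done n (hT.trans h)
  | one _ ih => exact .one (ih hT)
  | add ha hb _ ih => exact .add ha hb (ih hT)
  | sub ha hb _ ih => exact .sub ha hb (ih hT)
  | mul ha hb _ ih => exact .mul ha hb (ih hT)
  | inv ha _ ih => exact .inv ha (ih hT)

theorem mono (h : SLP S n T) (hn : n ≤ m) : SLP S m T := by
  induction h generalizing m with
  | done n h => exact .done m h
  | one _ ih =>
    obtain ⟨m, rfl⟩ := Nat.exists_eq_add_of_le' (Nat.le_of_add_left_le hn)
    exact .one (ih (by omega))
  | add ha hb _ ih =>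
    obtain ⟨m, rfl⟩ := Nat.exists_eq_add_of_le' (Nat.le_of_add_left_le hn)
    exact .add ha hb (ih (by omega))
  | sub ha hb _ ih =>
    obtain ⟨m, rfl⟩ := Nat.exists_eq_add_of_le' (Nat.le_of_add_left_le hn)
    exact .sub ha hb (ih (by omega))
  | mul ha hb _ ih =>
    obtain ⟨m, rfl⟩ := Nat.exists_eq_add_of_le' (Nat.le_of_add_left_le hn)
    exact .mul ha hb (ih (by omega))
  | inv ha _ ih =>
    obtain ⟨m, rfl⟩ := Nat.exists_eq_add_of_le' (Nat.le_of_add_left_le hn)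
    exact .inv ha (ih (by omega))

/-- Sequential composition. -/
theorem bind (h : SLP S n T) (k : ∀ S', S ⊆ S' → T ⊆ S' → SLP S' m U) : SLP S (n + m) U := by
  induction h with
  | done n h => exact (k _ le_rfl h).mono (by omega)
  | @one S T n _ ih =>
    have := ih fun S' h => k S' ((Set.subset_insert _ _).trans h)
    rw [show n + 1 + m = n + m + 1 by omega]; exact .one this
  | @add S T n _ _ ha hb _ ih =>
    have := ih fun S' h => k S' ((Set.subset_insert _ _).trans h)
    rw [show n + 1 + m = n + m + 1 by omega]; exact .add ha hb this
  | @sub S T n _ _ ha hb _ ih =>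
    have := ih fun S' h => k S' ((Set.subset_insert _ _).trans h)
    rw [show n + 1 + m = n + m + 1 by omega]; exact .sub ha hb this
  | @mul S T n _ _ ha hb _ ih =>
    have := ih fun S' h => k S' ((Set.subset_insert _ _).trans h)
    rw [show n + 1 + m = n + m + 1 by omega]; exact .mul ha hb this
  | @inv S T n _ ha _ ih =>
    have := ih fun S' h => k S' ((Set.subset_insert _ _).trans h)
    rw [show n + 1 + m = n + m + 1 by omega]; exact .inv ha this

theorem union (h : SLP S n T) (h' : SLP S m U) : SLP S (n + m) (T ∪ U) :=
  h.bind fun S' hS hT => by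
    have := (h'.mono_left hS).bind (m := 0) (U := T ∪ U)
      fun S'' hS' hU => .done 0 (Set.union_subset (hT.trans hS') hU)
    simpa using this

theorem iUnion_range {N c : ℕ} {f : ℕ → Set R} (h : ∀ i < N, SLP S c (f i)) :
    SLP S (N * c) (⋃ i < N, f i) := by
  induction N with
  | zero => exact .done _ (by simp)
  | succ N ih =>
    have := (ih fun i hi => h i (by omega)).union (h N (by omega))
    rw [Nat.succ_mul]
    refine this.mono_right ?_
    intro x hx
    simp only [Set.mem_iUnion] at hx
    obtain ⟨i, hi, hx⟩ := hx
    rcases Nat.lt_succ_iff_lt_or_eq.1 hi with hi | rfl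
    · exact Or.inl (by simp only [Set.mem_iUnion]; exact ⟨i, hi, hx⟩)
    · exact Or.inr hx

theorem of_forall_lt {N c : ℕ} {f : ℕ → Set R} (h : ∀ i < N, SLP S c (f i))
    (hT : ∀ x ∈ T, x ∈ S ∨ ∃ i < N, x ∈ f i) : SLP S (N * c) T := by
  have := (iUnion_range h).bind (m := 0) (U := T) fun S' hS hf => .done 0 fun x hx => by
    rcases hT x hx with hx | ⟨i, hi, hx⟩
    · exact hS hx
    · exact hf (by simp only [Set.mem_iUnion]; exact ⟨i, hi, hx⟩)
  simpa using this

theorem range_nat {N c : ℕ} {f : ℕ → R} (h : ∀ i < N, SLP S c {f i}) (h' : ∀ i, N ≤ i → f i ∈ S) :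
    SLP S (N * c) (Set.range f) :=
  of_forall_lt h <| by
    rintro _ ⟨i, rfl⟩
    rcases lt_or_ge i N with hi | hi
    · exact Or.inr ⟨i, hi, rfl⟩
    · exact Or.inl (h' i hi)

theorem single_one : SLP S 1 {1} := .one (.done 0 (by simp))

theorem single_add (ha : a ∈ S) (hb : b ∈ S) : SLP S 1 {a + b} := .add ha hb (.done 0 (by simp))

theorem single_sub (ha : a ∈ S) (hb : b ∈ S) : SLP S 1 {a - b} := .sub ha hb (.done 0 (by simp))

theorem single_mul (ha : a ∈ S) (hb : b ∈ S) : SLP S 1 {a * b} := .mul ha hb (.done 0 (by simp))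

theorem single_inv (ha : a ∈ S) : SLP S 1 {a⁻¹} := .inv ha (.done 0 (by simp))

theorem single_mem (ha : a ∈ S) : SLP S 0 {a} := .done 0 (by simpa using ha)

theorem bindSingle (h : SLP S n {a}) (k : ∀ S', S ⊆ S' → a ∈ S' → SLP S' m U) :
    SLP S (n + m) U :=
  h.bind fun S' hS ha => k S' hS (ha rfl)

theorem add' (h : SLP S n {a}) (h' : SLP S m {b}) : SLP S (n + m + 1) {a + b} :=
  (h.union h').bind fun _ _ hT => single_add (hT (by simp)) (hT (by simp))

theorem sub' (h : SLP S n {a}) (h' : SLP S m {b}) : SLP S (n + m + 1) {a - b} :=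
  (h.union h').bind fun _ _ hT => single_sub (hT (by simp)) (hT (by simp))

theorem mul' (h : SLP S n {a}) (h' : SLP S m {b}) : SLP S (n + m + 1) {a * b} :=
  (h.union h').bind fun _ _ hT => single_mul (hT (by simp)) (hT (by simp))

theorem single_sum {N c : ℕ} {f : ℕ → R} (h0 : (0 : R) ∈ S) (h : ∀ i < N, SLP S c {f i}) :
    SLP S (N * (c + 1)) {∑ i ∈ Finset.range N, f i} := by
  induction N with
  | zero => exact .done _ (by simpa using h0)
  | succ N ih =>
    rw [Finset.sum_range_succ, Nat.succ_mul]
    exact (ih fun i hi => h i (by omega)).add' (h N (by omega))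

theorem single_pow (ha : a ∈ S) (N : ℕ) : SLP S (N + 1) {a ^ N} := by
  induction N with
  | zero => simpa using single_one
  | succ N ih => rw [pow_succ]; exact ih.mul' (single_mem ha)

end

end SLP

/-! ### Compilation of programs into reversible circuits -/

namespace RevGate

variable {W : Type} [DecidableEq W]

theorem toPerm_symm (F : Type*) [Field F] (g : RevGate W) : g.symm.toPerm F = (g.toPerm F).symm := by
  ext x; rfl

/-- The gate that adds (or subtracts) the value of `o` to the wire `t`. -/
def ofOp (t : W) (o : FieldOp W) (n : Bool) (h : t ∉ o.reads) : RevGate W := ⟨t, o, n, h⟩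

end RevGate

namespace RevCircuit

variable {W : Type} [DecidableEq W] (F : Type*) [Field F]

theorem toPerm_append (c d : RevCircuit W) :
    toPerm F (c ++ d) = (toPerm F c).trans (toPerm F d) := by
  induction c with
  | nil => rfl
  | cons g c ih => simp only [List.cons_append, toPerm, ih, Equiv.trans_assoc]

theorem toPerm_reverse_symm (c : RevCircuit W) :
    toPerm F (c.map RevGate.symm).reverse = (toPerm F c).symm := by
  induction c with
  | nil => rfl
  | cons g c ih =>
    simp only [List.map_cons, List.reverse_cons, toPerm_append, ih, toPerm, RevGate.toPerm_symm]
    rfl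

end RevCircuit

section Compile

variable {ι : Type*} {K : ι → Type*} {I O : Type}

/-- The values that are held by the input wires and the first `t` ancilla wires. -/
def wireValues {s : ℕ} (x : I → ∀ i, K i) (σ : Fin s → ∀ i, K i) (t : ℕ) : Set (∀ i, K i) :=
  Set.range x ∪ σ '' {j | (j : ℕ) < t}

/-- The wire differs from ancilla `t`, so it keeps its value while ancilla `t` is being written; two
gates in a row may therefore target that ancilla. -/
theorem exists_wire {s t : ℕ} (ht : t < s) (x : I → ∀ i, K i) (σ : Fin s → ∀ i, K i)
    {a : ∀ i, K i} (ha : a ∈ wireValues x σ t) :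
    ∃ w : I ⊕ O ⊕ Fin s, w ≠ .inr (.inr ⟨t, ht⟩) ∧
      ∀ i (y : O → K i) (z : K i),
        Sum.elim (fun j => x j i)
          (Sum.elim y (Function.update (fun j => σ j i) ⟨t, ht⟩ z)) w = a i := by
  rcases ha with ⟨j, rfl⟩ | ⟨j, hj, rfl⟩
  · exact ⟨.inl j, by simp, fun i y z => rfl⟩
  · refine ⟨.inr (.inr j), ?_, fun i y z => ?_⟩
    · intro h
      simp only [Sum.inr.injEq] at h
      subst h
      exact (lt_irrefl t hj).elim
    · have : j ≠ ⟨t, ht⟩ := by rintro rfl; exact (lt_irrefl t hj).elim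
      simp only [Sum.elim_inr]
      exact Function.update_of_ne this _ _

variable [∀ i, Field (K i)] [DecidableEq I] [DecidableEq O]

theorem apply_ofOp {s : ℕ} {F : Type*} [Field F] (t : Fin s) (o : FieldOp (I ⊕ O ⊕ Fin s))
    (n : Bool) (h) (x : I → F) (y : O → F) (σ : Fin s → F) :
    (RevGate.ofOp (.inr (.inr t)) o n h).toPerm F (Sum.elim x (Sum.elim y σ)) =
      Sum.elim x (Sum.elim y (Function.update σ t
        (if n then σ t - o.eval (Sum.elim x (Sum.elim y σ))
          else σ t + o.eval (Sum.elim x (Sum.elim y σ))))) := by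
  change RevGate.apply _ _ = _
  simp only [RevGate.apply, RevGate.ofOp]
  rw [← Sum.elim_update_right, ← Sum.elim_update_right]
  rfl

/-- Each instruction writes its result into the first unused ancilla `t`. A gate adds a single
operand, so a sum or difference takes two gates, whence the factor 2. The circuit is chosen before
the factor `i`: the wires to be read depend only on where the elements of the product ring are held.
-/
theorem exists_gates {s : ℕ} (x : I → ∀ i, K i) {S T : Set (∀ i, K i)} {n : ℕ} (h : SLP S n T) :
    ∀ (t : ℕ) (σ : Fin s → ∀ i, K i), t + n ≤ s → S ⊆ wireValues x σ t →
      (∀ j : Fin s, t ≤ j → σ j = 0) →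
      ∃ (c : RevCircuit (I ⊕ O ⊕ Fin s)) (σ' : Fin s → ∀ i, K i), c.length ≤ 2 * n ∧
        (∀ i (y : O → K i), RevCircuit.toPerm (K i) c
          (Sum.elim (fun j => x j i) (Sum.elim y fun j => σ j i)) =
            Sum.elim (fun j => x j i) (Sum.elim y fun j => σ' j i)) ∧
        T ⊆ wireValues x σ' s := by
  -- The part of the induction common to all instructions: if some two gates put `a` into the fresh
  -- ancilla, the circuit for the rest of the program can be appended.
  have key : ∀ {S T : Set (∀ i, K i)} {n : ℕ} {a : ∀ i, K i},
      (∀ (t : ℕ) (ht : t < s) (σ : Fin s → ∀ i, K i), S ⊆ wireValues x σ t → σ ⟨t, ht⟩ = 0 →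
        ∃ c : RevCircuit (I ⊕ O ⊕ Fin s), c.length ≤ 2 ∧ ∀ i (y : O → K i),
          RevCircuit.toPerm (K i) c (Sum.elim (fun j => x j i) (Sum.elim y fun j => σ j i)) =
            Sum.elim (fun j => x j i) (Sum.elim y
              (Function.update (fun j => σ j i) ⟨t, ht⟩ (a i)))) →
      (∀ (t : ℕ) (σ : Fin s → ∀ i, K i), t + n ≤ s → insert a S ⊆ wireValues x σ t →
        (∀ j : Fin s, t ≤ j → σ j = 0) →
        ∃ (c : RevCircuit (I ⊕ O ⊕ Fin s)) (σ' : Fin s → ∀ i, K i), c.length ≤ 2 * n ∧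
          (∀ i (y : O → K i), RevCircuit.toPerm (K i) c
            (Sum.elim (fun j => x j i) (Sum.elim y fun j => σ j i)) =
              Sum.elim (fun j => x j i) (Sum.elim y fun j => σ' j i)) ∧
          T ⊆ wireValues x σ' s) →
      ∀ (t : ℕ) (σ : Fin s → ∀ i, K i), t + (n + 1) ≤ s → S ⊆ wireValues x σ t →
        (∀ j : Fin s, t ≤ j → σ j = 0) →
        ∃ (c : RevCircuit (I ⊕ O ⊕ Fin s)) (σ' : Fin s → ∀ i, K i), c.length ≤ 2 * (n + 1) ∧
          (∀ i (y : O → K i), RevCircuit.toPerm (K i) c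
            (Sum.elim (fun j => x j i) (Sum.elim y fun j => σ j i)) =
              Sum.elim (fun j => x j i) (Sum.elim y fun j => σ' j i)) ∧
          T ⊆ wireValues x σ' s := by
    intro S T n a hgate ih t σ ht hS h0
    have hts : t < s := by omega
    obtain ⟨c₁, hc₁, h₁⟩ := hgate t hts σ hS (h0 _ le_rfl)
    have hup : ∀ i, (fun j => Function.update σ ⟨t, hts⟩ a j i) =
        Function.update (fun j => σ j i) ⟨t, hts⟩ (a i) := by
      intro i
      funext j
      by_cases hj : j = ⟨t, hts⟩
      · subst hj; simp
      · simp [hj]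
    obtain ⟨c₂, σ', hc₂, h₂, hT⟩ := ih (t + 1) (Function.update σ ⟨t, hts⟩ a) (by omega)
      (by
        rintro b (rfl | hb)
        · exact Or.inr ⟨⟨t, hts⟩, Nat.lt_succ_self t, Function.update_self ..⟩
        · rcases hS hb with hb | ⟨j, hj, rfl⟩
          · exact Or.inl hb
          · have hj' : (j : ℕ) < t := hj
            refine Or.inr ⟨j, Nat.lt_succ_of_lt hj', Function.update_of_ne ?_ _ _⟩
            rintro rfl
            exact lt_irrefl _ hj')
      (by
        intro j hj
        rw [Function.update_of_ne]
        · exact h0 j (by omega)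
        · rintro rfl
          simp at hj)
    refine ⟨c₁ ++ c₂, σ', by simp; omega, fun i y => ?_, hT⟩
    rw [RevCircuit.toPerm_append, Equiv.trans_apply, h₁, ← h₂ i y, hup]
  induction h with
  | @done S T n h =>
    intro t σ ht hS h0
    refine ⟨[], σ, by simp, fun i y => rfl, fun a ha => ?_⟩
    rcases hS (h ha) with hb | ⟨j, hj, rfl⟩
    · exact Or.inl hb
    · exact Or.inr ⟨j, j.2, rfl⟩
  | one _ ih =>
    refine key (fun t ht σ hS h0 => ?_) ih
    refine ⟨[RevGate.ofOp (.inr (.inr ⟨t, ht⟩)) .one false (by simp [FieldOp.reads])], by simp,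
      fun i y => ?_⟩
    simp only [RevCircuit.toPerm, Equiv.trans_apply, apply_ofOp, Equiv.refl_apply]
    simp only [h0, FieldOp.eval, Pi.zero_apply, zero_add, Bool.false_eq_true, if_false, Pi.one_apply]
  | add ha hb _ ih =>
    refine key (fun t ht σ hS h0 => ?_) ih
    obtain ⟨u, hu, hu'⟩ := exists_wire (O := O) ht x σ (hS ha)
    obtain ⟨v, hv, hv'⟩ := exists_wire (O := O) ht x σ (hS hb)
    refine ⟨[RevGate.ofOp (.inr (.inr ⟨t, ht⟩)) (.read u) false
        (by simpa [FieldOp.reads] using hu.symm),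
      RevGate.ofOp (.inr (.inr ⟨t, ht⟩)) (.read v) false (by simpa [FieldOp.reads] using hv.symm)],
      by simp, fun i y => ?_⟩
    have hu0 := hu' i y (σ ⟨t, ht⟩ i)
    rw [Function.update_eq_self] at hu0
    simp only [RevCircuit.toPerm, Equiv.trans_apply, apply_ofOp, Equiv.refl_apply, FieldOp.eval,
      hu0, hv', Function.update_idem, Function.update_self]
    simp only [h0, Pi.zero_apply, zero_add, Bool.false_eq_true, if_false,
      Pi.add_apply]
  | sub ha hb _ ih =>
    refine key (fun t ht σ hS h0 => ?_) ih
    obtain ⟨u, hu, hu'⟩ := exists_wire (O := O) ht x σ (hS ha)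
    obtain ⟨v, hv, hv'⟩ := exists_wire (O := O) ht x σ (hS hb)
    refine ⟨[RevGate.ofOp (.inr (.inr ⟨t, ht⟩)) (.read u) false
        (by simpa [FieldOp.reads] using hu.symm),
      RevGate.ofOp (.inr (.inr ⟨t, ht⟩)) (.read v) true
        (by simpa [FieldOp.reads] using hv.symm)],
      by simp, fun i y => ?_⟩
    have hu0 := hu' i y (σ ⟨t, ht⟩ i)
    rw [Function.update_eq_self] at hu0
    simp only [RevCircuit.toPerm, Equiv.trans_apply, apply_ofOp, Equiv.refl_apply, FieldOp.eval,
      hu0, hv', Function.update_idem, Function.update_self]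
    simp only [h0, Pi.zero_apply, zero_add, Bool.false_eq_true, if_false, if_true,
      Pi.sub_apply]
  | mul ha hb _ ih =>
    refine key (fun t ht σ hS h0 => ?_) ih
    obtain ⟨u, hu, hu'⟩ := exists_wire (O := O) ht x σ (hS ha)
    obtain ⟨v, hv, hv'⟩ := exists_wire (O := O) ht x σ (hS hb)
    refine ⟨[RevGate.ofOp (.inr (.inr ⟨t, ht⟩)) (.mul u v) false
      (by simpa [FieldOp.reads] using ⟨hu.symm, hv.symm⟩)], by simp, fun i y => ?_⟩
    have hu0 := hu' i y (σ ⟨t, ht⟩ i)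
    have hv0 := hv' i y (σ ⟨t, ht⟩ i)
    rw [Function.update_eq_self] at hu0 hv0
    simp only [RevCircuit.toPerm, Equiv.trans_apply, apply_ofOp, Equiv.refl_apply, FieldOp.eval,
      hu0, hv0]
    simp only [h0, Pi.zero_apply, zero_add, Bool.false_eq_true, if_false,
      Pi.mul_apply]
  | inv ha _ ih =>
    refine key (fun t ht σ hS h0 => ?_) ih
    obtain ⟨u, hu, hu'⟩ := exists_wire (O := O) ht x σ (hS ha)
    refine ⟨[RevGate.ofOp (.inr (.inr ⟨t, ht⟩)) (.inv u) false
      (by simpa [FieldOp.reads] using hu.symm)], by simp, fun i y => ?_⟩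
    have hu0 := hu' i y (σ ⟨t, ht⟩ i)
    rw [Function.update_eq_self] at hu0
    simp only [RevCircuit.toPerm, Equiv.trans_apply, apply_ofOp, Equiv.refl_apply, FieldOp.eval,
      hu0]
    simp only [h0, Pi.zero_apply, zero_add, Bool.false_eq_true, if_false,
      Pi.inv_apply]

/-- Copying available values to the output wires. -/
theorem exists_copy {s m : ℕ} (x : I → ∀ i, K i) (σ : Fin s → ∀ i, K i) (v : Fin m → ∀ i, K i)
    (hv : Set.range v ⊆ wireValues x σ s) :
    ∃ c : RevCircuit (I ⊕ Fin m ⊕ Fin s), c.length ≤ m ∧ ∀ i (y : Fin m → K i),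
      RevCircuit.toPerm (K i) c (Sum.elim (fun j => x j i) (Sum.elim y fun j => σ j i)) =
        Sum.elim (fun j => x j i) (Sum.elim (y + fun j => v j i) fun j => σ j i) := by
  have key : ∀ l : List (Fin m), l.Nodup → ∃ c : RevCircuit (I ⊕ Fin m ⊕ Fin s),
      c.length = l.length ∧ ∀ i (y : Fin m → K i),
      RevCircuit.toPerm (K i) c (Sum.elim (fun j => x j i) (Sum.elim y fun j => σ j i)) =
        Sum.elim (fun j => x j i)
          (Sum.elim (fun j => if j ∈ l then y j + v j i else y j) fun j => σ j i) := by
    intro l hl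
    induction l with
    | nil => exact ⟨[], rfl, fun i y => by simp [RevCircuit.toPerm]⟩
    | cons o l ih =>
      obtain ⟨c, hc, h⟩ := ih hl.of_cons
      have ho : o ∉ l := (List.nodup_cons.1 hl).1
      obtain ⟨w, hw, hw'⟩ : ∃ w : I ⊕ Fin m ⊕ Fin s, w ≠ .inr (.inl o) ∧
          ∀ i (y : Fin m → K i),
            Sum.elim (fun j => x j i) (Sum.elim y fun j => σ j i) w = v o i := by
        rcases hv ⟨o, rfl⟩ with ⟨j, hj⟩ | ⟨j, -, hj⟩
        · exact ⟨.inl j, by simp, fun i y => congrFun hj i⟩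
        · exact ⟨.inr (.inr j), by simp, fun i y => congrFun hj i⟩
      refine ⟨RevGate.ofOp (.inr (.inl o)) (.read w) false
        (by simpa [FieldOp.reads] using hw.symm) :: c, by simp [hc], fun i y => ?_⟩
      have : (RevGate.ofOp (.inr (.inl o)) (.read w) false
          (by simpa [FieldOp.reads] using hw.symm)).toPerm (K i)
            (Sum.elim (fun j => x j i) (Sum.elim y fun j => σ j i)) =
          Sum.elim (fun j => x j i) (Sum.elim (Function.update y o (y o + v o i))
            fun j => σ j i) := by
        change RevGate.apply _ _ = _
        simp only [RevGate.apply, RevGate.ofOp, FieldOp.eval, hw']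
        rw [← Sum.elim_update_right, ← Sum.elim_update_left]
        rfl
      rw [RevCircuit.toPerm, Equiv.trans_apply, this, h]
      congr 2
      funext j
      by_cases hj : j = o
      · subst hj; simp [ho]
      · simp [hj]
  obtain ⟨c, hc, h⟩ := key (List.finRange m) (List.nodup_finRange m)
  refine ⟨c, by simp [hc], fun i y => ?_⟩
  rw [h]
  congr 2
  funext j
  simp

/-- A straight-line program over a product of fields yields one reversible circuit that works over
all the factors: compute, copy the outputs, uncompute. -/
theorem exists_circuit {m n : ℕ} (x : I → ∀ i, K i) (v : Fin m → ∀ i, K i)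
    (h : SLP (Set.range x) n (Set.range v)) :
    ∃ (s : ℕ) (c : RevCircuit (I ⊕ Fin m ⊕ Fin s)), c.length ≤ 4 * n + m ∧
      ∀ i, c.Computes (fun j => x j i) (fun j => v j i) := by
  obtain ⟨c, σ, hc, h₁, hT⟩ := exists_gates (O := Fin m) (s := n) x h 0 0 (by simp)
    Set.subset_union_left (by simp)
  obtain ⟨d, hd, h₂⟩ := exists_copy x σ v hT
  refine ⟨n, c ++ d ++ (c.map RevGate.symm).reverse, by simp; omega, fun i y => ?_⟩
  have h₁' : ∀ y, RevCircuit.toPerm (K i) c (Sum.elim (fun j => x j i) (Sum.elim y 0)) = _ := h₁ i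
  rw [RevCircuit.toPerm_append, RevCircuit.toPerm_append, RevCircuit.toPerm_reverse_symm,
    Equiv.trans_apply, Equiv.trans_apply, h₁', h₂, Equiv.symm_apply_eq, h₁']

end Compile

/-! ### Quasilinear cost bounds -/

/-- `f n` is bounded by `p ^ n` up to a factor that is polynomial in `n`. -/
def QL (p : ℕ) (f : ℕ → ℕ) : Prop := ∃ C a : ℕ, ∀ n, f n ≤ C * p ^ n * (n + 1) ^ a

namespace QL

variable {p : ℕ} {f g : ℕ → ℕ}

theorem mono (hf : QL p f) (h : ∀ n, g n ≤ f n) : QL p g := by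
  obtain ⟨C, a, hC⟩ := hf
  exact ⟨C, a, fun n => (h n).trans (hC n)⟩

theorem add (hf : QL p f) (hg : QL p g) : QL p (fun n => f n + g n) := by
  obtain ⟨C, a, hC⟩ := hf
  obtain ⟨D, b, hD⟩ := hg
  refine ⟨C + D, max a b, fun n => ?_⟩
  have h1 : (n + 1) ^ a ≤ (n + 1) ^ max a b := Nat.pow_le_pow_right (by omega) (le_max_left _ _)
  have h2 : (n + 1) ^ b ≤ (n + 1) ^ max a b := Nat.pow_le_pow_right (by omega) (le_max_right _ _)
  calc f n + g n ≤ C * p ^ n * (n + 1) ^ a + D * p ^ n * (n + 1) ^ b := add_le_add (hC n) (hD n)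
    _ ≤ C * p ^ n * (n + 1) ^ max a b + D * p ^ n * (n + 1) ^ max a b := by gcongr
    _ = _ := by ring

theorem poly_mul (hf : QL p f) (c b : ℕ) : QL p (fun n => c * (n + 1) ^ b * f n) := by
  obtain ⟨C, a, hC⟩ := hf
  refine ⟨c * C, b + a, fun n => ?_⟩
  calc c * (n + 1) ^ b * f n ≤ c * (n + 1) ^ b * (C * p ^ n * (n + 1) ^ a) := by gcongr; exact hC n
    _ = _ := by ring

theorem const_mul (hf : QL p f) (c : ℕ) : QL p (fun n => c * f n) := by
  simpa using hf.poly_mul c 0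

theorem pow : QL p (fun n => p ^ n) := ⟨1, 0, fun n => by simp⟩

theorem const (hp : 1 ≤ p) (c : ℕ) : QL p (fun _ => c) :=
  ⟨c, 0, fun n => by simpa using Nat.le_mul_of_pos_right c (by positivity)⟩

theorem succ (hf : QL p f) : QL p (fun n => f (n + 1)) := by
  obtain ⟨C, a, hC⟩ := hf
  refine ⟨C * p * 2 ^ a, a, fun n => ?_⟩
  calc f (n + 1) ≤ C * p ^ (n + 1) * (n + 1 + 1) ^ a := hC _
    _ ≤ C * p ^ (n + 1) * (2 * (n + 1)) ^ a := by gcongr; omega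
    _ = _ := by rw [mul_pow]; ring

/-- Each of the `n` levels of a binary recursion contributes about `2 ^ n` times a polynomial in
`n`, so the exponent of `n + 1` rises by one. -/
theorem of_two_mul (hg : QL 2 g) (h : ∀ n, f (n + 1) ≤ 2 * f n + g n) : QL 2 f := by
  obtain ⟨C, a, hC⟩ := hg
  refine ⟨f 0 + C, a + 1, fun n => ?_⟩
  induction n with
  | zero => simp
  | succ n ih =>
    have h1 : (n + 1) ^ (a + 1) + (n + 1) ^ a ≤ (n + 1 + 1) ^ (a + 1) := by
      calc (n + 1) ^ (a + 1) + (n + 1) ^ a = (n + 1) ^ a * (n + 1 + 1) := by ring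
        _ ≤ (n + 1 + 1) ^ a * (n + 1 + 1) := by gcongr; omega
        _ = _ := by ring
    calc f (n + 1) ≤ 2 * f n + g n := h n
      _ ≤ 2 * ((f 0 + C) * 2 ^ n * (n + 1) ^ (a + 1)) + C * 2 ^ n * (n + 1) ^ a := by
        gcongr; exact hC n
      _ ≤ 2 * ((f 0 + C) * 2 ^ n * (n + 1) ^ (a + 1)) +
          2 * ((f 0 + C) * 2 ^ n * (n + 1) ^ a) := by
        have : C * 2 ^ n * (n + 1) ^ a ≤ (f 0 + C) * 2 ^ n * (n + 1) ^ a := by gcongr; omega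
        omega
      _ = (f 0 + C) * 2 ^ (n + 1) * ((n + 1) ^ (a + 1) + (n + 1) ^ a) := by ring
      _ ≤ _ := by gcongr

theorem of_add (hg : QL 2 g) (h : ∀ n, f (n + 1) ≤ f n + g n) : QL 2 f :=
  hg.of_two_mul fun n => (h n).trans (by omega)

/-- A quasilinear bound in terms of the number of inputs. -/
theorem comp_clog (hf : QL 2 f) :
    ∃ A a : ℕ, ∀ m, 1 ≤ m → f (Nat.clog 2 m) ≤ A * m * (Nat.log 2 m + 1) ^ a := by
  obtain ⟨C, a, hC⟩ := hf
  refine ⟨C * 2 * 2 ^ a, a, fun m hm => (hC _).trans ?_⟩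
  have h1 : Nat.clog 2 m ≤ Nat.log 2 m + 1 := by
    refine Nat.clog_le_of_le_pow ?_
    exact (Nat.lt_pow_succ_log_self (by norm_num) m).le
  have h2 : 2 ^ Nat.clog 2 m ≤ 2 * m := by
    calc 2 ^ Nat.clog 2 m ≤ 2 ^ (Nat.log 2 m + 1) := Nat.pow_le_pow_right (by norm_num) h1
      _ = 2 * 2 ^ Nat.log 2 m := by ring
      _ ≤ 2 * m := by gcongr; exact Nat.pow_log_le_self 2 (by omega)
  calc C * 2 ^ Nat.clog 2 m * (Nat.clog 2 m + 1) ^ a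
      ≤ C * (2 * m) * (2 * (Nat.log 2 m + 1)) ^ a := by gcongr; omega
    _ = _ := by rw [mul_pow]; ring

end QL

/-! ### Fourier transforms over `R[y]/(y ^ Q - 1)` -/

theorem sum_range_mul_add {M : Type*} [AddCommMonoid M] (n p : ℕ) (h : ℕ → M) :
    ∑ k ∈ Finset.range (p * n), h k =
      ∑ j ∈ Finset.range n, ∑ r ∈ Finset.range p, h (p * j + r) := by
  induction n with
  | zero => simp
  | succ n ih => rw [Nat.mul_succ, Finset.sum_range_add, ih, Finset.sum_range_succ]

section Cyclic

variable {R : Type*} [CommRing R] {Q : ℕ}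

/-- The element `y ^ t` of `R[y]/(y ^ Q - 1)`. -/
noncomputable def rot (R : Type*) [CommRing R] {Q : ℕ} (t : ZMod Q) :
    AddMonoidAlgebra R (ZMod Q) :=
  AddMonoidAlgebra.single t 1

theorem rot_add (t u : ZMod Q) : rot R (t + u) = rot R t * rot R u := by
  simp [rot, AddMonoidAlgebra.single_mul_single]

theorem rot_zero : rot R (0 : ZMod Q) = 1 := rfl

theorem rot_nsmul (n : ℕ) (t : ZMod Q) : rot R (n • t) = rot R t ^ n := by
  simp [rot, AddMonoidAlgebra.single_pow]

theorem coeff_rot_mul (t g : ZMod Q) (z : AddMonoidAlgebra R (ZMod Q)) :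
    (rot R t * z).coeff g = z.coeff (-t + g) := by
  rw [rot, AddMonoidAlgebra.coeff_single_mul_apply, one_mul]

/-- The discrete Fourier transform of `f` of length `N` at the powers of `y ^ t`. -/
noncomputable def dft (N : ℕ) (t : ZMod Q) (f : ℕ → AddMonoidAlgebra R (ZMod Q)) (i : ℕ) :
    AddMonoidAlgebra R (ZMod Q) :=
  ∑ j ∈ Finset.range N, rot R ((i * j) • t) * f j

/-- Decimation in time (Cooley–Tukey): the input indices are sorted by their residue modulo `p`. -/
theorem dft_mul (N p : ℕ) (t : ZMod Q) (f : ℕ → AddMonoidAlgebra R (ZMod Q)) (i : ℕ) :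
    dft (p * N) t f i = ∑ r ∈ Finset.range p, rot R ((i * r) • t) *
      dft N (p • t) (fun j => f (p * j + r)) i := by
  simp only [dft, sum_range_mul_add, Finset.mul_sum]
  rw [Finset.sum_comm]
  refine Finset.sum_congr rfl fun r _ => Finset.sum_congr rfl fun j _ => ?_
  rw [← mul_assoc, ← rot_add, ← mul_nsmul', ← add_nsmul]
  congr 3
  ring

theorem dft_mod {N : ℕ} {t : ZMod Q} (ht : N • t = 0) (f : ℕ → AddMonoidAlgebra R (ZMod Q))
    (i : ℕ) : dft N t f (i % N) = dft N t f i := by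
  refine Finset.sum_congr rfl fun j _ => ?_
  congr 2
  conv_rhs => rw [← Nat.mod_add_div i N]
  rw [add_mul, add_nsmul, show N * (i / N) * j = i / N * j * N by ring, mul_nsmul' _ _ N, ht,
    nsmul_zero, add_zero]

variable [Inv R]

theorem SLP.cyclic [NeZero Q] {S : Set R} {c : ℕ} {z : AddMonoidAlgebra R (ZMod Q)}
    (h : ∀ g, SLP S c {z.coeff g}) : SLP S (Q * c) (Set.range z.coeff) := by
  refine SLP.of_forall_lt (f := fun i => {z.coeff (i : ZMod Q)}) (fun i _ => h _) ?_
  rintro _ ⟨g, rfl⟩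
  exact Or.inr ⟨g.val, g.val_lt, by simp⟩

/-- Multiplication by a power of `y` only permutes coefficients, so it costs no instruction. Each of
the `s` levels forms `p ^ s` elements with `Q` coefficients, each a sum of `p` available terms. By
periodicity these finitely many values account for all indices `i`. -/
theorem SLP.fft [NeZero Q] {p : ℕ} (s : ℕ) (t : ZMod Q) (f : ℕ → AddMonoidAlgebra R (ZMod Q))
    {S : Set R} (ht : p ^ s • t = 0) (h0 : 0 ∈ S)
    (hf : ∀ j < p ^ s, Set.range (f j).coeff ⊆ S) :
    SLP S (s * p ^ s * (Q * p)) (⋃ i, Set.range (dft (p ^ s) t f i).coeff) := by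
  induction s generalizing t f S with
  | zero =>
    refine .done _ (Set.iUnion_subset fun i => ?_)
    have : dft (p ^ 0) t f i = f 0 := by simp [dft, rot_zero]
    rw [this]
    exact hf 0 (by simp)
  | succ s ih =>
    have key : ∀ r < p, SLP S (s * p ^ s * (Q * p))
        (⋃ i, Set.range (dft (p ^ s) (p • t) (fun j => f (p * j + r)) i).coeff) := by
      intro r hr
      refine ih _ _ (by rw [← mul_nsmul', ← pow_succ, ht]) h0 fun j hj => hf _ ?_
      calc p * j + r < p * j + p := by omega
        _ = p * (j + 1) := by ring
        _ ≤ p * p ^ s := by gcongr; omega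
        _ = p ^ (s + 1) := by ring
    refine ((SLP.iUnion_range key).bind (m := p ^ (s + 1) * (Q * p)) fun S' hS hT => ?_).mono
      (le_of_eq (by ring))
    have hp : 0 < p ^ (s + 1) ∨ p = 0 := by
      rcases Nat.eq_zero_or_pos p with rfl | h
      · exact Or.inr rfl
      · exact Or.inl (by positivity)
    refine SLP.of_forall_lt (f := fun i => Set.range (dft (p ^ (s + 1)) t f i).coeff)
      (fun i _ => SLP.cyclic fun g => ?_) ?_
    · rw [pow_succ', dft_mul, AddMonoidAlgebra.coeff_sum, Finsupp.finsetSum_apply]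
      have := SLP.single_sum (S := S') (c := 0) (N := p) (f := fun r =>
        (rot R ((i * r) • t) * dft (p ^ s) (p • t) (fun j => f (p * j + r)) i).coeff g)
        (hS h0) (fun r hr => SLP.single_mem ?_)
      · simpa using this
      · rw [coeff_rot_mul]
        refine hT ?_
        simp only [Set.mem_iUnion]
        exact ⟨r, hr, i, _, rfl⟩
    · intro x hx
      obtain ⟨i, g, rfl⟩ := Set.mem_iUnion.1 hx
      rcases hp with hp | rfl
      · exact Or.inr ⟨i % p ^ (s + 1), Nat.mod_lt _ hp, g, by rw [dft_mod ht]⟩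
      · left
        simpa [dft] using hS h0

end Cyclic

section Invert

variable {R : Type*} [CommRing R] {p : ℕ}

/-- The gcd of `l` and `p ^ (s + 1)` is `p ^ v` with `v ≤ s`, so Bézout gives `p ^ v`, which is then
scaled up to `p ^ s`. In terms of roots of unity: every nontrivial power of the root has a further
power equal to `y ^ H` with `H = Q / p`. -/
theorem exists_mul_modEq_pow {l s : ℕ} (hp : p.Prime) (hl : ¬ p ^ (s + 1) ∣ l) :
    ∃ n, n * l ≡ p ^ s [MOD p ^ (s + 1)] := by
  obtain ⟨v, hv, hv'⟩ := (Nat.dvd_prime_pow hp).1 (Nat.gcd_dvd_right l (p ^ (s + 1)))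
  have hvs : v ≤ s := by
    by_contra h
    have : v = s + 1 := by omega
    subst this
    exact hl (hv' ▸ Nat.gcd_dvd_left _ _)
  obtain ⟨m, -, hm⟩ := Nat.exists_mul_mod_eq_gcd (k := p ^ (s + 1)) (n := l)
    (by rw [hv']; exact Nat.pow_lt_pow_right hp.one_lt (by omega))
  refine ⟨p ^ (s - v) * m, ?_⟩
  have h1 : l * m ≡ p ^ v [MOD p ^ (s + 1)] := by
    rw [hv'] at hm
    rw [Nat.ModEq, hm, Nat.mod_eq_of_lt (Nat.pow_lt_pow_right hp.one_lt (by omega))]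
  have := h1.mul_left (p ^ (s - v))
  rw [← pow_add, Nat.sub_add_cancel hvs] at this
  convert this using 1
  ring

/-- The element `1 - y ^ H`, with `Q = p * H`, kills the sums over nontrivial powers of a root of
unity. -/
theorem one_sub_rot_mul_sum {κ s l : ℕ} (hp : p.Prime) (hs : s < κ) (hl : ¬ p ^ (s + 1) ∣ l) :
    (1 - rot R ((p ^ (κ - 1) : ℕ) : ZMod (p ^ κ))) * ∑ i ∈ Finset.range (p ^ (s + 1)),
      rot R (i • l • ((p ^ (κ - (s + 1)) : ℕ) : ZMod (p ^ κ))) = 0 := by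
  obtain ⟨n, hn⟩ := exists_mul_modEq_pow hp hl
  set u : ZMod (p ^ κ) := l • ((p ^ (κ - (s + 1)) : ℕ) : ZMod (p ^ κ)) with hu
  have hnu : n • u = ((p ^ (κ - 1) : ℕ) : ZMod (p ^ κ)) := by
    have h1 := hn.mul_right' (p ^ (κ - (s + 1)))
    rw [← pow_add, ← pow_add, show s + (κ - (s + 1)) = κ - 1 by omega,
      show s + 1 + (κ - (s + 1)) = κ by omega] at h1
    have h2 := (ZMod.natCast_eq_natCast_iff _ _ _).2 h1
    rw [← h2, hu]
    push_cast
    simp only [nsmul_eq_mul]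
    ring
  have hDu : p ^ (s + 1) • u = 0 := by
    rw [hu]
    simp only [nsmul_eq_mul]
    have : ((p ^ κ : ℕ) : ZMod (p ^ κ)) = 0 := ZMod.natCast_self _
    calc ((p ^ (s + 1) : ℕ) : ZMod (p ^ κ)) * (l * ((p ^ (κ - (s + 1)) : ℕ) : ZMod (p ^ κ)))
        = l * ((p ^ (s + 1) * p ^ (κ - (s + 1)) : ℕ) : ZMod (p ^ κ)) := by push_cast; ring
      _ = 0 := by rw [← pow_add, show s + 1 + (κ - (s + 1)) = κ by omega, this, mul_zero]
  -- Since `n • u` is the exponent `H`, the element `1 - y ^ H` is a multiple of `1 - y ^ u`, and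
  -- the latter telescopes the sum to `1 - y ^ (p ^ (s + 1) • u) = 0`.
  obtain ⟨z, hz⟩ := one_sub_dvd_one_sub_pow (rot R u) n
  rw [← hnu, rot_nsmul, hz]
  simp only [rot_nsmul]
  rw [mul_comm _ z, mul_assoc, mul_neg_geom_sum, ← rot_nsmul, hDu, rot_zero, sub_self, mul_zero]

/-- Fourier inversion without division: the off-diagonal character sums need not vanish in `R[y]/(y
^ Q - 1)`, but `1 - y ^ H` annihilates them, and the diagonal ones equal the length of the
transform. -/
theorem one_sub_rot_mul_dft_dft {κ s j : ℕ} (hp : p.Prime) (hs : s < κ)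
    (c : ℕ → AddMonoidAlgebra R (ZMod (p ^ κ))) (hj : j < p ^ (s + 1)) :
    (1 - rot R ((p ^ (κ - 1) : ℕ) : ZMod (p ^ κ))) *
      dft (p ^ (s + 1)) (-((p ^ (κ - (s + 1)) : ℕ) : ZMod (p ^ κ)))
        (dft (p ^ (s + 1)) ((p ^ (κ - (s + 1)) : ℕ) : ZMod (p ^ κ)) c) j =
    p ^ (s + 1) • ((1 - rot R ((p ^ (κ - 1) : ℕ) : ZMod (p ^ κ))) * c j) := by
  set t : ZMod (p ^ κ) := ((p ^ (κ - (s + 1)) : ℕ) : ZMod (p ^ κ)) with ht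
  set D := p ^ (s + 1) with hD
  have hDt : D • t = 0 := by
    have : ((p ^ κ : ℕ) : ZMod (p ^ κ)) = 0 := ZMod.natCast_self _
    rw [ht, hD, nsmul_eq_mul, ← Nat.cast_mul, ← pow_add, show s + 1 + (κ - (s + 1)) = κ by omega,
      this]
  -- The exponent `-j` is replaced by `D - j`, which agrees with it because `D • t = 0`, so that all
  -- multipliers are natural numbers.
  have key : dft D (-t) (dft D t c) j = ∑ j' ∈ Finset.range D,
      (∑ i ∈ Finset.range D, rot R (i • (j' + (D - j)) • t)) * c j' := by
    simp only [dft, Finset.mul_sum, Finset.sum_mul]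
    rw [Finset.sum_comm]
    refine Finset.sum_congr rfl fun j' _ => Finset.sum_congr rfl fun i _ => ?_
    rw [← mul_assoc, ← rot_add]
    congr 2
    have : (D - j) • t = -(j • t) := by
      rw [eq_neg_iff_add_eq_zero, ← add_nsmul, Nat.sub_add_cancel hj.le, hDt]
    simp only [nsmul_eq_mul, Nat.cast_mul, Nat.cast_add] at this ⊢
    linear_combination -(i : ZMod (p ^ κ)) * this
  rw [key, Finset.mul_sum, Finset.sum_eq_single j]
  · have : ∀ i ∈ Finset.range D, rot R (i • (j + (D - j)) • t) = 1 := by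
      intro i _
      rw [show j + (D - j) = D by omega, hDt, nsmul_zero, rot_zero]
    rw [Finset.sum_congr rfl this]
    simp only [Finset.sum_const, Finset.card_range, nsmul_eq_mul, mul_one]
    ring
  · intro j' hj' hne
    rw [← mul_assoc, one_sub_rot_mul_sum hp hs, zero_mul]
    intro hdvd
    have hj'' := Finset.mem_range.1 hj'
    obtain ⟨q, hq⟩ := hdvd
    rw [← hD] at hq
    have h1 : 0 < q := by
      rcases Nat.eq_zero_or_pos q with rfl | h
      · omega
      · exact h
    have h2 : q < 2 := by
      by_contra h
      have : D * 2 ≤ D * q := Nat.mul_le_mul_left _ (by omega)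
      omega
    have : q = 1 := by omega
    subst this
    omega
  · intro h
    exact absurd (Finset.mem_range.2 hj) h

end Invert

/-! ### Reduction modulo `y ^ Q - 1` and splitting into blocks -/

section Reduce

variable {R : Type*} [CommRing R] {Q : ℕ}

/-- Reduction modulo `y ^ Q - 1`. -/
noncomputable def toCyclic (R : Type*) [CommRing R] (Q : ℕ) :
    R[X] →ₐ[R] AddMonoidAlgebra R (ZMod Q) := aeval (rot R 1)

/-- Below degree `2 * Q` at most two coefficients fold onto the same residue. -/
theorem coeff_toCyclic [NeZero Q] {h : R[X]} (hh : h.natDegree < Q + Q) (g : ZMod Q) :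
    (toCyclic R Q h).coeff g = h.coeff g.val + h.coeff (Q + g.val) := by
  have key : ∀ f : ℕ → R, ∑ i ∈ Finset.range Q, (if (i : ZMod Q) = g then f i else 0) = f g.val := by
    intro f
    rw [Finset.sum_eq_single g.val]
    · simp
    · intro i hi hne
      rw [if_neg]
      rintro rfl
      exact hne (ZMod.val_cast_of_lt (Finset.mem_range.1 hi)).symm
    · intro h
      exact absurd (Finset.mem_range.2 g.val_lt) h
  have h1 : ∀ i : ℕ, (h.coeff i • rot R (1 : ZMod Q) ^ i).coeff g =
      if (i : ZMod Q) = g then h.coeff i else 0 := by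
    intro i
    rw [← rot_nsmul, rot, AddMonoidAlgebra.coeff_smul, AddMonoidAlgebra.coeff_single,
      Finsupp.smul_apply, Finsupp.single_apply]
    simp
  rw [toCyclic, aeval_eq_sum_range' hh, AddMonoidAlgebra.coeff_sum, Finsupp.finsetSum_apply,
    Finset.sum_congr rfl fun i _ => h1 i, Finset.sum_range_add, key]
  congr 1
  rw [← key fun i => h.coeff (Q + i)]
  simp

theorem coeff_toCyclic_of_lt [NeZero Q] {h : R[X]} (hh : h.natDegree < Q) (g : ZMod Q) :
    (toCyclic R Q h).coeff g = h.coeff g.val := by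
  rw [coeff_toCyclic (by omega), coeff_eq_zero_of_natDegree_lt (n := Q + g.val) (by omega),
    add_zero]

/-- The representative of degree less than `Q` of an element of `R[y]/(y ^ Q - 1)`. -/
noncomputable def ofCyclic (z : AddMonoidAlgebra R (ZMod Q)) : R[X] :=
  ∑ i ∈ Finset.range Q, monomial i (z.coeff i)

theorem coeff_sum_range_monomial (N : ℕ) (f : ℕ → R) (i : ℕ) :
    (∑ j ∈ Finset.range N, monomial j (f j)).coeff i = if i < N then f i else 0 := by
  simp [finsetSum_coeff, coeff_monomial]

theorem natDegree_sum_range_monomial {N : ℕ} (hN : 0 < N) (f : ℕ → R) :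
    (∑ j ∈ Finset.range N, monomial j (f j)).natDegree < N := by
  refine Nat.lt_of_le_pred hN (natDegree_le_iff_coeff_eq_zero.2 fun i hi => ?_)
  rw [coeff_sum_range_monomial, if_neg (by simp at hi; omega)]

theorem toCyclic_ofCyclic [NeZero Q] (z : AddMonoidAlgebra R (ZMod Q)) :
    toCyclic R Q (ofCyclic z) = z := by
  refine AddMonoidAlgebra.ext (Finsupp.ext fun g => ?_)
  rw [ofCyclic, coeff_toCyclic_of_lt (natDegree_sum_range_monomial (NeZero.pos Q) _),
    coeff_sum_range_monomial, if_pos g.val_lt, ZMod.natCast_zmod_val]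

/-- `a` as a polynomial in `X ^ k` with coefficients of degree less than `k`. -/
noncomputable def blocks (k l : ℕ) (a : R[X]) : R[X][X] :=
  ∑ i ∈ Finset.range l, monomial i (∑ j ∈ Finset.range k, monomial j (a.coeff (k * i + j)))

theorem coeff_blocks (k l : ℕ) (a : R[X]) (i : ℕ) : (blocks k l a).coeff i =
    if i < l then ∑ j ∈ Finset.range k, monomial j (a.coeff (k * i + j)) else 0 :=
  coeff_sum_range_monomial _ _ _

theorem natDegree_blocks {k l : ℕ} (hl : 0 < l) (a : R[X]) : (blocks k l a).natDegree < l :=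
  natDegree_sum_range_monomial hl _

theorem natDegree_coeff_blocks {k l : ℕ} (hk : 0 < k) (a : R[X]) (i : ℕ) :
    ((blocks k l a).coeff i).natDegree < k := by
  rw [coeff_blocks]
  split_ifs
  · exact natDegree_sum_range_monomial hk _
  · simpa using hk

theorem eval_blocks {k l : ℕ} {a : R[X]} (ha : a.natDegree < k * l) :
    (blocks k l a).eval (X ^ k) = a := by
  conv_rhs => rw [a.as_sum_range' _ ha, sum_range_mul_add]
  rw [blocks, eval_finsetSum]
  refine Finset.sum_congr rfl fun i _ => ?_
  rw [eval_monomial, Finset.sum_mul]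
  refine Finset.sum_congr rfl fun j _ => ?_
  rw [← pow_mul, monomial_mul_X_pow, add_comm]

theorem natDegree_coeff_blocks_mul {k l : ℕ} (hk : 0 < k) (a b : R[X]) (j : ℕ) :
    ((blocks k l a * blocks k l b).coeff j).natDegree < 2 * k := by
  rw [coeff_mul]
  refine Nat.lt_of_le_pred (by omega) (natDegree_sum_le_of_forall_le _ _ fun x _ => ?_)
  have h1 := natDegree_coeff_blocks (l := l) hk a x.1
  have h2 := natDegree_coeff_blocks (l := l) hk b x.2
  exact natDegree_mul_le.trans (by simp; omega)

/-- The coefficients of a product in terms of the product of the polynomials of blocks. -/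
theorem coeff_mul_eq_blocks {k l : ℕ} (hk : 0 < k) {a b : R[X]} (ha : a.natDegree < k * l)
    (hb : b.natDegree < k * l) {n : ℕ} (hn : n < 2 * l * k) :
    (a * b).coeff n = ((blocks k l a * blocks k l b).coeff (n / k)).coeff (n % k) +
      if n / k = 0 then 0 else
        ((blocks k l a * blocks k l b).coeff (n / k - 1)).coeff (k + n % k) := by
  have hl : 0 < l := by
    rcases Nat.eq_zero_or_pos l with rfl | h
    · simp at ha
    · exact h
  set P := blocks k l a * blocks k l b with hP
  have hdeg : P.natDegree < 2 * l := by
    have h1 := natDegree_blocks (k := k) hl a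
    have h2 := natDegree_blocks (k := k) hl b
    exact lt_of_le_of_lt natDegree_mul_le (by omega)
  have hab : a * b = ∑ j ∈ Finset.range (2 * l), P.coeff j * X ^ (k * j) := by
    conv_lhs => rw [← eval_blocks ha, ← eval_blocks hb, ← eval_mul, eval_eq_sum_range' hdeg]
    refine Finset.sum_congr rfl fun j _ => by rw [pow_mul]
  have hq : n / k < 2 * l := Nat.div_lt_of_lt_mul (by rwa [mul_comm])
  have hmod : k * (n / k) + n % k = n := Nat.div_add_mod n k
  have hr : n % k < k := Nat.mod_lt _ hk
  rw [hab, finsetSum_coeff]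
  simp only [coeff_mul_X_pow']
  -- A product of two blocks has degree below `2 * k`, so only the block products number `n / k` and
  -- `n / k - 1` reach the coefficient `n`.
  have hzero : ∀ j, j ≠ n / k → j + 1 ≠ n / k →
      (if k * j ≤ n then (P.coeff j).coeff (n - k * j) else 0) = 0 := by
    intro j h1 h2
    split_ifs with h
    · refine coeff_eq_zero_of_natDegree_lt
        (lt_of_lt_of_le (natDegree_coeff_blocks_mul hk a b j) ?_)
      have h3 : j ≤ n / k := (Nat.le_div_iff_mul_le hk).2 (by rwa [mul_comm])
      obtain ⟨d, hd⟩ := Nat.exists_eq_add_of_le (show j + 2 ≤ n / k by omega)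
      have : k * (n / k) = k * j + 2 * k + k * d := by rw [hd]; ring
      omega
    · rfl
  have hmain : (if k * (n / k) ≤ n then (P.coeff (n / k)).coeff (n - k * (n / k)) else 0) =
      (P.coeff (n / k)).coeff (n % k) := by
    rw [if_pos (by omega), show n - k * (n / k) = n % k by omega]
  split_ifs with h0
  · rw [Finset.sum_eq_single (n / k), hmain, add_zero]
    · exact fun j _ h => hzero j h (by omega)
    · exact fun h => absurd (Finset.mem_range.2 hq) h
  · rw [Finset.sum_eq_add (n / k) (n / k - 1) (by omega), hmain]
    · congr 1
      obtain ⟨q, hq'⟩ := Nat.exists_eq_succ_of_ne_zero h0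
      have : k * (n / k) = k * q + k := by rw [hq', Nat.mul_succ]
      have h1 : n / k - 1 = q := by omega
      rw [h1, if_pos (by omega), show n - k * q = k + n % k by omega]
    · exact fun j _ h => hzero j h.1 (by omega)
    · exact fun h => absurd (Finset.mem_range.2 hq) h
    · exact fun h => absurd (Finset.mem_range.2 (by omega)) h

end Reduce

/-! ### Fast multiplication of polynomials -/

/-- Over every ring, `p ^ J` times the product of two polynomials of degree less than `p ^ n` is
obtained from their coefficients with `c` operations. -/
def MulBound.{u} (p n J c : ℕ) : Prop :=
  ∀ (R : Type u) [CommRing R] [Inv R] (S : Set R) (a b : R[X]), a.natDegree < p ^ n →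
    b.natDegree < p ^ n → Set.range a.coeff ⊆ S → Set.range b.coeff ⊆ S →
    SLP S c (Set.range (p ^ J • (a * b)).coeff)

universe u w

theorem MulBound.mono {p n J c c' : ℕ} (h : MulBound.{u} p n J c) (hc : c ≤ c') :
    MulBound.{u} p n J c' :=
  fun R _ _ S a b ha hb ha' hb' => (h R S a b ha hb ha' hb').mono hc

theorem zero_mem_of_coeff {R : Type*} [Semiring R] {S : Set R} {a : R[X]}
    (h : Set.range a.coeff ⊆ S) : (0 : R) ∈ S :=
  h ⟨a.natDegree + 1, coeff_eq_zero_of_natDegree_lt (by omega)⟩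

theorem SLP.polynomial {R : Type*} [CommRing R] [Inv R] {S : Set R} {N c : ℕ} {a : R[X]}
    (ha : a.natDegree < N) (h0 : (0 : R) ∈ S) (h : ∀ i < N, SLP S c {a.coeff i}) :
    SLP S (N * c) (Set.range a.coeff) :=
  SLP.range_nat h fun i hi => by rwa [coeff_eq_zero_of_natDegree_lt (by omega)]

theorem mulBound_naive (p n : ℕ) : MulBound.{u} p n 0 (2 * p ^ n * (4 * p ^ n)) := by
  intro R _ _ S a b ha hb ha' hb'
  have h0 := zero_mem_of_coeff ha'
  refine SLP.polynomial ?_ h0 fun i hi => ?_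
  · rw [pow_zero, one_smul]
    exact lt_of_le_of_lt natDegree_mul_le (by omega)
  · rw [pow_zero, one_smul, coeff_mul, Finset.Nat.sum_antidiagonal_eq_sum_range_succ_mk]
    refine (SLP.single_sum (c := 1) h0 fun j _ => ?_).mono (m := 4 * p ^ n) ?_
    · exact SLP.single_mul (ha' ⟨_, rfl⟩) (hb' ⟨_, rfl⟩)
    · simp only [Nat.succ_eq_add_one]; omega

/-- One level of Schönhage–Strassen: `p ^ l` blocks of length `p ^ k`. Transform length `D = p ^ (l
+ 1)` leaves room for the degree of the product in the outer variable. With `H = p ^ (k + 1)`, a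
product of two blocks has degree below `H`, and `Q = p ^ (k + 2)` is at least `2 * H`, so rotation
by `H` separates the two terms of `1 - y ^ H`. The condition `l ≤ k` makes `D` divide `Q`. Every
level multiplies the result by another factor `D`, the source of the `l + 1` added to `J`. -/
theorem mulBound_step {p k l J c : ℕ} (hp : p.Prime) (hl : l ≤ k)
    (h : MulBound.{u} p (k + 2) J c) :
    MulBound.{u} p (k + l) (J + (l + 1))
      (p ^ (l + 1) * c + 6 * (l + 1) * p ^ (k + l + 4)) := by
  intro R _ _ S a b ha hb ha' hb'
  have h0 := zero_mem_of_coeff ha'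
  have hp0 : 0 < p := hp.pos
  set Q := p ^ (k + 2) with hQ
  have : NeZero Q := ⟨by positivity⟩
  set D := p ^ (l + 1) with hD
  set t : ZMod Q := ((p ^ (k + 2 - (l + 1)) : ℕ) : ZMod Q) with ht
  have hDt : D • t = 0 := by
    have : ((p ^ (k + 2) : ℕ) : ZMod Q) = 0 := ZMod.natCast_self _
    rw [ht, hD, nsmul_eq_mul, ← Nat.cast_mul, ← pow_add,
      show l + 1 + (k + 2 - (l + 1)) = k + 2 by omega, this]
  have hK : 0 < p ^ k := by positivity
  have hL : 0 < p ^ l := by positivity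
  have h2L : 2 * p ^ l ≤ D := by
    rw [hD, pow_succ, mul_comm]
    exact Nat.mul_le_mul_left _ hp.two_le
  have hH : 2 * p ^ k ≤ p ^ (k + 1) := by
    rw [pow_succ, mul_comm]
    exact Nat.mul_le_mul_left _ hp.two_le
  have hHQ : 2 * p ^ (k + 1) ≤ Q := by
    rw [hQ, pow_succ p (k + 1), mul_comm]
    exact Nat.mul_le_mul_left _ hp.two_le
  have hKL : p ^ (k + l) = p ^ k * p ^ l := pow_add _ _ _
  rw [hKL] at ha hb
  set A := blocks (p ^ k) (p ^ l) a with hA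
  set B := blocks (p ^ k) (p ^ l) b with hB
  set π := toCyclic R Q with hπ
  -- the forward transforms
  have fwd : ∀ a : R[X], Set.range a.coeff ⊆ S → SLP S ((l + 1) * D * (Q * p))
      (⋃ i, Set.range (dft D t (fun j => π ((blocks (p ^ k) (p ^ l) a).coeff j)) i).coeff) := by
    intro a ha'
    refine SLP.fft _ _ _ hDt h0 fun j _ => ?_
    rintro _ ⟨g, rfl⟩
    rw [hπ, coeff_toCyclic_of_lt ((natDegree_coeff_blocks hK a j).trans (by omega)),
      coeff_blocks]
    split_ifs
    · rw [coeff_sum_range_monomial]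
      split_ifs
      · exact ha' ⟨_, rfl⟩
      · exact h0
    · simpa using h0
  have eval_dft : ∀ P : R[X][X], P.natDegree < D → ∀ i,
      dft D t (fun j => π (P.coeff j)) i = (P.map π.toRingHom).eval (rot R (i • t)) := by
    intro P hP i
    rw [eval_eq_sum_range' (natDegree_map_le.trans_lt hP)]
    refine Finset.sum_congr rfl fun j _ => ?_
    rw [coeff_map, ← rot_nsmul, ← mul_nsmul, mul_comm]
    rfl
  have hAD : A.natDegree < p ^ l := natDegree_blocks hL a
  have hBD : B.natDegree < p ^ l := natDegree_blocks hL b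
  have hABD : (A * B).natDegree < D := lt_of_le_of_lt natDegree_mul_le (by omega)
  have dft_mul : ∀ i, dft D t (fun j => π ((A * B).coeff j)) i =
      dft D t (fun j => π (A.coeff j)) i * dft D t (fun j => π (B.coeff j)) i := by
    intro i
    rw [eval_dft _ hABD, eval_dft _ (by omega), eval_dft _ (by omega), Polynomial.map_mul, eval_mul]
  set E : ℕ → AddMonoidAlgebra R (ZMod Q) :=
    dft D (-t) (dft D t fun j => p ^ J • π ((A * B).coeff j)) with hE
  have dft_smul : ∀ i, dft D t (fun j => p ^ J • π ((A * B).coeff j)) i =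
      p ^ J • dft D t (fun j => π ((A * B).coeff j)) i := by
    intro i
    simp only [dft, Finset.smul_sum, mul_smul_comm]
  -- extraction of the coefficients
  have extract : ∀ j < D, ∀ g < p ^ (k + 1), p ^ (J + (l + 1)) • ((A * B).coeff j).coeff g =
      (E j).coeff (g : ZMod Q) - (E j).coeff (-((p ^ (k + 1) : ℕ) : ZMod Q) + g) := by
    intro j hj g hg
    have h1 := one_sub_rot_mul_dft_dft hp (show l < k + 2 by omega)
      (fun j => p ^ J • π ((A * B).coeff j)) hj
    have h2 := congrArg (fun z => z.coeff (g : ZMod Q)) h1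
    simp only [sub_mul, one_mul, AddMonoidAlgebra.coeff_sub, AddMonoidAlgebra.coeff_smul,
      Finsupp.sub_apply, Finsupp.smul_apply, coeff_rot_mul] at h2
    have hCd : ((A * B).coeff j).natDegree < p ^ (k + 1) :=
      lt_of_lt_of_le (natDegree_coeff_blocks_mul hK a b j) hH
    have hg1 : (π ((A * B).coeff j)).coeff (g : ZMod Q) = ((A * B).coeff j).coeff g := by
      rw [hπ, coeff_toCyclic_of_lt (by omega), ZMod.val_cast_of_lt (by omega)]
    -- The rotated index is `Q - H + g` with `H = p ^ (k + 1)`; it is at least `H`, hence beyond the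
    -- degree of the block product.
    have hg2 : (π ((A * B).coeff j)).coeff (-((p ^ (k + 1) : ℕ) : ZMod Q) + g) = 0 := by
      rw [hπ, coeff_toCyclic_of_lt (by omega)]
      have : -((p ^ (k + 1) : ℕ) : ZMod Q) + g = ((Q - p ^ (k + 1) + g : ℕ) : ZMod Q) := by
        rw [Nat.cast_add, Nat.cast_sub (by omega), ZMod.natCast_self]
        ring
      rw [this, ZMod.val_cast_of_lt (by omega)]
      exact coeff_eq_zero_of_natDegree_lt (by omega)
    rw [show k + 2 - 1 = k + 1 from rfl] at h2
    rw [hg1, hg2, smul_zero, sub_zero] at h2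
    rw [pow_add, mul_comm, mul_smul]
    exact h2.symm
  have coeff_out : ∀ n < 2 * p ^ l * p ^ k, (p ^ (J + (l + 1)) • (a * b)).coeff n =
      p ^ (J + (l + 1)) • ((A * B).coeff (n / p ^ k)).coeff (n % p ^ k) +
      if n / p ^ k = 0 then 0 else
        p ^ (J + (l + 1)) • ((A * B).coeff (n / p ^ k - 1)).coeff (p ^ k + n % p ^ k) := by
    intro n hn
    rw [coeff_smul, coeff_mul_eq_blocks hK ha hb hn, smul_add, smul_ite, smul_zero]
  -- the cost
  have hcost : ((l + 1) * D * (Q * p) + (l + 1) * D * (Q * p)) + (D * (c + Q * 1) +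
      ((l + 1) * D * (Q * p) + (2 * p ^ l * p ^ k) * 3)) ≤
        D * c + 6 * (l + 1) * p ^ (k + l + 4) := by
    have e1 : D * (Q * p) = p ^ (k + l + 4) := by rw [hD, hQ]; ring
    have e2 : D * Q ≤ p ^ (k + l + 4) := by
      rw [← e1]; exact Nat.mul_le_mul_left _ (Nat.le_mul_of_pos_right _ hp0)
    have e3 : (2 * p ^ l * p ^ k) * 3 ≤ p ^ (k + l + 4) := by
      have e4 : D * (2 * p ^ (k + 1)) ≤ D * Q := Nat.mul_le_mul_left _ hHQ
      have e5 : (2 * p ^ l) * (2 * (2 * p ^ k)) ≤ D * (2 * p ^ (k + 1)) :=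
        Nat.mul_le_mul h2L (by omega)
      nlinarith [Nat.mul_pos hK hL]
    have e6 : (l + 1) * D * (Q * p) = (l + 1) * p ^ (k + l + 4) := by rw [mul_assoc, e1]
    rw [e6, mul_one, mul_add]
    nlinarith [Nat.zero_le (l * p ^ (k + l + 4))]
  refine SLP.mono ?_ hcost
  refine ((fwd a ha').union (fwd b hb')).bind fun S₁ hS₁ hT₁ => ?_
  have hTA : ∀ i, Set.range (dft D t (fun j => π (A.coeff j)) i).coeff ⊆ S₁ := fun i =>
    (Set.subset_iUnion (fun i => Set.range (dft D t (fun j => π (A.coeff j)) i).coeff) i).trans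
      (Set.subset_union_left.trans hT₁)
  have hTB : ∀ i, Set.range (dft D t (fun j => π (B.coeff j)) i).coeff ⊆ S₁ := fun i =>
    (Set.subset_iUnion (fun i => Set.range (dft D t (fun j => π (B.coeff j)) i).coeff) i).trans
      (Set.subset_union_right.trans hT₁)
  have prod : ∀ i < D, SLP S₁ (c + Q * 1)
      (Set.range (dft D t (fun j => p ^ J • π ((A * B).coeff j)) i).coeff) := by
    intro i _
    set α := dft D t (fun j => π (A.coeff j)) i with hα
    set β := dft D t (fun j => π (B.coeff j)) i with hβ
    have hQ0 : 0 < Q := NeZero.pos Q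
    have cz : ∀ z : AddMonoidAlgebra R (ZMod Q), Set.range z.coeff ⊆ S₁ →
        Set.range (ofCyclic z).coeff ⊆ S₁ := by
      rintro z hz _ ⟨i, rfl⟩
      rw [ofCyclic, coeff_sum_range_monomial]
      split_ifs
      · exact hz ⟨_, rfl⟩
      · exact hS₁ h0
    have dα : (ofCyclic α).natDegree < Q := natDegree_sum_range_monomial hQ0 _
    have dβ : (ofCyclic β).natDegree < Q := natDegree_sum_range_monomial hQ0 _
    refine (h R S₁ (ofCyclic α) (ofCyclic β) dα dβ (cz _ (hTA i)) (cz _ (hTB i))).bind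
      fun S₂ hS₂ hT₂ => SLP.cyclic fun g => ?_
    have : dft D t (fun j => p ^ J • π ((A * B).coeff j)) i =
        toCyclic R Q (p ^ J • (ofCyclic α * ofCyclic β)) := by
      rw [dft_smul, dft_mul, map_nsmul, map_mul, toCyclic_ofCyclic, toCyclic_ofCyclic]
    rw [this, coeff_toCyclic]
    · exact SLP.single_add (hT₂ ⟨_, rfl⟩) (hT₂ ⟨_, rfl⟩)
    · have h1 : (ofCyclic α * ofCyclic β).natDegree < Q + Q :=
        lt_of_le_of_lt natDegree_mul_le (by omega)
      exact lt_of_le_of_lt (natDegree_smul_le _ _) h1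
  refine (SLP.iUnion_range prod).bind fun S₂ hS₂ hT₂ => ?_
  have hT₂' : ∀ j < D, Set.range (dft D t (fun j => p ^ J • π ((A * B).coeff j)) j).coeff ⊆ S₂ := by
    rintro j hj x hx
    refine hT₂ ?_
    simp only [Set.mem_iUnion]
    exact ⟨j, hj, hx⟩
  refine (SLP.fft (l + 1) (-t) _ (by rw [smul_neg, hDt, neg_zero]) (hS₂ (hS₁ h0)) hT₂').bind
    fun S₃ hS₃ hT₃ => ?_
  have hE' : ∀ j g, (E j).coeff g ∈ S₃ := fun j g => hT₃ (Set.mem_iUnion.2 ⟨j, g, rfl⟩)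
  refine SLP.polynomial ?_ (hS₃ (hS₂ (hS₁ h0))) fun n hn => ?_
  · refine lt_of_le_of_lt ((natDegree_smul_le _ _).trans natDegree_mul_le) ?_
    have : 2 * p ^ l * p ^ k = p ^ k * p ^ l + p ^ k * p ^ l := by ring
    omega
  · have hr : n % p ^ k < p ^ k := Nat.mod_lt _ hK
    have hq : n / p ^ k < 2 * p ^ l := Nat.div_lt_of_lt_mul (by rwa [mul_comm])
    rw [coeff_out n hn, extract _ (by omega) _ (by omega)]
    refine SLP.add' (n := 1) (m := 1) (SLP.single_sub (hE' _ _) (hE' _ _)) ?_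
    split_ifs
    · exact (SLP.single_mem (hS₃ (hS₂ (hS₁ h0)))).mono (by omega)
    · rw [extract _ (by omega) _ (by omega)]
      exact SLP.single_sub (hE' _ _) (hE' _ _)

/-- Splitting exponents in half gives a recursion of logarithmic depth. The exponent `J` is bounded
along with the cost so that a `J`-th power can later be formed by repeated multiplication. -/
theorem exists_mulBound {p : ℕ} (hp : p.Prime) (hp3 : p ≤ 3) :
    ∃ B : ℕ → ℕ, QL p B ∧ ∀ n, ∃ J ≤ B n, MulBound.{u} p n J (B n) := by
  set C := 8 * 3 ^ 13 with hC
  have hp0 : 0 < p := hp.pos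
  refine ⟨fun n => C * p ^ n * (n + 1) ^ 14, ⟨C, 14, fun n => le_rfl⟩, fun n => ?_⟩
  induction n using Nat.strong_induction_on with
  | _ n ih =>
  rcases lt_or_ge n 13 with hn | hn
  · refine ⟨0, Nat.zero_le _, (mulBound_naive p n).mono ?_⟩
    have h1 : p ^ n ≤ 3 ^ 13 := (Nat.pow_le_pow_left hp3 n).trans
      (Nat.pow_le_pow_right (by norm_num) hn.le)
    calc 2 * p ^ n * (4 * p ^ n) = 8 * p ^ n * p ^ n * 1 := by ring
      _ ≤ 8 * 3 ^ 13 * p ^ n * (n + 1) ^ 14 := by gcongr; exact Nat.one_le_pow _ _ (by omega)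
  · obtain ⟨k, l, hk, hl, hkl, h4⟩ : ∃ k l, k + l = n ∧ l ≤ k ∧ k + 2 < n ∧
        4 * (k + 2 + 1) ≤ 3 * (n + 1) :=
      ⟨n - n / 2, n / 2, by omega, by omega, by omega, by omega⟩
    subst hk
    obtain ⟨J, hJ, hM⟩ := ih (k + 2) hkl
    set Y := (k + 2 + 1) ^ 14 with hY
    set Z := (k + l + 1) ^ 14 with hZ
    -- A level loses the factor `p ^ (l + 1) * p ^ (k + 2) / p ^ (k + l) = p ^ 3 ≤ 27`. As `(4 / 3)
    -- ^ 14 > 54`, the exponent 14 absorbs twice that loss; the spare half of the bound pays for the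
    -- transforms.
    have hYZ : 54 * Y ≤ Z := by
      have h5 := Nat.pow_le_pow_left h4 14
      rw [mul_pow, mul_pow, ← hY, ← hZ] at h5
      norm_num at h5
      omega
    have hlZ : l + 1 ≤ Z := le_trans (by omega) (Nat.le_self_pow (by norm_num) (k + l + 1))
    have hp27 : p ^ 3 ≤ 27 := Nat.pow_le_pow_left hp3 3
    have hp81 : p ^ 4 ≤ 81 := Nat.pow_le_pow_left hp3 4
    have hcost : p ^ (l + 1) * (C * p ^ (k + 2) * Y) + 6 * (l + 1) * p ^ (k + l + 4) ≤
        C * p ^ (k + l) * Z := by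
      have e1 : p ^ (l + 1) * (C * p ^ (k + 2) * Y) ≤ C * p ^ (k + l) * (27 * Y) := by
        calc p ^ (l + 1) * (C * p ^ (k + 2) * Y) = C * p ^ (k + l) * (p ^ 3 * Y) := by ring
          _ ≤ _ := by gcongr
      have e2 : 6 * (l + 1) * p ^ (k + l + 4) ≤ p ^ (k + l) * (486 * Z) := by
        calc 6 * (l + 1) * p ^ (k + l + 4) = p ^ (k + l) * (6 * p ^ 4 * (l + 1)) := by ring
          _ ≤ p ^ (k + l) * (6 * 81 * Z) := by gcongr
          _ = _ := by ring
      have e3 : C * p ^ (k + l) * (54 * Y) ≤ C * p ^ (k + l) * Z := by gcongr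
      have e4 : 972 * (p ^ (k + l) * Z) ≤ C * (p ^ (k + l) * Z) := by
        gcongr; rw [hC]; norm_num
      nlinarith
    refine ⟨J + (l + 1), ?_, (mulBound_step hp hl hM).mono hcost⟩
    refine le_trans ?_ hcost
    have e1 : J ≤ p ^ (l + 1) * (C * p ^ (k + 2) * Y) :=
      hJ.trans (Nat.le_mul_of_pos_left _ (by positivity))
    have e2 : l + 1 ≤ 6 * (l + 1) * p ^ (k + l + 4) := by
      calc l + 1 = 1 * (l + 1) * 1 := by ring
        _ ≤ _ := by gcongr; norm_num; exact Nat.one_le_pow _ _ hp0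
    omega

/-- Rings in which `x⁻¹` is a generalized inverse of `x`, such as products of fields. -/
class IsRegularInv (R : Type*) [CommRing R] [Inv R] : Prop where
  mul_inv_mul (x : R) : x * x⁻¹ * x = x

instance {ι : Type*} {K : ι → Type*} [∀ i, Field (K i)] : IsRegularInv (∀ i, K i) where
  mul_inv_mul x := funext fun i => mul_inv_mul_cancel (x i)

/-- The idempotent `e = 2 * 2⁻¹` satisfies `2 * e = 2`. On the part cut out by `e` the power `2⁻¹ ^
J` really inverts `2 ^ J`; on the part cut out by `1 - e` one has `2 = 0`, hence `3 = 1`, and `3 ^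
L` needs no inverse. -/
theorem eq_two_part_add_three_part {R : Type*} [CommRing R] [Inv R] [IsRegularInv R] (x : R)
    (J L : ℕ) : x = (2 * 2⁻¹) * 2⁻¹ ^ J * (2 ^ J * x) + (1 - 2 * 2⁻¹) * (3 ^ L * x) := by
  have h : (2 : R) * 2⁻¹ * 2 = 2 := IsRegularInv.mul_inv_mul 2
  have h1 : ∀ J : ℕ, (2 * 2⁻¹) * ((2 : R)⁻¹ ^ J * 2 ^ J) = 2 * 2⁻¹ := by
    intro J
    rw [← mul_pow, mul_comm (2 : R)⁻¹, ← pow_succ']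
    have : (2 * (2 : R)⁻¹) * (2 * 2⁻¹) = 2 * 2⁻¹ := by linear_combination (2 : R)⁻¹ * h
    exact IsIdempotentElem.pow_succ_eq J this
  have h2 : ∀ L : ℕ, (1 - 2 * (2 : R)⁻¹) * 3 ^ L = 1 - 2 * 2⁻¹ := by
    intro L
    induction L with
    | zero => simp
    | succ L ih => rw [pow_succ, ← mul_assoc, ih]; linear_combination -h
  linear_combination (-x) * h1 J - x * h2 L

/-- Fast multiplication of polynomials. -/
theorem exists_mulCost : ∃ μ : ℕ → ℕ, QL 2 μ ∧ ∀ (n : ℕ) (R : Type u) [CommRing R] [Inv R]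
    [IsRegularInv R] (S : Set R) (a b : R[X]), a.natDegree < 2 ^ n → b.natDegree < 2 ^ n →
    Set.range a.coeff ⊆ S → Set.range b.coeff ⊆ S → SLP S (μ n) (Set.range (a * b).coeff) := by
  obtain ⟨B₂, hB₂, H₂⟩ := exists_mulBound.{u} Nat.prime_two (by norm_num)
  obtain ⟨B₃, hB₃, H₃⟩ := exists_mulBound.{u} Nat.prime_three le_rfl
  -- Rounding `2 ^ n` up to a power of 3 loses at most a factor 3.
  have hB₃' : QL 2 fun n => B₃ (Nat.clog 3 (2 ^ n)) := by
    obtain ⟨C, a, hC⟩ := hB₃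
    refine ⟨C * 3, a, fun n => (hC _).trans ?_⟩
    have h1 : Nat.clog 3 (2 ^ n) ≤ n :=
      Nat.clog_le_of_le_pow (Nat.pow_le_pow_left (by norm_num) n)
    have h2 : 3 ^ Nat.clog 3 (2 ^ n) ≤ 3 * 2 ^ n := by
      rcases n with _ | n
      · simp
      · have h3 : 1 < 2 ^ (n + 1) := Nat.one_lt_two_pow (by omega)
        have h4 := Nat.pow_pred_clog_lt_self (b := 3) (by norm_num) h3
        have h5 := Nat.clog_pos (b := 3) (by norm_num) h3
        obtain ⟨q, hq⟩ := Nat.exists_eq_succ_of_ne_zero h5.ne'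
        rw [hq] at h4 ⊢
        rw [Nat.pow_succ]
        simp at h4
        omega
    calc C * 3 ^ Nat.clog 3 (2 ^ n) * (Nat.clog 3 (2 ^ n) + 1) ^ a
        ≤ C * (3 * 2 ^ n) * (n + 1) ^ a := by gcongr
      _ = _ := by ring
  refine ⟨fun n => (B₂ n + B₃ (Nat.clog 3 (2 ^ n))) + (B₂ n + 10 + 2 * 2 ^ n * 3), ?_, ?_⟩
  · refine (hB₂.add hB₃').add ((hB₂.add (QL.const (by norm_num) 10)).add ?_)
    exact (QL.pow.const_mul 6).mono fun n => by ring_nf; rfl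
  · intro n R _ _ _ S a b ha hb ha' hb'
    have h0 := zero_mem_of_coeff ha'
    obtain ⟨J, hJ, hM₂⟩ := H₂ n
    obtain ⟨L, hL, hM₃⟩ := H₃ (Nat.clog 3 (2 ^ n))
    have h3 : 2 ^ n ≤ 3 ^ Nat.clog 3 (2 ^ n) := Nat.le_pow_clog (by norm_num) _
    refine ((hM₂ R S a b ha hb ha' hb').union
      (hM₃ R S a b (by omega) (by omega) ha' hb')).bind fun S₁ hS₁ hT₁ => ?_
    have hc : SLP S₁ (B₂ n + 10) {(2 * 2⁻¹) * (2 : R)⁻¹ ^ J, 1 - 2 * 2⁻¹} := by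
      refine SLP.mono (n := 1 + (1 + (1 + (1 + (1 + ((J + 1) + 1)))))) ?_ (by omega)
      refine SLP.single_one.bindSingle fun S₂ hS₂ h1 => ?_
      refine (SLP.single_add h1 h1).bindSingle fun S₃ hS₃ h2 => ?_
      rw [one_add_one_eq_two] at h2
      refine (SLP.single_inv h2).bindSingle fun S₄ hS₄ h2' => ?_
      refine (SLP.single_mul (hS₄ h2) h2').bindSingle fun S₅ hS₅ he => ?_
      refine (SLP.single_sub (hS₅ (hS₄ (hS₃ h1))) he).bindSingle fun S₆ hS₆ hf => ?_
      refine (SLP.single_pow (hS₆ (hS₅ h2')) J).bindSingle fun S₇ hS₇ hu => ?_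
      refine (SLP.single_mul (hS₇ (hS₆ he)) hu).bindSingle (m := 0)
        fun S₈ hS₈ hv => .done 0 ?_
      rintro x (rfl | rfl)
      · exact hv
      · exact hS₈ (hS₇ hf)
    refine hc.bind fun S₂ hS₂ hT₂ => ?_
    refine SLP.polynomial (lt_of_le_of_lt natDegree_mul_le (by omega)) (hS₂ (hS₁ h0))
      fun i _ => ?_
    rw [eq_two_part_add_three_part ((a * b).coeff i) J L]
    have e2 : (2 : R) ^ J * (a * b).coeff i = (2 ^ J • (a * b)).coeff i := by
      rw [coeff_smul, nsmul_eq_mul]; push_cast; rfl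
    have e3 : (3 : R) ^ L * (a * b).coeff i = (3 ^ L • (a * b)).coeff i := by
      rw [coeff_smul, nsmul_eq_mul]; push_cast; rfl
    rw [e2, e3]
    refine SLP.add' (n := 1) (m := 1) (SLP.single_mul (hT₂ (by simp)) (hS₂ (hT₁ ?_)))
      (SLP.single_mul (hT₂ (by simp)) (hS₂ (hT₁ ?_)))
    · exact Or.inl ⟨i, rfl⟩
    · exact Or.inr ⟨i, rfl⟩

/-! ### Power series inversion and division with remainder -/

section Truncation

variable {R : Type*} [CommRing R]

/-- The remainder of `a` modulo `X ^ n`. -/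
noncomputable def truncX (n : ℕ) (a : R[X]) : R[X] :=
  ∑ i ∈ Finset.range n, monomial i (a.coeff i)

theorem coeff_truncX (n : ℕ) (a : R[X]) (i : ℕ) :
    (truncX n a).coeff i = if i < n then a.coeff i else 0 :=
  coeff_sum_range_monomial _ _ _

theorem natDegree_truncX {n : ℕ} (hn : 0 < n) (a : R[X]) : (truncX n a).natDegree < n :=
  natDegree_sum_range_monomial hn _

theorem range_coeff_truncX {S : Set R} {a : R[X]} (h : Set.range a.coeff ⊆ S) (n : ℕ) :
    Set.range (truncX n a).coeff ⊆ S := by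
  rintro _ ⟨i, rfl⟩
  rw [coeff_truncX]
  split_ifs
  · exact h ⟨_, rfl⟩
  · exact zero_mem_of_coeff h

theorem X_pow_dvd_sub_truncX (n : ℕ) (a : R[X]) : X ^ n ∣ a - truncX n a := by
  rw [X_pow_dvd_iff]
  intro d hd
  rw [coeff_sub, coeff_truncX, if_pos hd, sub_self]

theorem eq_truncX_of_dvd {n : ℕ} {a b : R[X]} (ha : a.natDegree < n) (h : X ^ n ∣ a - b) :
    a = truncX n b := by
  ext i
  rw [coeff_truncX]
  split_ifs with hi
  · have := X_pow_dvd_iff.1 h i hi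
    rwa [coeff_sub, sub_eq_zero] at this
  · exact coeff_eq_zero_of_natDegree_lt (by omega)

theorem range_coeff_reflect {S : Set R} {a : R[X]} (h : Set.range a.coeff ⊆ S) (n : ℕ) :
    Set.range (reflect n a).coeff ⊆ S := by
  rintro _ ⟨i, rfl⟩
  rw [coeff_reflect]
  exact h ⟨_, rfl⟩

theorem reflect_reflect (n : ℕ) (a : R[X]) : reflect n (reflect n a) = a := by
  ext i
  rw [coeff_reflect, coeff_reflect, revAt_invol]

theorem natDegree_reflect_le_of_le {n : ℕ} {a : R[X]} (h : a.natDegree ≤ n) :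
    (reflect n a).natDegree ≤ n := by
  refine natDegree_le_iff_coeff_eq_zero.2 fun i hi => ?_
  rw [coeff_reflect, revAt_eq_self_of_lt hi]
  exact coeff_eq_zero_of_natDegree_lt (by omega)

end Truncation

/-- Power series inversion by Newton's iteration. -/
theorem exists_invCost : ∃ μ : ℕ → ℕ, QL 2 μ ∧ ∀ (n : ℕ) (R : Type u) [CommRing R] [Inv R]
    [IsRegularInv R] (S : Set R) (a : R[X]) (c : R), c ∈ S → a.coeff 0 * c = 1 →
    Set.range a.coeff ⊆ S →
    ∃ g : R[X], g.natDegree < 2 ^ n ∧ X ^ 2 ^ n ∣ a * g - 1 ∧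
      SLP S (μ n) (Set.range g.coeff) := by
  obtain ⟨μ, hμ, H⟩ := exists_mulCost.{u}
  let I : ℕ → ℕ := fun n =>
    Nat.rec 0 (fun n r => r + (μ (n + 1) + (μ (n + 1) + 2 ^ (n + 1) * 2))) n
  refine ⟨I, QL.of_add (g := fun n => μ (n + 1) + (μ (n + 1) + 2 ^ (n + 1) * 2)) ?_
    fun n => le_rfl, ?_⟩
  · refine hμ.succ.add (hμ.succ.add ((QL.pow.const_mul 4).mono fun n => ?_))
    rw [pow_succ]; omega
  intro n R _ _ _ S a c hc hac ha
  have h0 := zero_mem_of_coeff ha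
  induction n with
  | zero =>
    refine ⟨C c, by simp, ?_, .done _ ?_⟩
    · rw [pow_zero, pow_one, X_dvd_iff]
      simp [hac]
    · rintro _ ⟨i, rfl⟩
      rw [coeff_C]
      split_ifs
      · exact hc
      · exact h0
  | succ n ih =>
    obtain ⟨g, hg, hag, hcost⟩ := ih
    have h2 : 2 ^ (n + 1) = 2 * 2 ^ n := by ring
    set b := truncX (2 ^ (n + 1)) a with hb
    refine ⟨truncX (2 ^ (n + 1)) (g + g - b * (g * g)), natDegree_truncX (by positivity) _, ?_, ?_⟩
    · have h1 := X_pow_dvd_sub_truncX (2 ^ (n + 1)) (g + g - b * (g * g))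
      have h3 := X_pow_dvd_sub_truncX (2 ^ (n + 1)) a
      have h4 : X ^ 2 ^ (n + 1) ∣ (a * g - 1) * (a * g - 1) := by
        rw [h2, two_mul, pow_add]
        exact mul_dvd_mul hag hag
      rw [← hb] at h3
      -- Newton's identity `1 - a * (2 * g - a * g ^ 2) = (1 - a * g) ^ 2` doubles the precision;
      -- the two truncations only add multiples of `X ^ 2 ^ (n + 1)`.
      have : a * truncX (2 ^ (n + 1)) (g + g - b * (g * g)) - 1 =
          -(a * ((g + g - b * (g * g)) - truncX (2 ^ (n + 1)) (g + g - b * (g * g)))) +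
          (a - b) * (a * (g * g)) - (a * g - 1) * (a * g - 1) := by ring
      rw [this]
      exact dvd_sub (dvd_add ((h1.mul_left _).neg_right) (h3.mul_right _)) h4
    · refine hcost.bind fun S₁ hS₁ hT₁ => ?_
      refine (H (n + 1) R S₁ g g (by omega) (by omega) hT₁ hT₁).bind fun S₂ hS₂ hT₂ => ?_
      have hgg : (g * g).natDegree < 2 ^ (n + 1) := lt_of_le_of_lt natDegree_mul_le (by omega)
      refine (H (n + 1) R S₂ b (g * g) (natDegree_truncX (by positivity) _) hgg
        ((range_coeff_truncX ha _).trans (hS₁.trans hS₂)) hT₂).bind fun S₃ hS₃ hT₃ => ?_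
      refine SLP.polynomial (natDegree_truncX (by positivity) _) (hS₃ (hS₂ (hS₁ h0)))
        fun i hi => ?_
      rw [coeff_truncX, if_pos hi, coeff_sub, coeff_add]
      have hgi : g.coeff i ∈ S₃ := hS₃ (hS₂ (hT₁ ⟨i, rfl⟩))
      exact (SLP.single_add hgi hgi).sub' (m := 0) (SLP.single_mem (hT₃ ⟨i, rfl⟩))

/-- Remainders modulo monic polynomials. -/
theorem exists_modByMonicCost : ∃ μ : ℕ → ℕ, QL 2 μ ∧ ∀ (n : ℕ) (R : Type u) [CommRing R]
    [Inv R] [IsRegularInv R] (S : Set R) (a M : R[X]), M.Monic → M.natDegree = 2 ^ n →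
    a.natDegree < 2 ^ (n + 1) → Set.range a.coeff ⊆ S → Set.range M.coeff ⊆ S →
    SLP S (μ n) (Set.range (a %ₘ M).coeff) := by
  obtain ⟨μ, hμ, H⟩ := exists_mulCost.{u}
  obtain ⟨ν, hν, HI⟩ := exists_invCost.{u}
  refine ⟨fun n => 1 + (ν n + (μ n + (μ (n + 1) + 2 ^ n * 1))), ?_, ?_⟩
  · exact (QL.const (by norm_num) 1).add (hν.add (hμ.add (hμ.succ.add
      (QL.pow.mono fun n => by simp))))
  intro n R _ _ _ S a M hM hMd had ha hMS
  have h0 := zero_mem_of_coeff ha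
  rcases subsingleton_or_nontrivial R with hR | hR
  · exact .done _ fun x _ => by rwa [Subsingleton.elim x 0]
  have h2 : 2 ^ (n + 1) = 2 * 2 ^ n := by ring
  have hpos : 0 < 2 ^ n := by positivity
  have hM1 : M ≠ 1 := by
    rintro rfl
    rw [natDegree_one] at hMd
    omega
  have hr : (a %ₘ M).natDegree < 2 ^ n := hMd ▸ natDegree_modByMonic_lt a hM hM1
  have hq : (a /ₘ M).natDegree ≤ 2 ^ n - 1 := by rw [natDegree_divByMonic a hM, hMd]; omega
  have hdiv := modByMonic_add_div a M
  have hrefl : reflect (2 ^ n - 1) (a /ₘ M) * reflect (2 ^ n) M +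
      reflect (2 ^ n - 1 + 2 ^ n) (a %ₘ M) = reflect (2 ^ n - 1 + 2 ^ n) a := by
    rw [← reflect_mul _ _ hq hMd.le, ← reflect_add, mul_comm (a /ₘ M), add_comm (M * _), hdiv]
  -- Reversal in degree `2 ^ n - 1 + 2 ^ n` sends the remainder, of degree below `2 ^ n`, to a
  -- multiple of `X ^ 2 ^ n`. The reversed quotient is therefore the quotient of the reversals as
  -- power series to that order.
  have hdvd : X ^ 2 ^ n ∣ reflect (2 ^ n - 1 + 2 ^ n) (a %ₘ M) := by
    rw [X_pow_dvd_iff]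
    intro i hi
    rw [coeff_reflect, revAt_le (by omega)]
    exact coeff_eq_zero_of_natDegree_lt (by omega)
  have hM0 : (reflect (2 ^ n) M).coeff 0 = 1 := by
    rw [coeff_reflect, revAt_le (Nat.zero_le _), Nat.sub_zero, ← hMd]
    exact hM
  refine SLP.single_one.bindSingle fun S₁ hS₁ h1 => ?_
  obtain ⟨g, hg, hgM, hgc⟩ := HI n R S₁ (reflect (2 ^ n) M) 1 h1 (by rw [hM0, one_mul])
    ((range_coeff_reflect hMS _).trans hS₁)
  refine hgc.bind fun S₂ hS₂ hT₂ => ?_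
  set b := truncX (2 ^ n) (reflect (2 ^ n - 1 + 2 ^ n) a) with hb
  refine (H n R S₂ b g (natDegree_truncX hpos _) hg ((range_coeff_truncX
    (range_coeff_reflect ha _) _).trans (hS₁.trans hS₂)) hT₂).bind fun S₃ hS₃ hT₃ => ?_
  have hqr : reflect (2 ^ n - 1) (a /ₘ M) = truncX (2 ^ n) (b * g) := by
    refine eq_truncX_of_dvd (lt_of_le_of_lt (natDegree_reflect_le_of_le hq) (by omega)) ?_
    have h3 := X_pow_dvd_sub_truncX (2 ^ n) (reflect (2 ^ n - 1 + 2 ^ n) a)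
    rw [← hb] at h3
    have : reflect (2 ^ n - 1) (a /ₘ M) - b * g =
        (reflect (2 ^ n - 1 + 2 ^ n) a - b) * g - reflect (2 ^ n - 1 + 2 ^ n) (a %ₘ M) * g -
        reflect (2 ^ n - 1) (a /ₘ M) * (reflect (2 ^ n) M * g - 1) := by
      rw [← hrefl]; ring
    rw [this]
    exact dvd_sub (dvd_sub (h3.mul_right _) (hdvd.mul_right _)) (hgM.mul_left _)
  have hqS : Set.range (a /ₘ M).coeff ⊆ S₃ := by
    rw [← reflect_reflect (2 ^ n - 1) (a /ₘ M), hqr]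
    exact range_coeff_reflect (range_coeff_truncX hT₃ _) _
  have hMS₃ : Set.range M.coeff ⊆ S₃ := hMS.trans (hS₁.trans (hS₂.trans hS₃))
  refine (H (n + 1) R S₃ M (a /ₘ M) (by omega) (by omega) hMS₃ hqS).bind fun S₄ hS₄ hT₄ => ?_
  refine SLP.polynomial hr (hS₄ (hS₃ (hS₂ (hS₁ h0)))) fun i _ => ?_
  rw [eq_sub_of_add_eq hdiv, coeff_sub]
  exact SLP.single_sub (hS₄ (hS₃ (hS₂ (hS₁ (ha ⟨i, rfl⟩))))) (hT₄ ⟨i, rfl⟩)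

/-! ### Product trees and multipoint evaluation -/

section FracNum

variable {R : Type*} [CommRing R]

/-- The numerator of the sum of the fractions `c j / ℓ j`, `j < N`, over the common denominator
`∏ j < N, ℓ j`. -/
noncomputable def fracNum (c : ℕ → R) (ℓ : ℕ → R[X]) : ℕ → R[X]
  | 0 => 0
  | N + 1 => fracNum c ℓ N * ℓ N + C (c N) * ∏ j ∈ Finset.range N, ℓ j

/-- Addition of the fractions `F₁ / P₁` and `F₂ / P₂` over the denominator `P₁ * P₂`; this is the
node of a product tree. -/
theorem fracNum_add (c : ℕ → R) (ℓ : ℕ → R[X]) (N M : ℕ) :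
    fracNum c ℓ (N + M) = fracNum c ℓ N * ∏ j ∈ Finset.range M, ℓ (N + j) +
      (∏ j ∈ Finset.range N, ℓ j) * fracNum (fun j => c (N + j)) (fun j => ℓ (N + j)) M := by
  induction M with
  | zero => simp [fracNum]
  | succ M ih =>
    rw [← add_assoc, fracNum, ih, Finset.prod_range_succ, fracNum, Finset.prod_range_add]
    ring

theorem natDegree_prod_linear {ℓ : ℕ → R[X]} {N : ℕ} (h : ∀ j < N, (ℓ j).natDegree ≤ 1) :
    (∏ j ∈ Finset.range N, ℓ j).natDegree ≤ N := by
  refine (natDegree_prod_le _ _).trans ((Finset.sum_le_card_nsmul _ _ 1 fun j hj => ?_).trans ?_)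
  · exact h j (Finset.mem_range.1 hj)
  · simp

theorem natDegree_fracNum {c : ℕ → R} {ℓ : ℕ → R[X]} {N : ℕ} (h : ∀ j < N, (ℓ j).natDegree ≤ 1) :
    (fracNum c ℓ N).natDegree ≤ N - 1 := by
  induction N with
  | zero => simp [fracNum]
  | succ N ih =>
    have h1 := ih fun j hj => h j (by omega)
    have h2 := h N (by omega)
    have h3 := natDegree_prod_linear (N := N) fun j hj => h j (by omega)
    rw [fracNum]
    refine natDegree_add_le_of_degree_le ?_ ((natDegree_C_mul_le _ _).trans h3)
    rcases N with _ | N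
    · simp [fracNum]
    · exact natDegree_mul_le.trans (by omega)

end FracNum

/-- The common denominator and the numerator of a sum of fractions with linear denominators. -/
theorem exists_fracNumCost : ∃ μ : ℕ → ℕ, QL 2 μ ∧ ∀ (n : ℕ) (R : Type u) [CommRing R] [Inv R]
    [IsRegularInv R] (S : Set R) (c : ℕ → R) (ℓ : ℕ → R[X]), (0 : R) ∈ S →
    (∀ j < 2 ^ n, (ℓ j).natDegree ≤ 1) → (∀ j < 2 ^ n, Set.range (ℓ j).coeff ⊆ S) →
    (∀ j < 2 ^ n, c j ∈ S) →
    SLP S (μ n) (Set.range (∏ j ∈ Finset.range (2 ^ n), ℓ j).coeff ∪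
      Set.range (fracNum c ℓ (2 ^ n)).coeff) := by
  obtain ⟨μ, hμ, H⟩ := exists_mulCost.{u}
  let T : ℕ → ℕ := fun n =>
    Nat.rec 0 (fun n r => 2 * r + (μ (n + 1) + (μ (n + 1) + (μ (n + 1) + 2 ^ (n + 1) * 1)))) n
  refine ⟨T, QL.of_two_mul
    (g := fun n => μ (n + 1) + (μ (n + 1) + (μ (n + 1) + 2 ^ (n + 1) * 1))) ?_
    fun n => le_rfl, ?_⟩
  · refine hμ.succ.add (hμ.succ.add (hμ.succ.add ((QL.pow.const_mul 2).mono fun n => ?_)))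
    rw [pow_succ]; omega
  intro n R _ _ _ S c ℓ h0 hd hℓ hc
  induction n generalizing c ℓ with
  | zero =>
    refine .done _ (Set.union_subset ?_ ?_)
    · simpa using hℓ 0 (by simp)
    · rintro _ ⟨i, rfl⟩
      simp only [pow_zero, fracNum, zero_mul, zero_add, Finset.range_zero, Finset.prod_empty,
        mul_one, coeff_C]
      split_ifs
      · exact hc 0 (by simp)
      · exact h0
  | succ n ih =>
    have h2 : 2 ^ (n + 1) = 2 ^ n + 2 ^ n := by ring
    have hpos : 0 < 2 ^ n := by positivity
    rw [h2] at hd hℓ hc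
    have r₁ := ih c ℓ (fun j hj => hd j (by omega)) (fun j hj => hℓ j (by omega))
      (fun j hj => hc j (by omega))
    have r₂ := ih (fun j => c (2 ^ n + j)) (fun j => ℓ (2 ^ n + j))
      (fun j hj => hd _ (by omega)) (fun j hj => hℓ _ (by omega)) (fun j hj => hc _ (by omega))
    have dP₁ := natDegree_prod_linear (ℓ := ℓ) (N := 2 ^ n) (fun j hj => hd j (by omega))
    have dP₂ := natDegree_prod_linear (ℓ := fun j => ℓ (2 ^ n + j)) (N := 2 ^ n)
      (fun j hj => hd _ (by omega))
    have dF₁ := natDegree_fracNum (c := c) (ℓ := ℓ) (N := 2 ^ n) (fun j hj => hd j (by omega))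
    have dF₂ := natDegree_fracNum (c := fun j => c (2 ^ n + j)) (ℓ := fun j => ℓ (2 ^ n + j))
      (N := 2 ^ n) (fun j hj => hd _ (by omega))
    have dF := natDegree_fracNum (c := c) (ℓ := ℓ) (N := 2 ^ n + 2 ^ n) hd
    rw [h2, Finset.prod_range_add]
    rw [fracNum_add] at dF ⊢
    set P₁ := ∏ j ∈ Finset.range (2 ^ n), ℓ j
    set P₂ := ∏ j ∈ Finset.range (2 ^ n), ℓ (2 ^ n + j)
    set F₁ := fracNum c ℓ (2 ^ n)
    set F₂ := fracNum (fun j => c (2 ^ n + j)) (fun j => ℓ (2 ^ n + j)) (2 ^ n)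
    refine ((r₁.union r₂).mono (m := 2 * T n) (by rw [two_mul])).bind fun S₁ hS₁ hT₁ => ?_
    have hP₁ : Set.range P₁.coeff ⊆ S₁ := fun x hx => hT₁ (Or.inl (Or.inl hx))
    have hF₁ : Set.range F₁.coeff ⊆ S₁ := fun x hx => hT₁ (Or.inl (Or.inr hx))
    have hP₂ : Set.range P₂.coeff ⊆ S₁ := fun x hx => hT₁ (Or.inr (Or.inl hx))
    have hF₂ : Set.range F₂.coeff ⊆ S₁ := fun x hx => hT₁ (Or.inr (Or.inr hx))
    refine (H (n + 1) R S₁ P₁ P₂ (by omega) (by omega) hP₁ hP₂).bind fun S₂ hS₂ hT₂ => ?_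
    refine (H (n + 1) R S₂ F₁ P₂ (by omega) (by omega) (hF₁.trans hS₂) (hP₂.trans hS₂)).bind
      fun S₃ hS₃ hT₃ => ?_
    refine (H (n + 1) R S₃ P₁ F₂ (by omega) (by omega) (hP₁.trans (hS₂.trans hS₃))
      (hF₂.trans (hS₂.trans hS₃))).bind fun S₄ hS₄ hT₄ => ?_
    have := (SLP.polynomial (S := S₄) (N := 2 ^ (n + 1)) (c := 1) (a := F₁ * P₂ + P₁ * F₂)
      (by omega) (hS₄ (hS₃ (hS₂ (hS₁ h0)))) fun i _ => by
        rw [coeff_add]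
        exact SLP.single_add (hS₄ (hT₃ ⟨i, rfl⟩)) (hT₄ ⟨i, rfl⟩))
    refine this.bind (m := 0) fun S₅ hS₅ hT₅ => .done 0 (Set.union_subset ?_ hT₅)
    exact hT₂.trans (hS₃.trans (hS₄.trans hS₅))

theorem SLP.linear {R : Type*} [CommRing R] [Inv R] {S : Set R} {a : R} (ha : a ∈ S)
    (h0 : (0 : R) ∈ S) : SLP S 4 (Set.range (X - C a : R[X]).coeff ∪
      Set.range (1 - C a * X : R[X]).coeff) := by
  refine SLP.mono (n := 1 + 1) ?_ (by norm_num)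
  refine SLP.single_one.bindSingle fun S₁ hS₁ h1 => ?_
  refine SLP.bindSingle (m := 0) (SLP.single_sub (hS₁ h0) (hS₁ ha)) fun S₂ hS₂ hn => .done 0 ?_
  rw [zero_sub] at hn
  have h1' := hS₂ h1
  have h0' := hS₂ (hS₁ h0)
  rintro x (⟨i, rfl⟩ | ⟨i, rfl⟩)
  · rcases i with _ | _ | i
    · simpa using hn
    · simpa [coeff_X, coeff_C] using h1'
    · simpa [coeff_X, coeff_C] using h0'
  · rcases i with _ | _ | i
    · simpa using h1'
    · simpa [coeff_one, coeff_X] using hn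
    · simpa [coeff_one, coeff_X] using h0'

/-- Multipoint evaluation. -/
theorem exists_multiEvalCost : ∃ μ : ℕ → ℕ, QL 2 μ ∧ ∀ (n : ℕ) (R : Type u) [CommRing R]
    [Inv R] [IsRegularInv R] (S : Set R) (α : ℕ → R) (a : R[X]), a.natDegree < 2 ^ n →
    (∀ j < 2 ^ n, α j ∈ S) → Set.range a.coeff ⊆ S →
    SLP S (μ n) ((fun j => a.eval (α j)) '' {j | j < 2 ^ n}) := by
  obtain ⟨μ, hμ, H⟩ := exists_modByMonicCost.{u}
  obtain ⟨ν, hν, HF⟩ := exists_fracNumCost.{u}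
  let T : ℕ → ℕ := fun n => Nat.rec 0 (fun n r => 2 * r + 2 * (2 ^ n * 4 + (ν n + μ n))) n
  refine ⟨T, QL.of_two_mul (g := fun n => 2 * (2 ^ n * 4 + (ν n + μ n))) ?_ fun n => le_rfl, ?_⟩
  · exact (((QL.pow.const_mul 4).mono fun n => by rw [mul_comm]).add (hν.add hμ)).const_mul 2
  intro n R _ _ _ S α a had hα ha
  rcases subsingleton_or_nontrivial R with hR | hR
  · exact .done _ fun x _ => by rw [Subsingleton.elim x 0]; exact zero_mem_of_coeff ha
  induction n generalizing S α a with
  | zero =>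
    refine .done _ ?_
    rintro _ ⟨j, -, rfl⟩
    have h1 : a = C (a.coeff 0) := eq_C_of_natDegree_eq_zero (by simpa using had)
    rw [h1]
    simpa using ha ⟨0, rfl⟩
  | succ n ih =>
    have h2 : 2 ^ (n + 1) = 2 ^ n + 2 ^ n := by ring
    -- Reduction modulo the node polynomial of half of the points preserves the values there. The
    -- node polynomial is recomputed at every level, at the price of at most logarithmic factors;
    -- the numerators `c = 0` play no role.
    have half : ∀ β : ℕ → R, (∀ j < 2 ^ n, β j ∈ S) →
        SLP S (2 ^ n * 4 + (ν n + μ n) + T n) ((fun j => a.eval (β j)) '' {j | j < 2 ^ n}) := by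
      intro β hβ
      set M := ∏ j ∈ Finset.range (2 ^ n), (X - C (β j)) with hM
      have hMm : M.Monic := monic_prod_X_sub_C _ _
      have hMd : M.natDegree = 2 ^ n := by
        rw [hM, natDegree_finsetProd_X_sub_C_eq_card, Finset.card_range]
      have hM1 : M ≠ 1 := by
        intro h
        rw [h, natDegree_one] at hMd
        have : 0 < 2 ^ n := by positivity
        omega
      rw [add_assoc]
      refine (SLP.iUnion_range (N := 2 ^ n) (fun j hj => SLP.linear (hβ j hj)
        (zero_mem_of_coeff ha))).bind fun S₁ hS₁ hT₁ => ?_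
      have hlin : ∀ j < 2 ^ n, Set.range (X - C (β j) : R[X]).coeff ⊆ S₁ := by
        intro j hj x hx
        refine hT₁ ?_
        simp only [Set.mem_iUnion]
        exact ⟨j, hj, Or.inl hx⟩
      rw [add_assoc]
      refine (HF n R S₁ (fun _ => 0) (fun j => X - C (β j)) (hS₁ (zero_mem_of_coeff ha))
        (fun j _ => (natDegree_X_sub_C_le _)) hlin
        (fun j _ => hS₁ (zero_mem_of_coeff ha))).bind fun S₂ hS₂ hT₂ => ?_
      refine (H n R S₂ a M hMm hMd had (ha.trans (hS₁.trans hS₂))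
        (Set.subset_union_left.trans hT₂)).bind fun S₃ hS₃ hT₃ => ?_
      refine (ih S₃ β (a %ₘ M) (hMd ▸ natDegree_modByMonic_lt a hMm hM1)
        (fun j hj => hS₃ (hS₂ (hS₁ (hβ j hj)))) hT₃).mono_right ?_
      rintro _ ⟨j, hj, rfl⟩
      refine ⟨j, hj, ?_⟩
      have hroot : M.eval (β j) = 0 := by
        rw [hM, eval_prod]
        exact Finset.prod_eq_zero (Finset.mem_range.2 hj) (by simp)
      have h3 := congrArg (eval (β j)) (modByMonic_add_div a M)
      rw [eval_add, eval_mul, hroot, zero_mul, add_zero] at h3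
      exact h3
    have := (half α fun j hj => hα j (by omega)).union
      (half (fun j => α (2 ^ n + j)) fun j hj => hα _ (by omega))
    refine (this.mono_right ?_).mono (le_of_eq ?_)
    · rintro _ ⟨j, hj, rfl⟩
      have hj' : j < 2 ^ n + 2 ^ n := h2 ▸ hj
      rcases lt_or_ge j (2 ^ n) with h | h
      · exact Or.inl ⟨j, h, rfl⟩
      · exact Or.inr ⟨j - 2 ^ n, by simp only [Set.mem_ofPred_eq]; omega,
          by simp only [Nat.add_sub_cancel' h]⟩
    · change _ = 2 * T n + 2 * (2 ^ n * 4 + (ν n + μ n))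
      ring

/-! ### The key equation by elimination of constant terms -/

/-- The state of the transition process that solves the key equation: two residual series and the
difference `Δ` of the degree bounds of the corresponding rows. -/
structure DivState (K : Type*) [Field K] where
  Δ : ℤ
  f : K[X]
  g : K[X]

namespace DivState

variable {K : Type*} [Field K]

/-- The condition under which a step exchanges the two rows. -/
def Swaps (s : DivState K) : Prop := 0 < s.Δ ∧ s.g.coeff 0 ≠ 0

open Classical in
/-- One step eliminates a constant term and divides by `X`. -/
noncomputable def step (s : DivState K) : DivState K :=
  if s.Swaps then
    ⟨1 - s.Δ, s.g, divX (C (s.g.coeff 0) * s.f - C (s.f.coeff 0) * s.g)⟩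
  else ⟨s.Δ + 1, s.f, divX (C (s.f.coeff 0) * s.g - C (s.g.coeff 0) * s.f)⟩

open Classical in
/-- The transition matrix of one step. -/
noncomputable def stepMat (s : DivState K) : Matrix (Fin 2) (Fin 2) K[X] :=
  if s.Swaps then !![0, X; C (s.g.coeff 0), -C (s.f.coeff 0)]
  else !![X, 0; -C (s.g.coeff 0), C (s.f.coeff 0)]

/-- The transition matrix of `n` steps. -/
noncomputable def mat : ℕ → DivState K → Matrix (Fin 2) (Fin 2) K[X]
  | 0, _ => 1
  | n + 1, s => mat n s.step * s.stepMat

theorem mat_add (m n : ℕ) (s : DivState K) : mat (m + n) s = mat n (step^[m] s) * mat m s := by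
  induction m generalizing s with
  | zero => simp [mat]
  | succ m ih =>
    rw [Nat.succ_add, mat, ih, mat, Function.iterate_succ_apply, Matrix.mul_assoc]

theorem mat_succ (n : ℕ) (s : DivState K) :
    mat (n + 1) s = (step^[n] s).stepMat * mat n s := by
  rw [mat_add n 1]
  simp [mat]

theorem X_mul_divX_of_coeff_zero {p : K[X]} (h : p.coeff 0 = 0) : X * divX p = p := by
  conv_rhs => rw [← X_mul_divX_add p, h, C_0, add_zero]

theorem stepMat_mulVec (s : DivState K) :
    s.stepMat.mulVec ![s.f, s.g] = (X : K[X]) • ![s.step.f, s.step.g] := by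
  have h1 := X_mul_divX_of_coeff_zero
    (p := C (s.g.coeff 0) * s.f - C (s.f.coeff 0) * s.g) (by simp [mul_comm])
  have h2 := X_mul_divX_of_coeff_zero
    (p := C (s.f.coeff 0) * s.g - C (s.g.coeff 0) * s.f) (by simp [mul_comm])
  by_cases h : s.Swaps
  · simp only [stepMat, step, h, if_true]
    ext1 a
    fin_cases a
    · simp [Matrix.mulVec, dotProduct, Fin.sum_univ_two]
    · simp [Matrix.mulVec, dotProduct, Fin.sum_univ_two, h1]
      ring
  · simp only [stepMat, step, h, if_false]
    ext1 a
    fin_cases a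
    · simp [Matrix.mulVec, dotProduct, Fin.sum_univ_two]
    · simp [Matrix.mulVec, dotProduct, Fin.sum_univ_two, h2]
      ring

theorem mat_mulVec (n : ℕ) (s : DivState K) :
    (mat n s).mulVec ![s.f, s.g] = (X : K[X]) ^ n • ![(step^[n] s).f, (step^[n] s).g] := by
  induction n with
  | zero => simp [mat]
  | succ n ih =>
    rw [mat_succ, ← Matrix.mulVec_mulVec, ih, Matrix.mulVec_smul, stepMat_mulVec, smul_smul,
      ← pow_succ, Function.iterate_succ_apply']

theorem mat_row_zero (n : ℕ) (s : DivState K) :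
    mat n s 0 0 * s.f + mat n s 0 1 * s.g = X ^ n * (step^[n] s).f := by
  have := congrFun (mat_mulVec n s) 0
  simpa [Matrix.mulVec, dotProduct, Fin.sum_univ_two] using this

theorem mat_row_one (n : ℕ) (s : DivState K) :
    mat n s 1 0 * s.f + mat n s 1 1 * s.g = X ^ n * (step^[n] s).g := by
  have := congrFun (mat_mulVec n s) 1
  simpa [Matrix.mulVec, dotProduct, Fin.sum_univ_two] using this

/-- A step reads only constant terms and then shifts by one place, so `n` steps see only `n`
coefficients. This is what makes divide and conquer with truncated residuals possible. -/
theorem mat_congr (n : ℕ) {s s' : DivState K} (hΔ : s.Δ = s'.Δ)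
    (hf : ∀ i < n, s.f.coeff i = s'.f.coeff i) (hg : ∀ i < n, s.g.coeff i = s'.g.coeff i) :
    mat n s = mat n s' ∧ (step^[n] s).Δ = (step^[n] s').Δ := by
  induction n generalizing s s' with
  | zero => exact ⟨rfl, hΔ⟩
  | succ n ih =>
    have hf0 := hf 0 (by omega)
    have hg0 := hg 0 (by omega)
    have hsw : s.Swaps ↔ s'.Swaps := by rw [Swaps, Swaps, hΔ, hg0]
    have key : s.stepMat = s'.stepMat ∧ s.step.Δ = s'.step.Δ ∧
        (∀ i < n, s.step.f.coeff i = s'.step.f.coeff i) ∧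
        ∀ i < n, s.step.g.coeff i = s'.step.g.coeff i := by
      by_cases h : s.Swaps
      · have h' := hsw.1 h
        simp only [stepMat, step, if_pos h, if_pos h', hf0, hg0, hΔ, true_and, coeff_divX,
          coeff_sub, coeff_C_mul]
        refine ⟨fun i hi => hg i (by omega), fun i hi => ?_⟩
        rw [hf (i + 1) (by omega), hg (i + 1) (by omega)]
      · have h' := mt hsw.2 h
        simp only [stepMat, step, if_neg h, if_neg h', hf0, hg0, hΔ, true_and, coeff_divX,
          coeff_sub, coeff_C_mul]
        refine ⟨fun i hi => hf i (by omega), fun i hi => ?_⟩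
        rw [hf (i + 1) (by omega), hg (i + 1) (by omega)]
    obtain ⟨hmat, h1, h2, h3⟩ := key
    have hstep := ih h1 h2 h3
    rw [mat, mat, hmat, hstep.1, Function.iterate_succ_apply, Function.iterate_succ_apply]
    exact ⟨rfl, hstep.2⟩

/-- Both kinds of step change `|Δ|` by at most one, which bounds the number of binary digits needed
for `Δ`. -/
theorem abs_iterate_le (n : ℕ) (s : DivState K) : |(step^[n] s).Δ| ≤ |s.Δ| + n := by
  induction n with
  | zero => simp
  | succ n ih =>
    have : ∀ t : DivState K, |t.step.Δ| ≤ |t.Δ| + 1 := by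
      intro t
      simp only [step]
      split_ifs
      · calc |1 - t.Δ| ≤ |1| + |t.Δ| := abs_sub _ _
          _ = |t.Δ| + 1 := by rw [abs_one, add_comm]
      · calc |t.Δ + 1| ≤ |t.Δ| + |1| := abs_add_le _ _
          _ = |t.Δ| + 1 := by rw [abs_one]
    rw [Function.iterate_succ_apply']
    have h1 := this (step^[n] s)
    push_cast
    omega

/-- The invariants of the process started with the residuals `1` and `g`. -/
theorem invariants (g : K[X]) (n : ℕ) :
    ((step^[n] ⟨1, 1, g⟩).f.coeff 0 ≠ 0 ∧ (mat n ⟨1, 1, g⟩ 0 1).coeff 0 = 0 ∧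
      (mat n ⟨1, 1, g⟩ 1 1).coeff 0 ≠ 0) ∧
    ∃ p q : ℕ, p + q = n + 1 ∧ (step^[n] ⟨1, 1, g⟩).Δ = p - q ∧
      (mat n ⟨1, 1, g⟩ 0 0).degree < p ∧ (mat n ⟨1, 1, g⟩ 0 1).degree < (p + 1 : ℕ) ∧
      (mat n ⟨1, 1, g⟩ 1 0).degree < q ∧ (mat n ⟨1, 1, g⟩ 1 1).degree < (q + 1 : ℕ) := by
  induction n with
  | zero =>
    refine ⟨by simp [mat], 1, 0, rfl, by simp, ?_, ?_, ?_, ?_⟩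
    · simp [mat]
    · simp only [mat, Matrix.one_apply_ne (show (0 : Fin 2) ≠ 1 by decide), degree_zero]
      exact WithBot.bot_lt_coe _
    · simp only [mat, Matrix.one_apply_ne (show (1 : Fin 2) ≠ 0 by decide), degree_zero]
      exact WithBot.bot_lt_coe _
    · simp [mat]
  | succ n ih =>
    obtain ⟨⟨hf, h01, h11⟩, p, q, hpq, hΔ, d00, d01, d10, d11⟩ := ih
    rw [mat_succ, Function.iterate_succ_apply']
    set s := step^[n] (⟨1, 1, g⟩ : DivState K) with hs
    set P := mat n (⟨1, 1, g⟩ : DivState K) with hP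
    have hX : ∀ {a : K[X]} {k : ℕ}, a.degree < k → (X * a : K[X]).degree < (k + 1 : ℕ) := by
      intro a k h
      rw [degree_lt_iff_coeff_zero] at h ⊢
      rintro (_ | m) hm
      · omega
      · rw [coeff_X_mul]
        exact h m (by omega)
    have hC : ∀ {a : K[X]} {k l : ℕ} (c : K), a.degree < k → k ≤ l → (C c * a).degree < l := by
      intro a k l c h hkl
      rw [degree_lt_iff_coeff_zero] at h ⊢
      intro m hm
      rw [coeff_C_mul, h m (by omega), mul_zero]
    have hsub : ∀ {a b : K[X]} {k : ℕ}, a.degree < k → b.degree < k → (a - b).degree < k :=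
      fun ha hb => lt_of_le_of_lt (degree_sub_le _ _) (max_lt ha hb)
    by_cases h : s.Swaps
    · have e : ∀ j, (s.stepMat * P) 0 j = X * P 1 j ∧
          (s.stepMat * P) 1 j = C (s.g.coeff 0) * P 0 j - C (s.f.coeff 0) * P 1 j := by
        intro j
        simp only [stepMat, h, if_true, Matrix.mul_apply, Fin.sum_univ_two]
        constructor
        · simp
        · simp; ring
      have hstep : s.step = ⟨1 - s.Δ, s.g,
        divX (C (s.g.coeff 0) * s.f - C (s.f.coeff 0) * s.g)⟩ := if_pos h
      have hpq' : q < p := by have := h.1; omega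
      refine ⟨⟨?_, ?_, ?_⟩, q + 1, p, by omega, ?_, ?_, ?_, ?_, ?_⟩
      · rw [hstep]; exact h.2
      · rw [(e 1).1, coeff_X_mul_zero]
      · rw [(e 1).2]
        simp [h01, hf, h11]
      · rw [hstep]; push_cast; simp only [hΔ]; ring
      · rw [(e 0).1]; exact hX d10
      · rw [(e 1).1]; exact hX d11
      · rw [(e 0).2]; exact hsub (hC _ d00 le_rfl) (hC _ d10 hpq'.le)
      · rw [(e 1).2]; exact hsub (hC _ d01 le_rfl) (hC _ d11 (by omega))
    · have e : ∀ j, (s.stepMat * P) 0 j = X * P 0 j ∧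
          (s.stepMat * P) 1 j = C (s.f.coeff 0) * P 1 j - C (s.g.coeff 0) * P 0 j := by
        intro j
        simp only [stepMat, h, if_false, Matrix.mul_apply, Fin.sum_univ_two]
        constructor
        · simp
        · simp; ring
      have hstep : s.step = ⟨s.Δ + 1, s.f,
        divX (C (s.f.coeff 0) * s.g - C (s.g.coeff 0) * s.f)⟩ := if_neg h
      -- Without an exchange either the constant term of `g` is zero and row 0 does not enter, or `Δ
      -- ≤ 0`, that is `p ≤ q`, and row 0 does not raise the degree bound of row 1.
      have hC' : ∀ {a : K[X]} {k l : ℕ}, a.degree < k → (p ≤ q → k ≤ l) →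
          (C (s.g.coeff 0) * a).degree < l := by
        intro a k l ha hkl
        by_cases hg : s.g.coeff 0 = 0
        · rw [hg, C_0, zero_mul, degree_zero]; exact WithBot.bot_lt_coe _
        · refine hC _ ha (hkl ?_)
          by_contra hlt
          exact h ⟨by omega, hg⟩
      refine ⟨⟨?_, ?_, ?_⟩, p + 1, q, by omega, ?_, ?_, ?_, ?_, ?_⟩
      · rw [hstep]; exact hf
      · rw [(e 1).1, coeff_X_mul_zero]
      · rw [(e 1).2]
        simp [h01, hf, h11]
      · rw [hstep]; push_cast; simp only [hΔ]; ring
      · rw [(e 0).1]; exact hX d00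
      · rw [(e 1).1]; exact hX d01
      · rw [(e 0).2]; exact hsub (hC _ d10 le_rfl) (hC' d00 id)
      · rw [(e 1).2]; exact hsub (hC _ d11 le_rfl) (hC' d01 (by omega))

/-- If `Λ * T = Ω` with `Λ` of constant term `1` and small degrees, then the process started with
`1` and a series that agrees with `T` up to order `n` recovers `T` as a fraction. -/
theorem mat_mul_eq {n t : ℕ} (ht : 2 * t ≤ n) {g Λ Ω T : K[X]} {M : ℕ} (hM : n < M)
    (hΛ0 : Λ.coeff 0 = 1)
    (hΛ : Λ.degree < (t + 1 : ℕ)) (hΩ : Ω.degree < t) (hT : X ^ M ∣ Λ * T - Ω)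
    (hgT : X ^ n ∣ T - g) :
    (mat n ⟨1, 1, g⟩ 1 1).coeff 0 ≠ 0 ∧
      X ^ M ∣ mat n ⟨1, 1, g⟩ 1 1 * T + mat n ⟨1, 1, g⟩ 1 0 := by
  obtain ⟨⟨hf, h01, h11⟩, p, q, hpq, hΔ, d00, d01, d10, d11⟩ := invariants g n
  refine ⟨h11, ?_⟩
  -- a row of small degree annihilates the series `T`
  have row : ∀ {a b r : K[X]} {d : ℕ}, b.degree < d → a.degree < (d + 1 : ℕ) → d + t ≤ n →
      b * 1 + a * g = X ^ n * r → X ^ M ∣ a * T + b := by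
    intro a b r d hb ha hd hrow
    have h1 : X ^ n ∣ a * Ω + b * Λ := by
      have h2 : a * Ω + b * Λ = -(a * (Λ * T - Ω)) + a * Λ * (T - g) + Λ * (X ^ n * r) := by
        rw [← hrow]; ring
      rw [h2]
      refine dvd_add (dvd_add ?_ (hgT.mul_left _)) ((dvd_mul_right _ _).mul_left _)
      exact ((pow_dvd_pow X hM.le).trans hT).mul_left _ |>.neg_right
    have hdeg : ∀ {u v : K[X]} {k l : ℕ}, u.degree < (k + 1 : ℕ) → v.degree < l → k + l ≤ n →
        ∀ i, n ≤ i → (u * v).coeff i = 0 := by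
      intro u v k l hu hv hkl i hi
      rw [coeff_mul]
      refine Finset.sum_eq_zero fun x hx => ?_
      rw [Finset.HasAntidiagonal.mem_antidiagonal] at hx
      rw [degree_lt_iff_coeff_zero] at hu hv
      rcases lt_or_ge x.1 (k + 1) with h | h
      · rw [hv x.2 (by omega), mul_zero]
      · rw [hu x.1 h, zero_mul]
    -- Divisible by `X ^ n` and of degree below `n`, since `d + t ≤ n` and `2 * t ≤ n`.
    have h0 : a * Ω + b * Λ = 0 := by
      ext i
      rcases lt_or_ge i n with hi | hi
      · rw [X_pow_dvd_iff.1 h1 i hi, coeff_zero]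
      · rw [coeff_add, hdeg ha hΩ hd i hi, mul_comm b, hdeg hΛ hb (by omega) i hi, add_zero,
          coeff_zero]
    have h3 : X ^ M ∣ Λ * (a * T + b) := by
      have : Λ * (a * T + b) = a * (Λ * T - Ω) + (a * Ω + b * Λ) := by ring
      rw [this, h0, add_zero]
      exact hT.mul_left _
    refine (IsCoprime.pow_left ?_).dvd_of_dvd_mul_left h3
    refine (irreducible_X.coprime_iff_not_dvd).2 fun hX => ?_
    rw [X_dvd_iff, hΛ0] at hX
    exact one_ne_zero hX
  have hrow0 := mat_row_zero n (⟨1, 1, g⟩ : DivState K)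
  have hrow1 := mat_row_one n (⟨1, 1, g⟩ : DivState K)
  -- Otherwise row 0 is the short one and annihilates `T` modulo `X ^ M` with `n < M`. Its residual
  -- is `X ^ n` times a series with nonzero constant term, while its entry `(0, 1)` has zero
  -- constant term, so changing `g` to `T` does not affect the coefficient of `X ^ n`: a
  -- contradiction.
  have hlt : q < p := by
    by_contra hle
    have h1 := row d00 d01 (by omega) hrow0
    -- compare the coefficients of `X ^ n`
    have h2 : (mat n ⟨1, 1, g⟩ 0 0 * 1 + mat n ⟨1, 1, g⟩ 0 1 * g).coeff n = 0 := by
      have h3 := X_pow_dvd_iff.1 h1 n hM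
      obtain ⟨r, hr⟩ := hgT
      have h4 : mat n ⟨1, 1, g⟩ 0 0 * 1 + mat n ⟨1, 1, g⟩ 0 1 * g =
          (mat n ⟨1, 1, g⟩ 0 1 * T + mat n ⟨1, 1, g⟩ 0 0) -
            (mat n ⟨1, 1, g⟩ 0 1 * r) * X ^ n := by
        linear_combination (-mat n ⟨1, 1, g⟩ 0 1) * hr
      rw [h4, coeff_sub, h3, coeff_mul_X_pow', if_pos le_rfl, Nat.sub_self, mul_coeff_zero, h01,
        zero_mul, sub_zero]
    rw [hrow0, coeff_X_pow_mul', if_pos le_rfl, Nat.sub_self] at h2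
    exact hf h2
  exact row d10 d11 (by omega) hrow1

end DivState

/-! ### Branch-free arithmetic with the counter `Δ` -/

section Bits

/-- The carry into position `j` when `1` is added to `N`. -/
def incCarry (N : ℕ) : ℕ → Bool
  | 0 => true
  | j + 1 => incCarry N j && N.testBit j

theorem incCarry_succ (N j : ℕ) : incCarry N (j + 1) = (N.testBit 0 && incCarry (N / 2) j) := by
  induction j with
  | zero => simp [incCarry]
  | succ j ih => rw [incCarry, ih, incCarry, Bool.and_assoc, Nat.testBit_succ]

theorem testBit_add_one (N j : ℕ) : (N + 1).testBit j = (N.testBit j ^^ incCarry N j) := by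
  induction j generalizing N with
  | zero =>
    simp only [Nat.testBit_zero, incCarry, Bool.xor_true]
    rcases Nat.mod_two_eq_zero_or_one N with h | h
    · have : (N + 1) % 2 = 1 := by omega
      simp [h, this]
    · have : (N + 1) % 2 = 0 := by omega
      simp [h, this]
  | succ j ih =>
    rw [Nat.testBit_succ, incCarry_succ, Nat.testBit_succ, Nat.testBit_zero]
    rcases Nat.mod_two_eq_zero_or_one N with h | h
    · rw [show (N + 1) / 2 = N / 2 by omega]
      simp [h]
    · rw [show (N + 1) / 2 = N / 2 + 1 by omega, ih]
      simp [h]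

variable {ι : Type*} {K : ι → Type*} [∀ i, Field (K i)]

/-- A family of truth values as an element of the ring. -/
def ofBool (b : ι → Bool) : ∀ i, K i := fun i => if b i then 1 else 0

theorem ofBool_and (b c : ι → Bool) :
    (ofBool (fun i => b i && c i) : ∀ i, K i) = ofBool b * ofBool c := by
  funext i
  cases hb : b i <;> cases hc : c i <;> simp [ofBool, hb, hc]

theorem ofBool_xor (b c : ι → Bool) : (ofBool (fun i => b i ^^ c i) : ∀ i, K i) =
    (ofBool b + ofBool c) - (ofBool b * ofBool c + ofBool b * ofBool c) := by
  funext i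
  cases hb : b i <;> cases hc : c i <;> simp [ofBool, hb, hc, one_add_one_eq_two]

theorem ofBool_not (b : ι → Bool) : (ofBool (fun i => !b i) : ∀ i, K i) = 1 - ofBool b := by
  funext i
  cases hb : b i <;> simp [ofBool, hb]

theorem SLP.single_ofBool_and {S : Set (∀ i, K i)} {b c : ι → Bool} (hb : ofBool b ∈ S)
    (hc : ofBool c ∈ S) : SLP S 1 {(ofBool (fun i => b i && c i) : ∀ i, K i)} := by
  rw [ofBool_and]
  exact SLP.single_mul hb hc

theorem SLP.single_ofBool_xor {S : Set (∀ i, K i)} {b c : ι → Bool} (hb : ofBool b ∈ S)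
    (hc : ofBool c ∈ S) : SLP S 4 {(ofBool (fun i => b i ^^ c i) : ∀ i, K i)} := by
  rw [ofBool_xor]
  refine SLP.sub' (n := 1) (m := 2) (SLP.single_add hb hc) ?_
  exact SLP.bindSingle (n := 1) (SLP.single_mul hb hc) fun S₁ _ h => SLP.single_add h h

/-- A ripple-carry increment controlled by `b`: digit by digit, the new digit is the old one, xor
`b`, xor the carry, where the carry is suppressed whenever `b` holds. Thus `b` selects between
complement and successor, the two updates of the shifted counter. -/
theorem SLP.ofBool_increment {S : Set (∀ i, K i)} (N : ι → ℕ) (w : ℕ) (h1 : (1 : ∀ i, K i) ∈ S)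
    {b : ι → Bool} (hb : ofBool b ∈ S) (hN : ∀ j < w, ofBool (fun i => (N i).testBit j) ∈ S) :
    SLP S (1 + 9 * w) ({(ofBool fun i => !b i && incCarry (N i) w : ∀ i, K i)} ∪
      (fun j => ofBool fun i => if b i then !(N i).testBit j else (N i + 1).testBit j) ''
        {j | j < w}) := by
  induction w with
  | zero =>
    have : (ofBool fun i => !b i && incCarry (N i) 0 : ∀ i, K i) = 1 - ofBool b := by
      rw [← ofBool_not]; simp [incCarry]
    rw [this]
    refine (SLP.single_sub h1 hb).mono_right ?_
    rintro x (hx | ⟨j, hj, -⟩)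
    · exact hx
    · exact absurd hj (Nat.not_lt_zero j)
  | succ w ih =>
    refine SLP.mono (n := 1 + 9 * w + (4 + (4 + 1))) ?_ (by omega)
    refine (ih fun j hj => hN j (by omega)).bind fun S₁ hS₁ hT₁ => ?_
    have hc := hT₁ (Or.inl rfl)
    have hx := hS₁ (hN w (by omega))
    refine (SLP.single_ofBool_xor hx (hS₁ hb)).bindSingle fun S₂ hS₂ hy => ?_
    refine (SLP.single_ofBool_xor hy (hS₂ hc)).bindSingle fun S₃ hS₃ hz => ?_
    refine ((SLP.single_ofBool_and (hS₃ (hS₂ hc)) (hS₃ hy)).bindSingle (m := 0)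
      fun S₄ hS₄ hd => .done 0 ?_)
    rintro _ (rfl | ⟨j, hj, rfl⟩)
    · convert hd using 2
      funext i
      cases b i <;> simp [incCarry]
    · rcases Nat.lt_succ_iff_lt_or_eq.1 hj with hj | rfl
      · exact hS₄ (hS₃ (hS₂ (hT₁ (Or.inr ⟨j, hj, rfl⟩))))
      · convert hS₄ hz using 2
        funext i
        cases b i <;> simp [testBit_add_one]

/-- The binary digits of the numbers `Δ i`, shifted by `2 ^ v - 1`. -/
def bits (v : ℕ) (Δ : ι → ℤ) (j : ℕ) : ∀ i, K i :=
  ofBool fun i => (Δ i + (2 ^ v - 1)).toNat.testBit j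

end Bits

/-! ### Transition matrices over a product of fields -/

section Jump

open DivState

variable {ι : Type*} {K : ι → Type*} [∀ i, Field (K i)]

/-- The states with residuals `F` and `G` in all the factors. -/
noncomputable def states (Δ : ι → ℤ) (F G : (∀ i, K i)[X]) (i : ι) : DivState (K i) :=
  ⟨Δ i, F.map (Pi.evalRingHom K i), G.map (Pi.evalRingHom K i)⟩

/-- The elements produced by `n` steps: the transition matrix and the digits of the new `Δ`. -/
def stepOutput (n v : ℕ) (Δ : ι → ℤ) (F G : (∀ i, K i)[X])
    (P : Matrix (Fin 2) (Fin 2) (∀ i, K i)[X]) : Set (∀ i, K i) :=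
  {x | (∃ a b, x ∈ Set.range (P a b).coeff) ∨
    ∃ j ≤ v, x = bits v (fun i => (step^[n] (states Δ F G i)).Δ) j}

/-- The shift by `2 ^ v - 1` places exactly the positive `d` at or above `2 ^ v`, so digit `v` is
the test for positivity. -/
theorem testBit_shifted {v : ℕ} {d : ℤ} (h : |d| < 2 ^ v) :
    (d + (2 ^ v - 1)).toNat.testBit v = decide (0 < d) := by
  obtain ⟨h1, h2⟩ := abs_lt.1 h
  obtain ⟨N, hN⟩ := Int.eq_ofNat_of_zero_le (show 0 ≤ d + (2 ^ v - 1) by omega)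
  rw [hN, Int.toNat_natCast]
  have hpow : ((2 ^ v : ℕ) : ℤ) = 2 ^ v := by push_cast; rfl
  by_cases hd : 0 < d
  · obtain ⟨r, hr⟩ := Nat.exists_eq_add_of_le (show 2 ^ v ≤ N by omega)
    rw [hr, Nat.testBit_two_pow_add_eq, Nat.testBit_lt_two_pow (by omega)]
    simp [hd]
  · rw [Nat.testBit_lt_two_pow (by omega)]
    simp [hd]

/-- The factors may take different branches in the same step. A 0/1 element `β` marking the
exchanges interpolates between the two transition matrices and controls the update of the digits of
`Δ`. -/
theorem SLP.oneStep (v : ℕ) {S : Set (∀ i, K i)} {Δ : ι → ℤ} {F G : (∀ i, K i)[X]}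
    (hF : Set.range F.coeff ⊆ S) (hG : Set.range G.coeff ⊆ S) (hΔ : ∀ i, |Δ i| + 1 < 2 ^ v)
    (hbits : ∀ j ≤ v, bits v Δ j ∈ S) :
    ∃ P : Matrix (Fin 2) (Fin 2) (∀ i, K i)[X],
      (∀ i a b, (P a b).map (Pi.evalRingHom K i) = mat 1 (states Δ F G i) a b) ∧
      (∀ a b, (P a b).natDegree ≤ 1) ∧
      SLP S (30 * (v + 1)) (stepOutput 1 v Δ F G P) := by
  classical
  set f0 := F.coeff 0 with hf0
  set g0 := G.coeff 0 with hg0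
  set b : ι → Bool := fun i => decide (0 < Δ i ∧ g0 i ≠ 0) with hb
  set β : ∀ i, K i := ofBool b with hβ
  -- Digit `v` tests `0 < Δ`, and `g0 * g0⁻¹` is 1 exactly in the factors where `g0` is nonzero.
  have hβS : β = bits v Δ v * (g0 * g0⁻¹) := by
    funext i
    have h1 := testBit_shifted (v := v) (d := Δ i) (by have := hΔ i; omega)
    simp only [hβ, ofBool, bits, Pi.mul_apply, Pi.inv_apply, h1, hb]
    by_cases h2 : 0 < Δ i <;> by_cases h3 : g0 i = 0 <;> simp [h2, h3]
  have hsw : ∀ i, (states Δ F G i).Swaps ↔ b i = true := by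
    intro i
    simp [Swaps, states, hb, hg0]
  refine ⟨!![C (1 - β) * X, C β * X; C (g0 * (β + β - 1)), C (f0 * (1 - (β + β)))],
    fun i a c => ?_, fun a c => ?_, ?_⟩
  · have hf : (F.map (Pi.evalRingHom K i)).coeff 0 = f0 i := by rw [coeff_map]; rfl
    have hg : (G.map (Pi.evalRingHom K i)).coeff 0 = g0 i := by rw [coeff_map]; rfl
    have hmat : mat 1 (states Δ F G i) = (states Δ F G i).stepMat := by simp [mat]
    rw [hmat, stepMat]
    cases h : b i
    · have hβi : β i = 0 := by simp [hβ, ofBool, h]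
      rw [if_neg (by rw [hsw, h]; simp)]
      simp only [states, hf, hg]
      fin_cases a <;> fin_cases c <;> simp [hβi]
    · have hβi : β i = 1 := by simp [hβ, ofBool, h]
      rw [if_pos (by rw [hsw, h])]
      simp only [states, hf, hg]
      fin_cases a <;> fin_cases c <;> simp [hβi]
  · fin_cases a <;> fin_cases c
    · exact (natDegree_C_mul_le _ _).trans natDegree_X_le
    · exact (natDegree_C_mul_le _ _).trans natDegree_X_le
    · exact (natDegree_C _).le.trans zero_le_one
    · exact (natDegree_C _).le.trans zero_le_one
  · have hf0S : f0 ∈ S := hF ⟨0, rfl⟩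
    have hg0S : g0 ∈ S := hG ⟨0, rfl⟩
    have h0S := zero_mem_of_coeff hF
    refine SLP.mono (n := 1 + (1 + (1 + (1 + (1 + (1 + (1 + (1 + (1 + (1 + (1 + 9 * (v + 1))))))))))))
      ?_ (by omega)
    refine SLP.single_one.bindSingle fun S₁ i₁ h1 => ?_
    refine (SLP.single_inv (i₁ hg0S)).bindSingle fun S₂ i₂ hgi => ?_
    refine (SLP.single_mul (i₂ (i₁ hg0S)) hgi).bindSingle fun S₃ i₃ hgg => ?_
    refine (SLP.single_mul (i₃ (i₂ (i₁ (hbits v le_rfl)))) hgg).bindSingle fun S₄ i₄ hβ' => ?_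
    rw [← hβS] at hβ'
    have h1₄ := i₄ (i₃ (i₂ h1))
    refine (SLP.single_sub h1₄ hβ').bindSingle fun S₅ i₅ ha => ?_
    refine (SLP.single_add (i₅ hβ') (i₅ hβ')).bindSingle fun S₆ i₆ h2β => ?_
    refine (SLP.single_sub h2β (i₆ (i₅ h1₄))).bindSingle fun S₇ i₇ hm => ?_
    refine (SLP.single_sub (i₇ (i₆ (i₅ h1₄))) (i₇ h2β)).bindSingle fun S₈ i₈ hn => ?_
    have up : ∀ {x}, x ∈ S → x ∈ S₈ := fun hx => i₈ (i₇ (i₆ (i₅ (i₄ (i₃ (i₂ (i₁ hx)))))))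
    refine SLP.bind (n := 1) (T := {g0 * (β + β - 1)}) (SLP.single_mul (up hg0S) (i₈ hm))
      fun S₉ i₉ hx => ?_
    refine (SLP.single_mul (i₉ (up hf0S)) (i₉ hn)).bindSingle fun S₁₀ i₁₀ hy => ?_
    have i₅₁₀ : ∀ {x}, x ∈ S₅ → x ∈ S₁₀ := fun hx => i₁₀ (i₉ (i₈ (i₇ (i₆ hx))))
    refine (SLP.ofBool_increment (fun i => (Δ i + (2 ^ v - 1)).toNat) (v + 1)
      (i₅₁₀ (i₅ h1₄)) (i₅₁₀ (i₅ hβ')) fun j hj => i₁₀ (i₉ (up (hbits j (by omega))))).bind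
        (m := 0) fun S₁₁ i₁₁ hT => .done 0 ?_
    have h0' : (0 : ∀ i, K i) ∈ S₁₁ := i₁₁ (i₁₀ (i₉ (up h0S)))
    rintro x (⟨a, c, k, rfl⟩ | ⟨j, hj, rfl⟩)
    · fin_cases a <;> fin_cases c
      · simp only [Fin.zero_eta, Matrix.of_apply, Matrix.cons_val', Matrix.cons_val_zero,
          Matrix.cons_val_fin_one, coeff_C_mul, coeff_X]
        split_ifs
        · rw [mul_one]; exact i₁₁ (i₅₁₀ ha)
        · rwa [mul_zero]
      · simp only [Fin.zero_eta, Fin.mk_one, Matrix.of_apply, Matrix.cons_val', Matrix.cons_val_zero,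
          Matrix.cons_val_one, Matrix.cons_val_fin_one, coeff_C_mul, coeff_X]
        split_ifs
        · rw [mul_one]; exact i₁₁ (i₅₁₀ (i₅ hβ'))
        · rwa [mul_zero]
      · simp only [Fin.zero_eta, Fin.mk_one, Matrix.of_apply, Matrix.cons_val', Matrix.cons_val_zero,
          Matrix.cons_val_one, Matrix.cons_val_fin_one, coeff_C]
        split_ifs
        · exact i₁₁ (i₁₀ (hx rfl))
        · exact h0'
      · simp only [Fin.mk_one, Matrix.of_apply, Matrix.cons_val',
          Matrix.cons_val_one, Matrix.cons_val_fin_one, coeff_C]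
        split_ifs
        · exact i₁₁ hy
        · exact h0'
    · refine hT (Or.inr ⟨j, Nat.lt_succ_of_le hj, ?_⟩)
      refine congrArg ofBool (funext fun i => ?_)
      have hΔi := hΔ i
      obtain ⟨l1, l2⟩ := abs_lt.1 (show |Δ i| < 2 ^ v by omega)
      have l3 : Δ i + 1 < 2 ^ v := by have := le_abs_self (Δ i); omega
      obtain ⟨N, hN⟩ := Int.eq_ofNat_of_zero_le (show 0 ≤ Δ i + (2 ^ v - 1) by omega)
      have hpow : ((2 ^ v : ℕ) : ℤ) = 2 ^ v := by push_cast; rfl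
      have hpow' : 2 ^ (v + 1) = 2 * 2 ^ v := by ring
      change _ = ((states Δ F G i).step.Δ + (2 ^ v - 1)).toNat.testBit j
      rw [hN, Int.toNat_natCast]
      cases h : b i
      · have : (states Δ F G i).step.Δ = Δ i + 1 := by
          rw [step, if_neg (by rw [hsw, h]; simp)]; rfl
        rw [this, show Δ i + 1 + (2 ^ v - 1) = ((N + 1 : ℕ) : ℤ) by push_cast; omega,
          Int.toNat_natCast]
        simp
      · have : (states Δ F G i).step.Δ = 1 - Δ i := by
          rw [step, if_pos (by rw [hsw, h])]; rfl
        -- Replacing `Δ` by `1 - Δ` turns the shifted value `N` into `2 ^ (v + 1) - 1 - N`, the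
        -- complement of all `v + 1` digits.
        have hN2 : N < 2 ^ (v + 1) := by omega
        rw [this, show 1 - Δ i + (2 ^ v - 1) = ((2 ^ (v + 1) - (N + 1) : ℕ) : ℤ) by
          rw [Nat.cast_sub (by omega), hpow']; push_cast; omega, Int.toNat_natCast,
          Nat.testBit_two_pow_sub_succ hN2]
        simp [Nat.lt_succ_of_le hj]

end Jump

section

open DivState

theorem SLP.iUnion_fin_two {R : Type*} [Ring R] [Inv R] {S : Set R} {c : ℕ} {f : Fin 2 → Set R}
    (h : ∀ a, SLP S c (f a)) : SLP S (2 * c) (⋃ a, f a) := by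
  rw [two_mul]
  refine ((h 0).union (h 1)).mono_right (Set.iUnion_subset fun a => ?_)
  fin_cases a
  · exact Set.subset_union_left
  · exact Set.subset_union_right

/-- The divide-and-conquer computation of the transition matrices. -/
theorem exists_jumpCost : ∃ μ : ℕ → ℕ, QL 2 μ ∧ ∀ (k v n : ℕ), n ≤ 2 ^ k →
    ∀ {ι : Type w} {K : ι → Type u} [∀ i, Field (K i)] (S : Set (∀ i, K i)) (Δ : ι → ℤ)
      (F G : (∀ i, K i)[X]), Set.range F.coeff ⊆ S → Set.range G.coeff ⊆ S →
      (∀ i, |Δ i| + n < 2 ^ v) → (∀ j ≤ v, bits v Δ j ∈ S) →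
      ∃ P : Matrix (Fin 2) (Fin 2) (∀ i, K i)[X],
        (∀ i a b, (P a b).map (Pi.evalRingHom K i) = mat n (states Δ F G i) a b) ∧
        (∀ a b, (P a b).natDegree ≤ n) ∧
        SLP S (2 ^ k * (30 * (v + 1)) + μ k) (stepOutput n v Δ F G P) := by
  obtain ⟨μ, hμ, H⟩ := exists_mulCost.{max u w}
  let T : ℕ → ℕ := fun k =>
    Nat.rec 0 (fun k r => 2 * r + (12 * μ (k + 1) + 24 * 2 ^ k)) k
  refine ⟨T, QL.of_two_mul (g := fun k => 12 * μ (k + 1) + 24 * 2 ^ k)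
    ((hμ.succ.const_mul 12).add (QL.pow.const_mul 24)) fun n => le_rfl, ?_⟩
  intro k v n hn ι K _ S Δ F G hF hG hΔ hbits
  induction k generalizing n S Δ F G with
  | zero =>
    obtain rfl | rfl : n = 0 ∨ n = 1 := by simp at hn; omega
    · refine ⟨1, fun i a b => ?_, fun a b => ?_, ?_⟩
      · fin_cases a <;> fin_cases b <;> simp [mat]
      · fin_cases a <;> fin_cases b <;> simp
      · refine SLP.mono (n := 1 + 0) ?_ (by omega)
        refine SLP.single_one.bindSingle fun S₁ i₁ h1 => .done 0 ?_
        have h0 := i₁ (zero_mem_of_coeff hF)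
        rintro x (⟨a, b, j, rfl⟩ | ⟨j, hj, rfl⟩)
        · rw [Matrix.one_apply]
          split_ifs
          · rw [coeff_one]; split_ifs <;> assumption
          · simpa using h0
        · exact i₁ (hbits j hj)
    · obtain ⟨P, h1, h2, h3⟩ := SLP.oneStep v hF hG (by simpa using hΔ) hbits
      exact ⟨P, h1, h2, h3.mono (by omega)⟩
  | succ k ih =>
    have hpow : 2 ^ (k + 1) = 2 * 2 ^ k := by ring
    have hpow2 : 2 ^ (k + 2) = 4 * 2 ^ k := by ring
    have hpos : 0 < 2 ^ k := by positivity
    obtain ⟨n₁, n₂, rfl, hn₁, hn₂⟩ : ∃ n₁ n₂, n = n₁ + n₂ ∧ n₁ ≤ 2 ^ k ∧ n₂ ≤ 2 ^ k :=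
      ⟨min n (2 ^ k), n - min n (2 ^ k), by omega, by omega, by omega⟩
    set F₀ := truncX (2 ^ (k + 1)) F with hF₀
    set G₀ := truncX (2 ^ (k + 1)) G with hG₀
    have hF₀S := range_coeff_truncX hF (2 ^ (k + 1))
    have hG₀S := range_coeff_truncX hG (2 ^ (k + 1))
    have dF₀ : F₀.natDegree < 2 ^ (k + 1) := natDegree_truncX (by positivity) F
    have dG₀ : G₀.natDegree < 2 ^ (k + 1) := natDegree_truncX (by positivity) G
    -- truncation does not matter
    have htrunc : ∀ m ≤ 2 ^ (k + 1), ∀ i, mat m (states Δ F G i) = mat m (states Δ F₀ G₀ i) ∧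
        (step^[m] (states Δ F G i)).Δ = (step^[m] (states Δ F₀ G₀ i)).Δ := by
      intro m hm i
      refine mat_congr m rfl (fun j hj => ?_) (fun j hj => ?_)
      · simp only [states, coeff_map, hF₀, coeff_truncX, if_pos (show j < 2 ^ (k + 1) by omega)]
      · simp only [states, coeff_map, hG₀, coeff_truncX, if_pos (show j < 2 ^ (k + 1) by omega)]
    obtain ⟨P₁, hP₁, dP₁, cP₁⟩ := ih n₁ hn₁ S Δ F₀ G₀ hF₀S hG₀S
      (fun i => by have := hΔ i; push_cast at this; omega) hbits
    set Δ₁ : ι → ℤ := fun i => (step^[n₁] (states Δ F₀ G₀ i)).Δ with hΔ₁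
    -- the residuals after `n₁` steps
    let res : Fin 2 → (∀ i, K i)[X] := fun a =>
      ∑ j ∈ Finset.range (2 ^ k), monomial j ((P₁ a 0 * F₀ + P₁ a 1 * G₀).coeff (n₁ + j))
    have hres : ∀ a i j, j < 2 ^ k → ((res a).map (Pi.evalRingHom K i)).coeff j =
        (mat n₁ (states Δ F₀ G₀ i) a 0 * (states Δ F₀ G₀ i).f +
          mat n₁ (states Δ F₀ G₀ i) a 1 * (states Δ F₀ G₀ i).g).coeff (n₁ + j) := by
      intro a i j hj
      rw [coeff_map, coeff_sum_range_monomial, if_pos hj, ← coeff_map, Polynomial.map_add,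
        Polynomial.map_mul, Polynomial.map_mul, hP₁, hP₁]
      rfl
    -- The first matrix applied to the initial residuals gives `X ^ n₁` times the later ones, so
    -- these are read off from coefficient `n₁` onwards.
    have hstates : ∀ m ≤ 2 ^ k, ∀ i,
        mat m (step^[n₁] (states Δ F₀ G₀ i)) = mat m (states Δ₁ (res 0) (res 1) i) ∧
        (step^[m] (step^[n₁] (states Δ F₀ G₀ i))).Δ =
          (step^[m] (states Δ₁ (res 0) (res 1) i)).Δ := by
      intro m hm i
      refine mat_congr m rfl (fun j hj => ?_) (fun j hj => ?_)
      · refine Eq.symm ((hres 0 i j (by omega)).trans ?_)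
        rw [mat_row_zero, add_comm, coeff_X_pow_mul]
      · refine Eq.symm ((hres 1 i j (by omega)).trans ?_)
        rw [mat_row_one, add_comm, coeff_X_pow_mul]
    -- sums of two products
    have hmul : ∀ (S' : Set (∀ i, K i)) (a b c d : (∀ i, K i)[X]), a.natDegree ≤ 2 ^ k →
        b.natDegree < 2 ^ (k + 1) → c.natDegree ≤ 2 ^ k → d.natDegree < 2 ^ (k + 1) →
        Set.range a.coeff ⊆ S' → Set.range b.coeff ⊆ S' → Set.range c.coeff ⊆ S' →
        Set.range d.coeff ⊆ S' →
        SLP S' (μ (k + 1) + μ (k + 1) + 2 ^ (k + 2) * 1) (Set.range (a * b + c * d).coeff) := by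
      intro S' a b c d da db dc dd ha hb hc hd
      refine ((H (k + 1) _ S' a b (by omega) db ha hb).union
        (H (k + 1) _ S' c d (by omega) dd hc hd)).bind fun S₁ i₁ hT => ?_
      refine SLP.polynomial ?_ (i₁ (zero_mem_of_coeff ha)) fun j _ => ?_
      · have h1 := natDegree_mul_le (p := a) (q := b)
        have h2 := natDegree_mul_le (p := c) (q := d)
        exact lt_of_le_of_lt (natDegree_add_le_of_degree_le (n := 2 ^ (k + 2) - 1) (by omega)
          (by omega)) (by omega)
      · rw [coeff_add]
        exact SLP.single_add (hT (Or.inl ⟨j, rfl⟩)) (hT (Or.inr ⟨j, rfl⟩))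
    have main : ∃ P₂ : Matrix (Fin 2) (Fin 2) (∀ i, K i)[X],
        (∀ i a b, (P₂ a b).map (Pi.evalRingHom K i) =
          mat n₂ (states Δ₁ (res 0) (res 1) i) a b) ∧
        (∀ a b, (P₂ a b).natDegree ≤ n₂) ∧
        SLP S (2 ^ (k + 1) * (30 * (v + 1)) + T (k + 1))
          (stepOutput (n₁ + n₂) v Δ F G (P₂ * P₁)) := by
      have hΔ₁' : ∀ i, |Δ₁ i| + n₂ < 2 ^ v := by
        intro i
        have h1 := abs_iterate_le n₁ (states Δ F₀ G₀ i)
        have h2 := hΔ i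
        push_cast at h2
        have h3 : |(states Δ F₀ G₀ i).Δ| = |Δ i| := rfl
        rw [h3] at h1
        change |(step^[n₁] (states Δ F₀ G₀ i)).Δ| + n₂ < 2 ^ v
        omega
      have hresS : ∀ S' : Set (∀ i, K i), (0 : ∀ i, K i) ∈ S' →
          (∀ a, Set.range (P₁ a 0 * F₀ + P₁ a 1 * G₀).coeff ⊆ S') →
          ∀ a, Set.range (res a).coeff ⊆ S' := by
        rintro S' h0 h a _ ⟨j, rfl⟩
        rw [coeff_sum_range_monomial]
        split_ifs
        · exact h a ⟨_, rfl⟩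
        · exact h0
      -- the residuals are available in every set that contains the following one
      set S₂ : Set (∀ i, K i) := S ∪ stepOutput n₁ v Δ F₀ G₀ P₁ ∪
        ⋃ a, Set.range (P₁ a 0 * F₀ + P₁ a 1 * G₀).coeff with hS₂
      have h0 := zero_mem_of_coeff hF
      -- The matrix `P₂` has to be fixed before the program is composed; it is taken for the set of
      -- exactly the elements needed, and its program is later used over a larger set.
      obtain ⟨P₂, hP₂, dP₂, cP₂⟩ := ih n₂ hn₂ S₂ Δ₁ (res 0) (res 1)
        (hresS S₂ (Or.inl (Or.inl h0)) (fun a x hx => Or.inr (Set.mem_iUnion.2 ⟨a, hx⟩)) 0)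
        (hresS S₂ (Or.inl (Or.inl h0)) (fun a x hx => Or.inr (Set.mem_iUnion.2 ⟨a, hx⟩)) 1)
        hΔ₁' (fun j hj => Or.inl (Or.inr (Or.inr ⟨j, hj, rfl⟩)))
      refine ⟨P₂, hP₂, dP₂, ?_⟩
      -- Two recursive runs, two row combinations for the residuals, and four entries of the product
      -- `P₂ * P₁`: six sums of two products.
      refine SLP.mono (n := (2 ^ k * (30 * (v + 1)) + T k) +
        (2 * (μ (k + 1) + μ (k + 1) + 2 ^ (k + 2) * 1) + ((2 ^ k * (30 * (v + 1)) + T k) +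
          2 * (2 * (μ (k + 1) + μ (k + 1) + 2 ^ (k + 2) * 1))))) ?_ ?_
      · refine cP₁.bind fun S₁ i₁ hT₁ => ?_
        have hP₁S : ∀ a b, Set.range (P₁ a b).coeff ⊆ S₁ := fun a b x hx =>
          hT₁ (Or.inl ⟨a, b, hx⟩)
        refine (SLP.iUnion_fin_two fun a => hmul S₁ (P₁ a 0) F₀ (P₁ a 1) G₀
          ((dP₁ a 0).trans hn₁) dF₀ ((dP₁ a 1).trans hn₁) dG₀ (hP₁S a 0) (hF₀S.trans i₁)
          (hP₁S a 1) (hG₀S.trans i₁)).bind fun S₂' i₂ hT₂ => ?_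
        refine (cP₂.mono_left (S' := S₂') ?_).bind fun S₃ i₃ hT₃ => ?_
        · rintro x ((hx | hx) | hx)
          · exact i₂ (i₁ hx)
          · exact i₂ (hT₁ hx)
          · exact hT₂ hx
        have hP₁S₃ : ∀ a b, Set.range (P₁ a b).coeff ⊆ S₃ := fun a b =>
          (hP₁S a b).trans (i₂.trans i₃)
        have hP₂S₃ : ∀ a b, Set.range (P₂ a b).coeff ⊆ S₃ := fun a b x hx =>
          hT₃ (Or.inl ⟨a, b, hx⟩)
        refine SLP.bind (m := 0) (SLP.iUnion_fin_two fun a => SLP.iUnion_fin_two fun b =>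
          hmul S₃ (P₂ a 0) (P₁ 0 b) (P₂ a 1) (P₁ 1 b) ((dP₂ a 0).trans hn₂)
            (lt_of_le_of_lt (dP₁ 0 b) (by omega)) ((dP₂ a 1).trans hn₂)
            (lt_of_le_of_lt (dP₁ 1 b) (by omega)) (hP₂S₃ a 0) (hP₁S₃ 0 b) (hP₂S₃ a 1)
            (hP₁S₃ 1 b)) fun S₄ i₄ hT₄ => .done 0 ?_
        rintro x (⟨a, b, hx⟩ | ⟨j, hj, rfl⟩)
        · refine hT₄ (Set.mem_iUnion.2 ⟨a, Set.mem_iUnion.2 ⟨b, ?_⟩⟩)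
          rwa [Matrix.mul_apply, Fin.sum_univ_two] at hx
        · refine i₄ (hT₃ (Or.inr ⟨j, hj, ?_⟩))
          refine congrArg (fun d => bits v d j) (funext fun i => ?_)
          rw [(htrunc (n₁ + n₂) (by omega) i).2, add_comm, Function.iterate_add_apply,
            (hstates n₂ hn₂ i).2]
      · change _ ≤ 2 ^ (k + 1) * (30 * (v + 1)) + (2 * T k + (12 * μ (k + 1) + 24 * 2 ^ k))
        rw [hpow, hpow2]
        nlinarith [Nat.zero_le (μ (k + 1))]
    obtain ⟨P₂, hP₂, dP₂, cP₂⟩ := main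
    refine ⟨P₂ * P₁, fun i a b => ?_, fun a b => ?_, cP₂⟩
    · rw [(htrunc (n₁ + n₂) (by omega) i).1, mat_add, (hstates n₂ hn₂ i).1, Matrix.mul_apply,
        Matrix.mul_apply, Fin.sum_univ_two, Fin.sum_univ_two, Polynomial.map_add,
        Polynomial.map_mul, Polynomial.map_mul, hP₁, hP₁, hP₂, hP₂]
    · rw [Matrix.mul_apply, Fin.sum_univ_two]
      have h1 := natDegree_mul_le (p := P₂ a 0) (q := P₁ 0 b)
      have h2 := natDegree_mul_le (p := P₂ a 1) (q := P₁ 1 b)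
      have := dP₂ a 0
      have := dP₂ a 1
      have := dP₁ 0 b
      have := dP₁ 1 b
      exact natDegree_add_le_of_degree_le (by omega) (by omega)

end

/-! ### Power sums and partial fractions -/

section Series

variable {R : Type*} [CommRing R]

/-- The truncated generating series of the power sums `∑ i ∈ E, c i * α i ^ j`. -/
noncomputable def powerSums (E : Finset ℕ) (α c : ℕ → R) (M : ℕ) : R[X] :=
  ∑ j ∈ Finset.range M, monomial j (∑ i ∈ E, c i * α i ^ j)

theorem powerSums_insert {E : Finset ℕ} {a : ℕ} (ha : a ∉ E) (α c : ℕ → R) (M : ℕ) :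
    powerSums (insert a E) α c M =
      powerSums E α c M + C (c a) * ∑ j ∈ Finset.range M, (C (α a) * X) ^ j := by
  rw [powerSums, powerSums, Finset.mul_sum, ← Finset.sum_add_distrib]
  refine Finset.sum_congr rfl fun j _ => ?_
  rw [Finset.sum_insert ha, map_add, add_comm, mul_pow, ← C_pow, ← mul_assoc, ← C_mul,
    C_mul_X_pow_eq_monomial]

theorem X_pow_dvd_geom (a : R) (M : ℕ) :
    X ^ M ∣ (1 - C a * X) * ∑ j ∈ Finset.range M, (C a * X : R[X]) ^ j - 1 := by
  rw [mul_neg_geom_sum, mul_pow]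
  exact ⟨-C a ^ M, by ring⟩

/-- The power sums are the coefficients of `∑ c j / (1 - α j * X)`, expanded as geometric series. -/
theorem X_pow_dvd_prod_mul_powerSums (α c : ℕ → R) (m M : ℕ) :
    X ^ M ∣ (∏ j ∈ Finset.range m, (1 - C (α j) * X)) * powerSums (Finset.range m) α c M -
      fracNum c (fun j => 1 - C (α j) * X) m := by
  induction m with
  | zero => simp [powerSums, fracNum]
  | succ m ih =>
    rw [Finset.range_add_one, powerSums_insert Finset.notMem_range_self, ← Finset.range_add_one,
      Finset.prod_range_succ, fracNum]
    have h := X_pow_dvd_geom (α m) M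
    have e : ((∏ j ∈ Finset.range m, (1 - C (α j) * X)) * (1 - C (α m) * X)) *
        (powerSums (Finset.range m) α c M +
          C (c m) * ∑ j ∈ Finset.range M, (C (α m) * X) ^ j) -
        (fracNum c (fun j => 1 - C (α j) * X) m * (1 - C (α m) * X) +
          C (c m) * ∏ j ∈ Finset.range m, (1 - C (α j) * X)) =
        ((∏ j ∈ Finset.range m, (1 - C (α j) * X)) * powerSums (Finset.range m) α c M -
          fracNum c (fun j => 1 - C (α j) * X) m) * (1 - C (α m) * X) +
        ((1 - C (α m) * X) * ∑ j ∈ Finset.range M, (C (α m) * X : R[X]) ^ j - 1) *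
          (C (c m) * ∏ j ∈ Finset.range m, (1 - C (α j) * X)) := by ring
    rw [e]
    exact dvd_add (ih.mul_right _) (h.mul_right _)

theorem natDegree_one_sub_C_mul_X (a : R) : (1 - C a * X : R[X]).natDegree ≤ 1 := by
  refine (natDegree_sub_le _ _).trans (max_le (by simp) ?_)
  exact (natDegree_C_mul_le _ _).trans natDegree_X_le

/-- This is the key equation: the product is the locator of the support `E`, and `Ω` is the
corresponding evaluator. -/
theorem exists_powerSums_num (E : Finset ℕ) (α c : ℕ → R) (M : ℕ) :
    (∏ j ∈ E, (1 - C (α j) * X) : R[X]).degree < (E.card + 1 : ℕ) ∧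
    (∏ j ∈ E, (1 - C (α j) * X) : R[X]).coeff 0 = 1 ∧
    ∃ Ω : R[X], Ω.degree < E.card ∧
      X ^ M ∣ (∏ j ∈ E, (1 - C (α j) * X)) * powerSums E α c M - Ω := by
  have hlin : ∀ {p : R[X]} {d : ℕ} (a : R), p.degree < d →
      (p * (1 - C a * X) : R[X]).degree < (d + 1 : ℕ) := by
    intro p d a h
    rw [degree_lt_iff_coeff_zero] at h ⊢
    rintro (_ | i) hi
    · omega
    · rw [mul_sub, mul_one, mul_left_comm, coeff_sub, coeff_C_mul, coeff_mul_X, h _ (by omega),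
        h _ (by omega), mul_zero, sub_zero]
  induction E using Finset.induction_on with
  | empty =>
    refine ⟨?_, by simp, 0, ?_, by simp [powerSums]⟩
    · rw [degree_lt_iff_coeff_zero]
      intro i hi
      simp at hi
      rw [Finset.prod_empty, coeff_one, if_neg (by omega)]
    · rw [degree_zero]; exact WithBot.bot_lt_coe _
  | insert a E ha ih =>
    obtain ⟨hd, h0, Ω, hΩ, hdvd⟩ := ih
    rw [Finset.prod_insert ha, Finset.card_insert_of_notMem ha, powerSums_insert ha,
      mul_comm (1 - C (α a) * X)]
    refine ⟨hlin _ hd, ?_, Ω * (1 - C (α a) * X) + C (c a) * ∏ j ∈ E, (1 - C (α j) * X), ?_, ?_⟩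
    · rw [mul_coeff_zero, h0]; simp
    · refine lt_of_le_of_lt (degree_add_le _ _) (max_lt (hlin _ hΩ) ?_)
      rw [degree_lt_iff_coeff_zero] at hd ⊢
      intro i hi
      rw [coeff_C_mul, hd i hi, mul_zero]
    · have h := X_pow_dvd_geom (α a) M
      have e : ((∏ j ∈ E, (1 - C (α j) * X)) * (1 - C (α a) * X)) *
          (powerSums E α c M + C (c a) * ∑ j ∈ Finset.range M, (C (α a) * X) ^ j) -
          (Ω * (1 - C (α a) * X) + C (c a) * ∏ j ∈ E, (1 - C (α j) * X)) =
          ((∏ j ∈ E, (1 - C (α j) * X)) * powerSums E α c M - Ω) * (1 - C (α a) * X) +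
          ((1 - C (α a) * X) * ∑ j ∈ Finset.range M, (C (α a) * X : R[X]) ^ j - 1) *
            (C (c a) * ∏ j ∈ E, (1 - C (α j) * X)) := by ring
      rw [e]
      exact dvd_add (hdvd.mul_right _) (h.mul_right _)

theorem reflect_one_sub (a : R) : reflect 1 (1 - C a * X : R[X]) = X - C a := by
  ext i
  rw [coeff_reflect]
  rcases i with _ | _ | i
  · rw [revAt_le (by omega)]; simp [coeff_one]
  · rw [revAt_le (by omega)]; simp
  · rw [revAt_eq_self_of_lt (by omega)]; simp [coeff_one, coeff_X]

theorem reflect_prod_one_sub (α : ℕ → R) (m : ℕ) :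
    reflect m (∏ j ∈ Finset.range m, (1 - C (α j) * X)) =
      ∏ j ∈ Finset.range m, (X - C (α j)) := by
  induction m with
  | zero => ext i; rw [coeff_reflect]; rcases i with _ | i <;> simp [revAt_eq_self_of_lt]
  | succ m ih =>
    rw [Finset.prod_range_succ, reflect_mul _ _ (natDegree_prod_linear fun j _ =>
      natDegree_one_sub_C_mul_X _) (natDegree_one_sub_C_mul_X _), ih, reflect_one_sub,
      Finset.prod_range_succ]

/-- Reversal exchanges the factors `1 - α j * X`, natural for power sums, with the factors `X - α
j`, whose numerator can be evaluated at the nodes. -/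
theorem reflect_fracNum (α c : ℕ → R) (m : ℕ) :
    reflect m (fracNum c (fun j => 1 - C (α j) * X) (m + 1)) =
      fracNum c (fun j => X - C (α j)) (m + 1) := by
  induction m with
  | zero =>
    simp only [fracNum, zero_mul, zero_add, Finset.range_zero, Finset.prod_empty, mul_one]
    ext i; rw [coeff_reflect]; rcases i with _ | i <;> simp [revAt_eq_self_of_lt]
  | succ m ih =>
    rw [fracNum, reflect_add, reflect_C_mul, reflect_prod_one_sub, reflect_mul _ _ (F := m)
      (natDegree_fracNum fun j _ => natDegree_one_sub_C_mul_X _) (natDegree_one_sub_C_mul_X _), ih,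
      reflect_one_sub]
    rfl

/-- Every other summand of the numerator contains the factor `X - α i`, so the value at a node
isolates its own coefficient. -/
theorem eval_fracNum (α c : ℕ → R) {m i : ℕ} (hi : i < m) :
    (fracNum c (fun j => X - C (α j)) m).eval (α i) =
      c i * ∏ j ∈ (Finset.range m).erase i, (α i - α j) := by
  induction m with
  | zero => omega
  | succ m ih =>
    rw [fracNum, eval_add, eval_mul, eval_mul, eval_C, eval_prod, eval_sub, eval_X, eval_C]
    simp only [eval_sub, eval_X, eval_C]
    rcases Nat.lt_succ_iff_lt_or_eq.1 hi with h | rfl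
    · rw [ih h, Finset.prod_eq_zero (Finset.mem_range.2 h) (sub_self _), mul_zero, add_zero,
        Finset.range_add_one, Finset.erase_insert_of_ne (by omega), Finset.prod_insert (by simp)]
      ring
    · rw [sub_self, mul_zero, zero_add, Finset.range_add_one,
        Finset.erase_insert Finset.notMem_range_self]

theorem fracNum_congr {c c' : ℕ → R} {ℓ ℓ' : ℕ → R[X]} {m : ℕ} (hc : ∀ j < m, c j = c' j)
    (hℓ : ∀ j < m, ℓ j = ℓ' j) : fracNum c ℓ m = fracNum c' ℓ' m := by
  induction m with
  | zero => rfl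
  | succ m ih =>
    rw [fracNum, fracNum, ih (fun j hj => hc j (by omega)) (fun j hj => hℓ j (by omega)),
      hc m (by omega), hℓ m (by omega),
      Finset.prod_congr rfl fun j hj => hℓ j (by have := Finset.mem_range.1 hj; omega)]

/-- Padding by the fractions `0 / 1` reduces an arbitrary number of points to a power of two. -/
theorem fracNum_of_le {c : ℕ → R} {ℓ : ℕ → R[X]} {m N : ℕ} (hmN : m ≤ N)
    (hc : ∀ j, m ≤ j → c j = 0) (hℓ : ∀ j, m ≤ j → ℓ j = 1) :
    fracNum c ℓ N = fracNum c ℓ m := by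
  induction N, hmN using Nat.le_induction with
  | base => rfl
  | succ N h ih => rw [fracNum, hc N h, hℓ N h, ih]; simp

end Series

/-- The fractions with denominators `X - α j` and `1 - α j * X`, for any number of points. -/
theorem exists_pointsCost : ∃ μ : ℕ → ℕ, QL 2 μ ∧ ∀ (k m : ℕ), m ≤ 2 ^ k → ∀ (R : Type u)
    [CommRing R] [Inv R] [IsRegularInv R] (S : Set R) (α c : ℕ → R), (0 : R) ∈ S →
    (∀ j < m, α j ∈ S) → (∀ j < m, c j ∈ S) →
    SLP S (μ k) (Set.range (∏ j ∈ Finset.range m, (1 - C (α j) * X)).coeff ∪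
      Set.range (fracNum c (fun j => 1 - C (α j) * X) m).coeff ∪
      Set.range (fracNum c (fun j => X - C (α j)) m).coeff) := by
  obtain ⟨μ, hμ, H⟩ := exists_fracNumCost.{u}
  refine ⟨fun k => 1 + (4 * 2 ^ k + (μ k + μ k)), (QL.const (by norm_num) 1).add
    ((QL.pow.const_mul 4).add (hμ.add hμ)), ?_⟩
  intro k m hm R _ _ _ S α c h0 hα hc
  refine SLP.single_one.bindSingle fun S₁ i₁ h1 => ?_
  refine ((SLP.iUnion_range (N := m) fun j hj => SLP.linear (i₁ (hα j hj)) (i₁ h0)).mono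
    (m := 4 * 2 ^ k) (by omega)).bind fun S₂ i₂ hT₂ => ?_
  have hlin : ∀ j < m, Set.range (X - C (α j) : R[X]).coeff ∪
      Set.range (1 - C (α j) * X : R[X]).coeff ⊆ S₂ := by
    intro j hj x hx
    refine hT₂ ?_
    simp only [Set.mem_iUnion]
    exact ⟨j, hj, hx⟩
  have key : ∀ ℓ : ℕ → R[X], (∀ j, (ℓ j).natDegree ≤ 1) →
      (∀ j < m, Set.range (ℓ j).coeff ⊆ S₂) →
      SLP S₂ (μ k) (Set.range (∏ j ∈ Finset.range m, ℓ j).coeff ∪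
        Set.range (fracNum c ℓ m).coeff) := by
    intro ℓ hd hℓ
    have h := H k R S₂ (fun j => if j < m then c j else 0) (fun j => if j < m then ℓ j else 1)
      (i₂ (i₁ h0)) (fun j _ => ?_) (fun j _ => ?_) (fun j _ => ?_)
    · rw [fracNum_of_le hm (fun j hj => if_neg (by omega)) (fun j hj => if_neg (by omega)),
        fracNum_congr (c' := c) (ℓ' := ℓ) (fun j hj => if_pos hj) (fun j hj => if_pos hj)] at h
      have hp : ∏ j ∈ Finset.range (2 ^ k), (if j < m then ℓ j else 1) =
          ∏ j ∈ Finset.range m, ℓ j := by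
        rw [← Finset.prod_subset (Finset.range_subset_range.2 hm) fun j _ hj => if_neg fun h =>
          hj (Finset.mem_range.2 h)]
        exact Finset.prod_congr rfl fun j hj => if_pos (Finset.mem_range.1 hj)
      rwa [hp] at h
    · split_ifs
      · exact hd j
      · simp
    · split_ifs with h
      · exact hℓ j h
      · rintro _ ⟨i, rfl⟩
        rw [coeff_one]
        split_ifs
        · exact i₂ h1
        · exact i₂ (i₁ h0)
    · split_ifs with h
      · exact i₂ (i₁ (hc j h))
      · exact i₂ (i₁ h0)
  refine ((key _ (fun j => natDegree_one_sub_C_mul_X _)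
    fun j hj => Set.subset_union_right.trans (hlin j hj)).union
      (key _ (fun j => natDegree_X_sub_C_le _)
        fun j hj => Set.subset_union_left.trans (hlin j hj))).mono_right ?_
  rintro x (hx | hx)
  · exact Or.inl hx
  · exact Or.inr (Or.inr hx)

/-- Multipoint evaluation at any number of points. -/
theorem exists_evalPointsCost : ∃ μ : ℕ → ℕ, QL 2 μ ∧ ∀ (k m : ℕ), m ≤ 2 ^ k → ∀ (R : Type u)
    [CommRing R] [Inv R] [IsRegularInv R] (S : Set R) (α : ℕ → R) (a : R[X]),
    a.natDegree < 2 ^ k → (∀ j < m, α j ∈ S) → Set.range a.coeff ⊆ S →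
    SLP S (μ k) ((fun j => a.eval (α j)) '' {j | j < m}) := by
  obtain ⟨μ, hμ, H⟩ := exists_multiEvalCost.{u}
  refine ⟨μ, hμ, fun k m hm R _ _ _ S α a had hα ha => ?_⟩
  refine (H k R S (fun j => if j < m then α j else 0) a had (fun j _ => ?_) ha).mono_right ?_
  · split_ifs with h
    · exact hα j h
    · exact zero_mem_of_coeff ha
  · rintro _ ⟨j, hj, rfl⟩
    have hj' : j < m := hj
    exact ⟨j, lt_of_lt_of_le hj' hm, by simp only [if_pos hj']⟩

/-! ### Key equation, node weights and power sums over products -/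

section KeyEquation

theorem X_pow_dvd_iff_map {ι : Type*} {K : ι → Type*} [∀ i, Field (K i)] {M : ℕ}
    {p : (∀ i, K i)[X]} : X ^ M ∣ p ↔ ∀ i, X ^ M ∣ p.map (Pi.evalRingHom K i) := by
  simp only [X_pow_dvd_iff, coeff_map, Pi.evalRingHom_apply]
  exact ⟨fun h i d hd => by rw [h d hd]; rfl, fun h d hd => funext fun i => h i d hd⟩

variable {R : Type*} [CommRing R]

theorem coeff_powerSums (E : Finset ℕ) (α c : ℕ → R) (M j : ℕ) :
    (powerSums E α c M).coeff j = if j < M then ∑ i ∈ E, c i * α i ^ j else 0 :=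
  coeff_sum_range_monomial _ _ _

theorem natDegree_powerSums {M : ℕ} (hM : 0 < M) (E : Finset ℕ) (α c : ℕ → R) :
    (powerSums E α c M).natDegree < M :=
  natDegree_sum_range_monomial hM _

theorem map_powerSums {T : Type*} [CommRing T] (φ : R →+* T) (E : Finset ℕ) (α c : ℕ → R) (M : ℕ) :
    (powerSums E α c M).map φ = powerSums E (fun j => φ (α j)) (fun j => φ (c j)) M := by
  ext j
  rw [coeff_map, coeff_powerSums, coeff_powerSums]
  split_ifs <;> simp

theorem powerSums_of_subset {E E' : Finset ℕ} (h : E ⊆ E') {α c : ℕ → R}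
    (hc : ∀ j ∈ E', j ∉ E → c j = 0) (M : ℕ) : powerSums E' α c M = powerSums E α c M := by
  ext j
  rw [coeff_powerSums, coeff_powerSums,
    Finset.sum_subset h fun i hi hi' => by rw [hc i hi hi', zero_mul]]

theorem X_pow_dvd_powerSums_sub {n M : ℕ} (h : n ≤ M) (E : Finset ℕ) (α c : ℕ → R) :
    X ^ n ∣ powerSums E α c M - powerSums E α c n := by
  rw [X_pow_dvd_iff]
  intro d hd
  rw [coeff_sub, coeff_powerSums, coeff_powerSums, if_pos hd, if_pos (by omega), sub_self]

end KeyEquation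

/-- The value at `α j` of the derivative of `∏ i < m, (X - α i)`. -/
def nodeWeight {R : Type*} [CommRing R] (α : ℕ → R) (m j : ℕ) : R :=
  ∏ i ∈ (Finset.range m).erase j, (α j - α i)

section Pi

variable {ι : Type*} {K : ι → Type*} [∀ i, Field (K i)]

theorem nodeWeight_apply (α : ℕ → ∀ i, K i) (m j : ℕ) (i : ι) :
    nodeWeight α m j i = nodeWeight (fun l => α l i) m j := by
  simp [nodeWeight, Finset.prod_apply]

theorem nodeWeight_ne_zero {K : Type*} [Field K] {α : ℕ → K} {m j : ℕ} (hj : j < m)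
    (h : Set.InjOn α {j | j < m}) : nodeWeight α m j ≠ 0 :=
  Finset.prod_ne_zero_iff.2 fun i hi hij => by
    obtain ⟨h1, h2⟩ := Finset.mem_erase.1 hi
    exact h1 (h (Finset.mem_range.1 h2) hj (sub_eq_zero.1 hij).symm)

theorem nodeWeight_mul_inv {α : ℕ → ∀ i, K i} {m j : ℕ} (hj : j < m)
    (h : ∀ i, Set.InjOn (fun j => α j i) {j | j < m}) :
    nodeWeight α m j * (nodeWeight α m j)⁻¹ = 1 := by
  funext i
  rw [Pi.mul_apply, Pi.inv_apply, nodeWeight_apply]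
  exact mul_inv_cancel₀ (nodeWeight_ne_zero hj (h i))

end Pi

/-- The weights `nodeWeight α m j`. -/
theorem exists_nodeWeightCost : ∃ μ : ℕ → ℕ, QL 2 μ ∧ ∀ (k m : ℕ), 0 < m → m ≤ 2 ^ k →
    ∀ (R : Type u) [CommRing R] [Inv R] [IsRegularInv R] (S : Set R) (α : ℕ → R),
    (∀ j < m, α j ∈ S) → SLP S (μ k) (nodeWeight α m '' {j | j < m}) := by
  obtain ⟨μ₁, hμ₁, H₁⟩ := exists_pointsCost.{u}
  obtain ⟨μ₂, hμ₂, H₂⟩ := exists_evalPointsCost.{u}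
  refine ⟨fun k => 1 + (1 + (μ₁ k + μ₂ k)), (QL.const (by norm_num) 1).add
    ((QL.const (by norm_num) 1).add (hμ₁.add hμ₂)), ?_⟩
  intro k m hm0 hm R _ _ _ S α hα
  refine SLP.single_one.bindSingle fun S₁ i₁ h1 => ?_
  -- There is no instruction for zero; it is obtained as `1 - 1`.
  refine (SLP.single_sub h1 h1).bindSingle fun S₂ i₂ h0 => ?_
  rw [sub_self] at h0
  refine (H₁ k m hm R S₂ α (fun _ => 1) h0 (fun j hj => i₂ (i₁ (hα j hj)))
    fun j _ => i₂ h1).bind fun S₃ i₃ hT => ?_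
  refine (H₂ k m hm R S₃ α (fracNum (fun _ => 1) (fun j => X - C (α j)) m) ?_
    (fun j hj => i₃ (i₂ (i₁ (hα j hj)))) (Set.subset_union_right.trans hT)).mono_right ?_
  · refine (natDegree_fracNum fun j _ => ?_).trans_lt (show m - 1 < 2 ^ k by omega)
    exact natDegree_X_sub_C_le _
  · rintro _ ⟨j, hj, rfl⟩
    exact ⟨j, hj, by simp only [eval_fracNum α _ hj, one_mul, nodeWeight]⟩

/-- The power sums `∑ i < m, c i * α i ^ j`. -/
theorem exists_powerSumsCost : ∃ μ : ℕ → ℕ, QL 2 μ ∧ ∀ (k m : ℕ), 0 < m → m ≤ 2 ^ k →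
    ∀ (R : Type u) [CommRing R] [Inv R] [IsRegularInv R] (S : Set R) (α c : ℕ → R),
    (∀ j < m, α j ∈ S) → (∀ j < m, c j ∈ S) →
    SLP S (μ k) (Set.range (powerSums (Finset.range m) α c (2 ^ k)).coeff) := by
  obtain ⟨μ₁, hμ₁, H₁⟩ := exists_pointsCost.{u}
  obtain ⟨μ₂, hμ₂, H₂⟩ := exists_invCost.{u}
  obtain ⟨μ₃, hμ₃, H₃⟩ := exists_mulCost.{u}
  refine ⟨fun k => 1 + (1 + (μ₁ k + (μ₂ k + (μ₃ k + 0)))), (QL.const (by norm_num) 1).add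
    ((QL.const (by norm_num) 1).add (hμ₁.add (hμ₂.add (hμ₃.add (QL.const (by norm_num) 0))))), ?_⟩
  intro k m hm0 hm R _ _ _ S α c hα hc
  refine SLP.single_one.bindSingle fun S₁ i₁ h1 => ?_
  refine (SLP.single_sub h1 h1).bindSingle fun S₂ i₂ h0 => ?_
  rw [sub_self] at h0
  refine (H₁ k m hm R S₂ α c h0 (fun j hj => i₂ (i₁ (hα j hj)))
    fun j hj => i₂ (i₁ (hc j hj))).bind fun S₃ i₃ hT => ?_
  set Λ : R[X] := ∏ j ∈ Finset.range m, (1 - C (α j) * X) with hΛ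
  have hΛ0 : Λ.coeff 0 * 1 = 1 := by
    rw [mul_one]; exact (exists_powerSums_num (Finset.range m) α c 0).2.1
  obtain ⟨g, dg, hg, hgS⟩ := H₂ k R S₃ Λ 1 (i₃ (i₂ h1)) hΛ0
    ((Set.subset_union_left.trans Set.subset_union_left).trans hT)
  set N := fracNum c (fun j => 1 - C (α j) * X) m with hN
  have dN : N.natDegree < 2 ^ k := by
    refine (natDegree_fracNum fun j _ => ?_).trans_lt (show m - 1 < 2 ^ k by omega)
    exact natDegree_one_sub_C_mul_X _
  refine hgS.bind fun S₄ i₄ hg₄ => ?_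
  refine (H₃ k R S₄ g N dg dN hg₄
    (((Set.subset_union_right.trans Set.subset_union_left).trans hT).trans i₄)).bind
    fun S₅ i₅ hT₅ => .done 0 ?_
  -- Multiplying by the inverse series `g` of the denominator `Λ` recovers the series from its
  -- numerator.
  have key : powerSums (Finset.range m) α c (2 ^ k) = truncX (2 ^ k) (g * N) := by
    refine eq_truncX_of_dvd (natDegree_powerSums (by positivity) _ _ _) ?_
    have h := X_pow_dvd_prod_mul_powerSums α c m (2 ^ k)
    have e : powerSums (Finset.range m) α c (2 ^ k) - g * N =
        g * (Λ * powerSums (Finset.range m) α c (2 ^ k) - N) -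
          (Λ * g - 1) * powerSums (Finset.range m) α c (2 ^ k) := by ring
    rw [e]
    exact dvd_sub (h.mul_left _) (hg.mul_right _)
  rw [key]
  exact range_coeff_truncX hT₅ _

/-- The support `E` may vary with the factor `i` and enters only the proof; the process depends on
the first `n` power sums alone. -/
theorem mat_keyEquation {ι : Type*} {K : ι → Type*} [∀ i, Field (K i)] (α e : ℕ → ∀ i, K i)
    {m n M : ℕ} (hM : n < M) (i : ι) {E : Finset ℕ} (hEm : E ⊆ Finset.range m)
    (hEn : 2 * E.card ≤ n) (hE0 : ∀ j < m, j ∉ E → e j i = 0) :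
    (DivState.mat n (states (fun _ => 1) 1 (powerSums (Finset.range m) α e n) i) 1 1).coeff 0 ≠ 0 ∧
    X ^ M ∣ DivState.mat n (states (fun _ => 1) 1 (powerSums (Finset.range m) α e n) i) 1 1 *
        (powerSums (Finset.range m) α e M).map (Pi.evalRingHom K i) +
      DivState.mat n (states (fun _ => 1) 1 (powerSums (Finset.range m) α e n) i) 1 0 := by
  have hTi : (powerSums (Finset.range m) α e M).map (Pi.evalRingHom K i) =
      powerSums E (fun j => α j i) (fun j => e j i) M := by
    rw [map_powerSums]
    exact powerSums_of_subset hEm (fun j hj hj' => hE0 j (Finset.mem_range.1 hj) hj') _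
  obtain ⟨hΛ, hΛ0, Ω, hΩ, hdvd⟩ := exists_powerSums_num E (fun j => α j i) (fun j => e j i) M
  have hgT : X ^ n ∣ (powerSums (Finset.range m) α e M).map (Pi.evalRingHom K i) -
      (powerSums (Finset.range m) α e n).map (Pi.evalRingHom K i) := by
    have h := X_pow_dvd_powerSums_sub hM.le (Finset.range m) α e
    rw [← Polynomial.map_sub]
    exact X_pow_dvd_iff_map.1 h i
  rw [hTi] at hgT ⊢
  rw [states, Polynomial.map_one]
  exact DivState.mat_mul_eq hEn hM hΛ0 hΛ hΩ hdvd hgT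

/-! ### Decoding over a product of fields -/

/-- Over a product of fields, a vector with few nonzero entries in every field is computed from its
power sums. -/
theorem exists_syndromeCost : ∃ μ : ℕ → ℕ, QL 2 μ ∧ ∀ (k m n : ℕ), n < m → m ≤ 2 ^ k →
    ∀ {ι : Type w} {K : ι → Type u} [∀ i, Field (K i)] (S : Set (∀ i, K i))
      (α e : ℕ → ∀ i, K i), (∀ j < m, α j ∈ S) →
      (∀ j < n, ∑ l ∈ Finset.range m, e l * α l ^ j ∈ S) →
      (∀ i, Set.InjOn (fun j => α j i) {j | j < m}) →
      (∀ i, ∃ E ⊆ Finset.range m, 2 * E.card ≤ n ∧ ∀ j < m, j ∉ E → e j i = 0) →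
      SLP S (μ k) (e '' {j | j < m}) := by
  obtain ⟨μ₁, hμ₁, H₁⟩ := exists_jumpCost.{u, w}
  obtain ⟨μ₂, hμ₂, H₂⟩ := exists_invCost.{max u w}
  obtain ⟨μ₃, hμ₃, H₃⟩ := exists_mulCost.{max u w}
  obtain ⟨μ₄, hμ₄, H₄⟩ := exists_pointsCost.{max u w}
  obtain ⟨μ₅, hμ₅, H₅⟩ := exists_evalPointsCost.{max u w}
  obtain ⟨μ₆, hμ₆, H₆⟩ := exists_nodeWeightCost.{max u w}
  have q1 : QL 2 fun k => 2 ^ k * (30 * (k + 2 + 1)) :=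
    ⟨90, 1, fun k => by
      rw [pow_one, mul_comm 90, mul_assoc]; exact Nat.mul_le_mul_left _ (by omega)⟩
  refine ⟨fun k => 1 + (1 + ((2 ^ k * (30 * (k + 2 + 1)) + μ₁ k) + (1 + (μ₂ k + (μ₃ k +
    (2 ^ k * 1 + (μ₄ k + (μ₃ (k + 1) + (μ₅ k + (μ₆ k + 2 ^ k * 2)))))))))), ?_, ?_⟩
  · have h1 : QL 2 fun _ => 1 := QL.const (by norm_num) 1
    have h2 : ∀ c, QL 2 fun k => 2 ^ k * c := fun c =>
      (QL.pow.const_mul c).mono fun k => by rw [mul_comm]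
    exact h1.add (h1.add ((q1.add hμ₁).add (h1.add (hμ₂.add (hμ₃.add ((h2 1).add (hμ₄.add
      (hμ₃.succ.add (hμ₅.add (hμ₆.add (h2 2)))))))))))
  intro k m n hnm hm ι K _ S α e hα hs hinj hE
  refine SLP.single_one.bindSingle fun S₁ i₁ h1 => ?_
  refine (SLP.single_sub h1 h1).bindSingle fun S₂ i₂ h0 => ?_
  rw [sub_self] at h0
  replace h1 := i₂ h1
  replace hα : ∀ j < m, α j ∈ S₂ := fun j hj => i₂ (i₁ (hα j hj))
  set G := powerSums (Finset.range m) α e n with hG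
  have hGS : Set.range G.coeff ⊆ S₂ := by
    rintro _ ⟨j, rfl⟩
    rw [hG, coeff_powerSums]
    split_ifs with hj
    · exact i₂ (i₁ (hs j hj))
    · exact h0
  obtain ⟨P, hP, dP, cP⟩ := H₁ k (k + 2) n (by omega) S₂ (fun _ => 1) 1 G
    (by
      rintro _ ⟨j, rfl⟩
      rw [coeff_one]
      split_ifs <;> assumption) hGS
    (fun i => by
      have : (n : ℤ) < 2 ^ k := by exact_mod_cast hnm.trans_le hm
      rw [abs_one, pow_add]; omega)
    -- Initially `Δ = 1` in every factor, so each digit is the constant 0 or 1.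
    (fun j _ => by
      cases hb : ((1 : ℤ) + (2 ^ (k + 2) - 1)).toNat.testBit j
      · convert h0 using 1
        funext i
        simp only [bits, ofBool, hb]; rfl
      · convert h1 using 1
        funext i
        simp only [bits, ofBool, hb]; rfl)
  refine cP.bind fun S₃ i₃ hT₃ => ?_
  have hPS : ∀ a b, Set.range (P a b).coeff ⊆ S₃ := fun a b x hx => hT₃ (Or.inl ⟨a, b, hx⟩)
  set T := powerSums (Finset.range m) α e (2 ^ k) with hT
  have dT : T.natDegree < 2 ^ k := natDegree_powerSums (by positivity) _ _ _
  have key : ∀ i, ((P 1 1).coeff 0) i ≠ 0 ∧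
      X ^ 2 ^ k ∣ (P 1 1 * T + P 1 0).map (Pi.evalRingHom K i) := by
    intro i
    obtain ⟨E, hEm, hEn, hE0⟩ := hE i
    obtain ⟨r1, r2⟩ := mat_keyEquation α e (hnm.trans_le hm) i hEm hEn hE0
    rw [← hP] at r1 r2
    rw [← hP, ← Polynomial.map_mul, ← Polynomial.map_add] at r2
    rw [coeff_map] at r1
    exact ⟨r1, r2⟩
  have hdvd : X ^ 2 ^ k ∣ P 1 1 * T + P 1 0 := X_pow_dvd_iff_map.2 fun i => (key i).2
  have hunit : (P 1 1).coeff 0 * ((P 1 1).coeff 0)⁻¹ = 1 :=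
    funext fun i => mul_inv_cancel₀ (key i).1
  refine (SLP.single_inv (hPS 1 1 ⟨0, rfl⟩)).bindSingle fun S₄ i₄ hc => ?_
  obtain ⟨g, dg, hg, cg⟩ := H₂ k _ S₄ (P 1 1) _ hc hunit ((hPS 1 1).trans i₄)
  refine cg.bind fun S₅ i₅ hg₅ => ?_
  refine (H₃ k _ S₅ (P 1 0) g ((dP 1 0).trans_lt (by omega)) dg
    (((hPS 1 0).trans i₄).trans i₅) hg₅).bind fun S₆ i₆ hT₆ => ?_
  have iS : S₂ ⊆ S₆ := i₃.trans (i₄.trans (i₅.trans i₆))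
  -- The second row gives `T = -P 1 0 / P 1 1` modulo `X ^ 2 ^ k`, which extends the `n` known power
  -- sums to `2 ^ k` of them.
  have hTeq : T = truncX (2 ^ k) (-(P 1 0 * g)) := by
    refine eq_truncX_of_dvd dT ?_
    have e : T - -(P 1 0 * g) = g * (P 1 1 * T + P 1 0) - (P 1 1 * g - 1) * T := by ring
    rw [e]
    exact dvd_sub (hdvd.mul_left _) (hg.mul_right _)
  refine (SLP.polynomial dT (iS h0) fun j hj => (?_ : SLP S₆ 1 {T.coeff j})).bind
    fun S₇ i₇ hT₇ => ?_
  · rw [hTeq, coeff_truncX, if_pos hj, coeff_neg, ← zero_sub]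
    exact SLP.single_sub (iS h0) (hT₆ ⟨j, rfl⟩)
  refine (H₄ k m hm _ S₇ α (fun _ => 0) (i₇ (iS h0)) (fun j hj => i₇ (iS (hα j hj)))
    fun _ _ => i₇ (iS h0)).bind fun S₈ i₈ hT₈ => ?_
  set Λ : (∀ i, K i)[X] := ∏ j ∈ Finset.range m, (1 - C (α j) * X) with hΛ
  have hpow : 2 ^ (k + 1) = 2 * 2 ^ k := by ring
  have dΛ : Λ.natDegree ≤ m := natDegree_prod_linear fun j _ => natDegree_one_sub_C_mul_X _
  refine (H₃ (k + 1) _ S₈ Λ T (by omega) (by omega)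
    ((Set.subset_union_left.trans Set.subset_union_left).trans hT₈) (hT₇.trans i₈)).bind
    fun S₉ i₉ hT₉ => ?_
  replace iS : S₂ ⊆ S₉ := iS.trans (i₇.trans (i₈.trans i₉))
  set N := fracNum e (fun j => 1 - C (α j) * X) m with hN
  have dN : N.natDegree < 2 ^ k := by
    refine (natDegree_fracNum fun j _ => ?_).trans_lt (show m - 1 < 2 ^ k by omega)
    exact natDegree_one_sub_C_mul_X _
  -- The denominator runs over all nodes instead of the unknown support. It is a known polynomial,
  -- and nodes without error have numerator zero.
  have hNeq : N = truncX (2 ^ k) (Λ * T) := by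
    refine eq_truncX_of_dvd dN ?_
    rw [← dvd_neg, neg_sub]
    exact X_pow_dvd_prod_mul_powerSums α e m (2 ^ k)
  have hNS : Set.range N.coeff ⊆ S₉ := by rw [hNeq]; exact range_coeff_truncX hT₉ _
  set N' := fracNum e (fun j => X - C (α j)) m with hN'
  have hN'S : Set.range N'.coeff ⊆ S₉ := by
    obtain ⟨m', rfl⟩ : ∃ m', m = m' + 1 := ⟨m - 1, by omega⟩
    rw [hN', ← reflect_fracNum]
    exact range_coeff_reflect hNS _
  have dN' : N'.natDegree < 2 ^ k := by
    refine (natDegree_fracNum fun j _ => ?_).trans_lt (show m - 1 < 2 ^ k by omega)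
    exact natDegree_X_sub_C_le _
  refine (H₅ k m hm _ S₉ α N' dN' (fun j hj => iS (hα j hj)) hN'S).bind fun S₁₀ i₁₀ hT₁₀ => ?_
  refine (H₆ k m (by omega) hm _ S₁₀ α fun j hj => i₁₀ (iS (hα j hj))).bind fun S₁₁ i₁₁ hT₁₁ => ?_
  refine (SLP.of_forall_lt (N := m) (c := 2) (f := fun j => {e j}) (fun j hj => ?_) ?_).mono
    (by omega)
  · have h2 : N'.eval (α j) = e j * nodeWeight α m j := eval_fracNum α e hj
    have h3 : e j = N'.eval (α j) * (nodeWeight α m j)⁻¹ := by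
      rw [h2, mul_assoc, nodeWeight_mul_inv hj hinj, mul_one]
    rw [h3]
    exact (SLP.single_inv (hT₁₁ ⟨j, hj, rfl⟩)).bindSingle fun S' i' h' =>
      SLP.single_mul (i' (i₁₁ (hT₁₀ ⟨j, hj, rfl⟩))) h'
  · rintro _ ⟨j, hj, rfl⟩
    exact Or.inr ⟨j, hj, rfl⟩

/-- Over a product of fields, the correction of a received word which is close to a word that is
orthogonal to the weighted power vectors. -/
theorem exists_decodeCost : ∃ μ : ℕ → ℕ, QL 2 μ ∧ ∀ (k m n : ℕ), n < m → m ≤ 2 ^ k →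
    ∀ {ι : Type w} {K : ι → Type u} [∀ i, Field (K i)] (S : Set (∀ i, K i))
      (α r x : ℕ → ∀ i, K i), (∀ j < m, α j ∈ S) → (∀ j < m, r j ∈ S) →
      (∀ i, Set.InjOn (fun j => α j i) {j | j < m}) →
      (∀ j < n, ∑ l ∈ Finset.range m, x l * (nodeWeight α m l)⁻¹ * α l ^ j = 0) →
      (∀ i, ∃ E ⊆ Finset.range m, 2 * E.card ≤ n ∧ ∀ j < m, j ∉ E → r j i = x j i) →
      SLP S (μ k) (x '' {j | j < m}) := by
  obtain ⟨μ₁, hμ₁, H₁⟩ := exists_syndromeCost.{u, w}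
  obtain ⟨μ₂, hμ₂, H₂⟩ := exists_powerSumsCost.{max u w}
  obtain ⟨μ₃, hμ₃, H₃⟩ := exists_nodeWeightCost.{max u w}
  refine ⟨fun k => μ₃ k + (2 ^ k * 2 + (μ₂ k + (μ₁ k + 2 ^ k * 2))), ?_, ?_⟩
  · have h2 : QL 2 fun k => 2 ^ k * 2 := (QL.pow.const_mul 2).mono fun k => by rw [mul_comm]
    exact hμ₃.add (h2.add (hμ₂.add (hμ₁.add h2)))
  intro k m n hnm hm ι K _ S α r x hα hr hinj horth hE
  refine (H₃ k m (by omega) hm _ S α hα).bind fun S₁ i₁ hT₁ => ?_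
  have hc : SLP S₁ (2 ^ k * 2) ((fun j => r j * (nodeWeight α m j)⁻¹) '' {j | j < m}) := by
    refine (SLP.of_forall_lt (N := m) (c := 2) (f := fun j => {r j * (nodeWeight α m j)⁻¹})
      (fun j hj => ?_) ?_).mono (by omega)
    · exact (SLP.single_inv (hT₁ ⟨j, hj, rfl⟩)).bindSingle fun S' i' h' =>
        SLP.single_mul (i' (i₁ (hr j hj))) h'
    · rintro _ ⟨j, hj, rfl⟩
      exact Or.inr ⟨j, hj, rfl⟩
  refine hc.bind fun S₂ i₂ hT₂ => ?_
  refine (H₂ k m (by omega) hm _ S₂ α (fun j => r j * (nodeWeight α m j)⁻¹)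
    (fun j hj => i₂ (i₁ (hα j hj))) fun j hj => hT₂ ⟨j, hj, rfl⟩).bind fun S₃ i₃ hT₃ => ?_
  -- The orthogonality of `x` removes its contribution, so the syndrome of the scaled error is that
  -- of the scaled received word.
  have hsyn : ∀ j < n, ∑ l ∈ Finset.range m, ((r l - x l) * (nodeWeight α m l)⁻¹) * α l ^ j =
      (powerSums (Finset.range m) α (fun j => r j * (nodeWeight α m j)⁻¹) (2 ^ k)).coeff j := by
    intro j hj
    rw [coeff_powerSums, if_pos (by omega), ← sub_eq_zero, ← Finset.sum_sub_distrib,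
      ← neg_eq_zero, ← Finset.sum_neg_distrib, ← horth j hj]
    exact Finset.sum_congr rfl fun l _ => by ring
  refine (H₁ k m n hnm hm S₃ α (fun l => (r l - x l) * (nodeWeight α m l)⁻¹)
    (fun j hj => i₃ (i₂ (i₁ (hα j hj)))) (fun j hj => ?_) hinj fun i => ?_).bind
    fun S₄ i₄ hT₄ => ?_
  · rw [hsyn j hj]; exact hT₃ ⟨j, rfl⟩
  · obtain ⟨E, h1, h2, h3⟩ := hE i
    refine ⟨E, h1, h2, fun j hj hjE => ?_⟩
    simp only [Pi.mul_apply, Pi.sub_apply, h3 j hj hjE, sub_self, zero_mul]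
  refine (SLP.of_forall_lt (N := m) (c := 2) (f := fun j => {x j}) (fun j hj => ?_) ?_).mono
    (by omega)
  · have h : x j = r j - ((r j - x j) * (nodeWeight α m j)⁻¹) * nodeWeight α m j := by
      rw [mul_assoc, mul_comm _⁻¹, nodeWeight_mul_inv hj hinj]; ring
    rw [h]
    exact (SLP.single_mul (hT₄ ⟨j, hj, rfl⟩) (i₄ (i₃ (i₂ (hT₁ ⟨j, hj, rfl⟩))))).bindSingle
      fun S' i' h' => SLP.single_sub (i' (i₄ (i₃ (i₂ (i₁ (hr j hj)))))) h'
  · rintro _ ⟨j, hj, rfl⟩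
    exact Or.inr ⟨j, hj, rfl⟩

/-! ### Duality and minimum distances over a field -/

/-- A vector of finite length, continued by `0`. -/
def extendZero {R : Type*} [Zero R] {m : ℕ} (v : Fin m → R) (j : ℕ) : R :=
  if h : j < m then v ⟨j, h⟩ else 0

theorem extendZero_fin {R : Type*} [Zero R] {m : ℕ} (v : Fin m → R) (j : Fin m) :
    extendZero v j = v j := dif_pos j.2

theorem extendZero_of_lt {R : Type*} [Zero R] {m : ℕ} (v : Fin m → R) {j : ℕ} (h : j < m) :
    extendZero v j = v ⟨j, h⟩ := dif_pos h

theorem injOn_extendZero {R : Type*} [Zero R] {m : ℕ} {v : Fin m → R}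
    (hv : Function.Injective v) : Set.InjOn (extendZero v) {j | j < m} := by
  intro i hi j hj h
  rw [extendZero_of_lt v hi, extendZero_of_lt v hj] at h
  exact congrArg Fin.val (hv h)

section Code

variable {F : Type*} [Field F] {m : ℕ}

/-- Comparison of the top coefficients in Lagrange interpolation. For degree below `m - 1` the sum
is zero, which is the source of both dualities below. -/
theorem sum_eval_mul_nodeWeight_inv {α : ℕ → F} (hα : Set.InjOn α {j | j < m}) {p : F[X]}
    (hp : p.degree < m) :
    ∑ j ∈ Finset.range m, p.eval (α j) * (nodeWeight α m j)⁻¹ = p.coeff (m - 1) := by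
  have h := Lagrange.coeff_eq_sum (s := Finset.range m) (v := α) (P := p)
    (fun i hi j hj => hα (Finset.mem_range.1 hi) (Finset.mem_range.1 hj))
    (by rwa [Finset.card_range])
  rw [Finset.card_range] at h
  rw [h]
  exact Finset.sum_congr rfl fun j _ => by rw [nodeWeight, div_eq_mul_inv]

theorem sum_power_eq (α e : Fin m → F) (j : ℕ) :
    ∑ l ∈ Finset.range m, extendZero e l * extendZero α l ^ j = ∑ i, e i * α i ^ j := by
  rw [← Fin.sum_univ_eq_sum_range]
  exact Finset.sum_congr rfl fun i _ => by rw [extendZero_fin, extendZero_fin]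

theorem mulVec_vandermondeMatrix (α e : Fin m → F) (n : ℕ) (j : Fin n) :
    (vandermondeMatrix α n).transpose.mulVec e j = ∑ i, e i * α i ^ (j : ℕ) := by
  simp only [Matrix.mulVec, dotProduct, Matrix.transpose_apply, vandermondeMatrix, Matrix.of_apply]
  exact Finset.sum_congr rfl fun i _ => mul_comm _ _

/-- For a codeword given by `p`, the sum is the coefficient of `X ^ (m - 1)` in `p * X ^ j`, whose
degree is too small. -/
theorem sum_reedSolomonCode {α : Fin m → F} (hα : Function.Injective α) {k n : ℕ}
    (hn : n + k ≤ m) {x : Fin m → F} (hx : x ∈ reedSolomonCode α k) {j : ℕ} (hj : j < n) :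
    ∑ l ∈ Finset.range m,
      extendZero x l * (nodeWeight (extendZero α) m l)⁻¹ * extendZero α l ^ j = 0 := by
  obtain ⟨p, hp, rfl⟩ := Submodule.mem_map.1 hx
  have hp' : (p * X ^ j).degree < ((m - 1 : ℕ) : WithBot ℕ) := by
    rw [degree_lt_iff_coeff_zero]
    intro i hi
    rw [coeff_mul_X_pow', if_pos (by omega)]
    exact (degree_lt_iff_coeff_zero _ _).1 (mem_degreeLT.1 hp) _ (by omega)
  have h := sum_eval_mul_nodeWeight_inv (injOn_extendZero hα)
    (hp'.trans_le (by exact_mod_cast Nat.sub_le m 1))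
  rw [(degree_lt_iff_coeff_zero _ _).1 hp' _ le_rfl] at h
  rw [← h]
  refine Finset.sum_congr rfl fun l hl => ?_
  rw [eval_mul, eval_pow, eval_X, extendZero_of_lt _ (Finset.mem_range.1 hl),
    extendZero_of_lt α (Finset.mem_range.1 hl)]
  simp only [LinearMap.pi_apply, leval_apply]
  ring

variable [DecidableEq F]

theorem hammingNorm_le_card {v : Fin m → F} {E : Finset ℕ} (h : ∀ i, v i ≠ 0 → (i : ℕ) ∈ E) :
    hammingNorm v ≤ E.card :=
  Finset.card_le_card_of_injOn Fin.val (fun i hi => h i (by simpa using hi))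
    Fin.val_injective.injOn

theorem exists_support (e : Fin m → F) : ∃ E ⊆ Finset.range m, E.card = hammingNorm e ∧
    ∀ j < m, j ∉ E → extendZero e j = 0 := by
  refine ⟨(Finset.univ.filter fun i => e i ≠ 0).map Fin.valEmbedding, fun j hj => ?_,
    Finset.card_map _, fun j hj hjE => ?_⟩
  · obtain ⟨i, _, rfl⟩ := Finset.mem_map.1 hj
    exact Finset.mem_range.2 i.2
  · rw [extendZero_of_lt e hj]
    by_contra h
    exact hjE (Finset.mem_map.2 ⟨⟨j, hj⟩, by simpa using h, rfl⟩)

theorem codeMinDist_le_hammingNorm {C : Submodule F (Fin m → F)} {v : Fin m → F} (hv : v ∈ C)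
    (h : v ≠ 0) : codeMinDist C ≤ hammingNorm v :=
  Nat.sInf_le ⟨v, hv, 0, C.zero_mem, h, (hammingDist_zero_right v).symm⟩

/-- The polynomial that vanishes exactly at the first `k - 1` nodes gives a light codeword. Only
this upper bound is needed: a distance below half the minimum distance then has its double at most
`m - k`. -/
theorem codeMinDist_reedSolomonCode_le {α : Fin m → F} (hα : Function.Injective α) {k : ℕ}
    (hk : 1 ≤ k) (hkm : k ≤ m) : codeMinDist (reedSolomonCode α k) ≤ m - k + 1 := by
  set p : F[X] := ∏ j ∈ Finset.range (k - 1), (X - C (extendZero α j)) with hp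
  have heval : ∀ i : Fin m, p.eval (α i) = 0 ↔ (i : ℕ) < k - 1 := by
    intro i
    rw [hp, eval_prod, Finset.prod_eq_zero_iff]
    constructor
    · rintro ⟨j, hj, h⟩
      have hj := Finset.mem_range.1 hj
      rw [eval_sub, eval_X, eval_C, extendZero_of_lt α (by omega), sub_eq_zero] at h
      rw [hα h]
      exact hj
    · intro h
      exact ⟨i, Finset.mem_range.2 h, by rw [extendZero_fin]; simp⟩
  have hmem : (fun i => p.eval (α i)) ∈ reedSolomonCode α k := by
    refine Submodule.mem_map.2 ⟨p, mem_degreeLT.2 ?_, rfl⟩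
    rw [hp, degree_prod]
    simp only [degree_X_sub_C, Finset.sum_const, Finset.card_range, nsmul_one]
    exact_mod_cast (by omega : k - 1 < k)
  refine (codeMinDist_le_hammingNorm hmem fun h => ?_).trans ?_
  · have := (heval ⟨k - 1, by omega⟩).1 (congrFun h _)
    simp at this
  · refine (hammingNorm_le_card (E := Finset.Ico (k - 1) m) fun i hi => ?_).trans ?_
    · have := mt (heval i).2 hi
      have := i.2
      simp only [Finset.mem_Ico]; omega
    · rw [Nat.card_Ico]; omega

/-- The inverse node weights of the first `n + 1` nodes form a light word orthogonal to all powers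
below `n`, by Lagrange interpolation on these nodes. -/
theorem codeMinDist_vandermondeDualCode_le {α : Fin m → F} (hα : Function.Injective α) {n : ℕ}
    (hn : n < m) : codeMinDist (vandermondeDualCode α n) ≤ n + 1 := by
  have hinj : Set.InjOn (extendZero α) {j | j < n + 1} :=
    (injOn_extendZero hα).mono fun j (hj : j < n + 1) => show j < m by omega
  set v : Fin m → F := fun i =>
    if (i : ℕ) < n + 1 then (nodeWeight (extendZero α) (n + 1) i)⁻¹ else 0 with hv
  have hmem : v ∈ vandermondeDualCode α n := by
    refine LinearMap.mem_ker.2 (funext fun j => ?_)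
    rw [Matrix.mulVecLin_apply, mulVec_vandermondeMatrix]
    have h := sum_eval_mul_nodeWeight_inv hinj (p := X ^ (j : ℕ))
      ((degree_X_pow_le _).trans_lt (by exact_mod_cast j.2.trans (Nat.lt_succ_self n)))
    rw [coeff_X_pow, if_neg (by have := j.2; omega)] at h
    rw [Pi.zero_apply, ← h, ← sum_power_eq,
      ← Finset.sum_subset (Finset.range_mono (show n + 1 ≤ m from hn))]
    · refine Finset.sum_congr rfl fun l hl => ?_
      have hl := Finset.mem_range.1 hl
      rw [extendZero_of_lt v (by omega), hv, eval_pow, eval_X, mul_comm]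
      simp only [if_pos hl]
    · intro l hl hl'
      rw [extendZero_of_lt v (Finset.mem_range.1 hl), hv]
      simp only [if_neg (mt Finset.mem_range.2 hl'), zero_mul]
  refine (codeMinDist_le_hammingNorm hmem fun h => ?_).trans ?_
  · have h0 := congrFun h ⟨0, by omega⟩
    simp only [hv, Nat.zero_lt_succ, if_true, Pi.zero_apply, inv_eq_zero] at h0
    exact nodeWeight_ne_zero (Nat.zero_lt_succ n) hinj h0
  · refine (hammingNorm_le_card (E := Finset.range (n + 1)) fun i hi => ?_).trans
      (Finset.card_range _).le
    by_contra h
    exact hi (if_neg (mt Finset.mem_range.2 h))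

end Code

/-! ### Circuits from the product over all problem instances -/

theorem QL.exists_gateBound {f : ℕ → ℕ} (hf : QL 2 f) : ∃ A a : ℕ, ∀ m, 1 ≤ m →
    4 * f (Nat.clog 2 m) + m ≤ A * m * (Nat.log 2 m + 1) ^ a := by
  obtain ⟨A, a, h⟩ := ((hf.const_mul 4).add QL.pow).comp_clog
  exact ⟨A, a, fun m hm =>
    (Nat.add_le_add_left (Nat.le_pow_clog one_lt_two m) _).trans (h m hm)⟩

/-- The problems of evaluating a polynomial at `m` points. -/
structure EvalProblem (m : ℕ) : Type (u + 1) where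
  F : Type u
  field : Field F
  p : F[X]
  α : Fin m → F
  degree_lt : p.degree < m

/-- The problems of decoding a received word. -/
structure DecodingProblem (m k : ℕ) : Type (u + 1) where
  F : Type u
  field : Field F
  decEq : DecidableEq F
  α : Fin m → F
  injective : Function.Injective α
  w : Fin m → F
  r : Fin m → F
  mem : w ∈ reedSolomonCode α k
  close : 2 * hammingDist r w < codeMinDist (reedSolomonCode α k)

/-- The problems of decoding a syndrome. -/
structure SyndromeProblem (m n : ℕ) : Type (u + 1) where
  F : Type u
  field : Field F
  decEq : DecidableEq F
  α : Fin m → F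
  injective : Function.Injective α
  e : Fin m → F
  light : 2 * hammingNorm e < codeMinDist (vandermondeDualCode α n)

attribute [instance] EvalProblem.field DecodingProblem.field DecodingProblem.decEq
  SyndromeProblem.field SyndromeProblem.decEq

theorem exists_multipointEvaluation : ∃ A a : ℕ, ∀ m : ℕ,
    ∃ (s : ℕ) (c : RevCircuit ((Fin m ⊕ Fin m) ⊕ Fin m ⊕ Fin s)),
      c.length ≤ A * m * (Nat.log 2 m + 1) ^ a ∧
      ∀ (F : Type u) [Field F] (p : F[X]) (α : Fin m → F), p.degree < m →
        c.Computes (Sum.elim (fun j : Fin m => p.coeff j) α) (fun i => p.eval (α i)) := by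
  -- The problem instances over fields in universe `u` form a type one universe higher, and so does
  -- their product ring.
  obtain ⟨μ, hμ, H⟩ := exists_evalPointsCost.{u + 1}
  obtain ⟨A, a, hA⟩ := ((QL.const (by norm_num) 1).add
    ((QL.const (by norm_num) 1).add hμ)).exists_gateBound
  refine ⟨A, a, fun m => ?_⟩
  -- For `m = 0` the bound allows no gates, and the empty circuit suffices.
  rcases Nat.eq_zero_or_pos m with rfl | hm
  · refine ⟨0, [], by simp, fun F _ p α _ y => ?_⟩
    exact funext fun j => by
      rcases j with j | j | j
      · rfl
      · exact j.elim0
      · exact j.elim0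
  -- Each input wire becomes one element of the product ring: its value as a function of the problem
  -- instance.
  set x : Fin m ⊕ Fin m → ∀ e : EvalProblem.{u} m, e.F :=
    Sum.elim (fun j e => e.p.coeff j) (fun j e => e.α j) with hx
  have hpow : m ≤ 2 ^ Nat.clog 2 m := Nat.le_pow_clog one_lt_two m
  have hP : SLP (Set.range x) (1 + (1 + μ (Nat.clog 2 m)))
      (Set.range fun (i : Fin m) (e : EvalProblem.{u} m) => e.p.eval (e.α i)) := by
    refine SLP.single_one.bindSingle fun S₁ i₁ h1 => ?_
    refine (SLP.single_sub h1 h1).bindSingle fun S₂ i₂ h0 => ?_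
    rw [sub_self] at h0
    set P : (∀ e : EvalProblem.{u} m, e.F)[X] :=
      ∑ j ∈ Finset.range m, monomial j (fun e => e.p.coeff j) with hPdef
    have hmap : ∀ e : EvalProblem.{u} m, P.map (Pi.evalRingHom _ e) = e.p := by
      intro e
      ext j
      rw [coeff_map, hPdef, coeff_sum_range_monomial]
      split_ifs with hj
      · rfl
      · exact ((degree_lt_iff_coeff_zero _ _).1 e.degree_lt j (by omega)).symm
    refine (H (Nat.clog 2 m) m hpow _ S₂ (fun j e => extendZero e.α j) P
      ((natDegree_sum_range_monomial hm _).trans_le hpow) (fun j hj => ?_) ?_).mono_right ?_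
    · exact i₂ (i₁ ⟨Sum.inr ⟨j, hj⟩, funext fun e => (extendZero_of_lt e.α hj).symm⟩)
    · rintro _ ⟨j, rfl⟩
      rw [hPdef, coeff_sum_range_monomial]
      split_ifs with hj
      · exact i₂ (i₁ ⟨Sum.inl ⟨j, hj⟩, rfl⟩)
      · exact h0
    · rintro _ ⟨i, rfl⟩
      refine ⟨i, i.2, funext fun e => ?_⟩
      have h := eval_map_apply (Pi.evalRingHom (fun e : EvalProblem.{u} m => e.F) e)
        (p := P) (fun e => extendZero e.α i)
      rw [hmap] at h
      simp only [Pi.evalRingHom_apply, extendZero_fin] at h ⊢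
      exact h.symm
  obtain ⟨s, c, hc, h⟩ := exists_circuit x _ hP
  refine ⟨s, c, hc.trans (hA m hm), fun F _ p α hp => ?_⟩
  convert h ⟨F, _, p, α, hp⟩ using 1
  funext j
  rcases j with j | j <;> rfl

theorem exists_wordDecoding : ∃ A a : ℕ, ∀ m k : ℕ, 1 ≤ k → k ≤ m →
    ∃ (s : ℕ) (c : RevCircuit ((Fin m ⊕ Fin m) ⊕ Fin m ⊕ Fin s)),
      c.length ≤ A * m * (Nat.log 2 m + 1) ^ a ∧
      ∀ (F : Type u) [Field F] [DecidableEq F] (α : Fin m → F),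
        Function.Injective α → ∀ (w r : Fin m → F), w ∈ reedSolomonCode α k →
        2 * hammingDist r w < codeMinDist (reedSolomonCode α k) →
        c.Computes (Sum.elim α r) w := by
  obtain ⟨μ, hμ, H⟩ := exists_decodeCost.{u, u + 1}
  obtain ⟨A, a, hA⟩ := hμ.exists_gateBound
  refine ⟨A, a, fun m k hk hkm => ?_⟩
  set x : Fin m ⊕ Fin m → ∀ e : DecodingProblem.{u} m k, e.F :=
    Sum.elim (fun j e => e.α j) (fun j e => e.r j) with hx
  have hP : SLP (Set.range x) (μ (Nat.clog 2 m))
      (Set.range fun (i : Fin m) (e : DecodingProblem.{u} m k) => e.w i) := by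
    -- A Reed–Solomon code of dimension `k` satisfies `n = m - k` weighted parity checks, matching
    -- the distance bound `m - k + 1`.
    refine (H (Nat.clog 2 m) m (m - k) (by omega) (Nat.le_pow_clog one_lt_two m) (Set.range x)
      (fun j e => extendZero e.α j) (fun j e => extendZero e.r j) (fun j e => extendZero e.w j)
      (fun j hj => ⟨Sum.inl ⟨j, hj⟩, funext fun e => (extendZero_of_lt e.α hj).symm⟩)
      (fun j hj => ⟨Sum.inr ⟨j, hj⟩, funext fun e => (extendZero_of_lt e.r hj).symm⟩)
      (fun e => injOn_extendZero e.injective) (fun j hj => funext fun e => ?_)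
      fun e => ?_).mono_right ?_
    · rw [Finset.sum_apply]
      simp only [Pi.mul_apply, Pi.inv_apply, Pi.pow_apply, nodeWeight_apply]
      exact sum_reedSolomonCode e.injective (by omega) e.mem hj
    · obtain ⟨E, hE, hcard, h0⟩ := exists_support (-e.r + e.w)
      refine ⟨E, hE, ?_, fun j hj hjE => ?_⟩
      · have h1 := e.close
        have h2 := codeMinDist_reedSolomonCode_le e.injective hk hkm
        rw [hammingDist_eq_hammingNorm] at h1
        omega
      · have := h0 j hj hjE
        rw [extendZero_of_lt _ hj] at this
        rw [extendZero_of_lt _ hj, extendZero_of_lt _ hj]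
        exact neg_add_eq_zero.1 this
    · rintro _ ⟨i, rfl⟩
      exact ⟨i, i.2, funext fun e => extendZero_fin e.w i⟩
  obtain ⟨s, c, hc, h⟩ := exists_circuit x _ hP
  refine ⟨s, c, hc.trans (hA m (by omega)), fun F _ _ α hα w r hw hr => ?_⟩
  convert h ⟨F, _, _, α, hα, w, r, hw, hr⟩ using 1
  funext j
  rcases j with j | j <;> rfl

theorem exists_syndromeDecoding : ∃ A a : ℕ, ∀ m n : ℕ, n < m →
    ∃ (s : ℕ) (c : RevCircuit ((Fin m ⊕ Fin n) ⊕ Fin m ⊕ Fin s)),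
      c.length ≤ A * m * (Nat.log 2 m + 1) ^ a ∧
      ∀ (F : Type u) [Field F] [DecidableEq F] (α : Fin m → F),
        Function.Injective α → ∀ e : Fin m → F,
        2 * hammingNorm e < codeMinDist (vandermondeDualCode α n) →
        c.Computes (Sum.elim α ((vandermondeMatrix α n).transpose.mulVec e)) e := by
  obtain ⟨μ, hμ, H⟩ := exists_syndromeCost.{u, u + 1}
  obtain ⟨A, a, hA⟩ := hμ.exists_gateBound
  refine ⟨A, a, fun m n hnm => ?_⟩
  set x : Fin m ⊕ Fin n → ∀ e : SyndromeProblem.{u} m n, e.F :=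
    Sum.elim (fun j e => e.α j)
      (fun j e => (vandermondeMatrix e.α n).transpose.mulVec e.e j) with hx
  have hP : SLP (Set.range x) (μ (Nat.clog 2 m))
      (Set.range fun (i : Fin m) (e : SyndromeProblem.{u} m n) => e.e i) := by
    refine (H (Nat.clog 2 m) m n hnm (Nat.le_pow_clog one_lt_two m) (Set.range x)
      (fun j e => extendZero e.α j) (fun j e => extendZero e.e j)
      (fun j hj => ⟨Sum.inl ⟨j, hj⟩, funext fun e => (extendZero_of_lt e.α hj).symm⟩)
      (fun j hj => ⟨Sum.inr ⟨j, hj⟩, funext fun e => ?_⟩)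
      (fun e => injOn_extendZero e.injective) fun e => ?_).mono_right ?_
    · rw [Finset.sum_apply]
      exact (mulVec_vandermondeMatrix e.α e.e n ⟨j, hj⟩).trans (sum_power_eq e.α e.e j).symm
    · obtain ⟨E, hE, hcard, h0⟩ := exists_support e.e
      refine ⟨E, hE, ?_, h0⟩
      have h1 := e.light
      have h2 := codeMinDist_vandermondeDualCode_le e.injective hnm
      omega
    · rintro _ ⟨i, rfl⟩
      exact ⟨i, i.2, funext fun e => extendZero_fin e.e i⟩
  obtain ⟨s, c, hc, h⟩ := exists_circuit x _ hP
  refine ⟨s, c, hc.trans (hA m (by omega)), fun F _ _ α hα e he => ?_⟩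
  convert h ⟨F, _, _, α, hα, e, he⟩ using 1
  funext j
  rcases j with j | j <;> rfl

theorem mainTheorem8 :
    -- Multipoint evaluation of a polynomial of degree less than `m` at `m` points
    (∃ A a : ℕ, ∀ m : ℕ, ∃ (s : ℕ) (c : RevCircuit ((Fin m ⊕ Fin m) ⊕ Fin m ⊕ Fin s)),
      c.length ≤ A * m * (Nat.log 2 m + 1) ^ a ∧
      ∀ (F : Type*) [Field F] [Finite F] (p : F[X]) (α : Fin m → F), p.degree < m →
        c.Computes (Sum.elim (fun j : Fin m => p.coeff j) α) (fun i => p.eval (α i))) ∧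
    -- Decoding of received words
    (∃ A a : ℕ, ∀ m k : ℕ, 1 ≤ k → k ≤ m →
      ∃ (s : ℕ) (c : RevCircuit ((Fin m ⊕ Fin m) ⊕ Fin m ⊕ Fin s)),
      c.length ≤ A * m * (Nat.log 2 m + 1) ^ a ∧
      ∀ (F : Type*) [Field F] [Finite F] [DecidableEq F] (α : Fin m → F),
        Function.Injective α → ∀ (w r : Fin m → F), w ∈ reedSolomonCode α k →
        2 * hammingDist r w < codeMinDist (reedSolomonCode α k) →
        c.Computes (Sum.elim α r) w) ∧
    -- Decoding of syndromes
    (∃ A a : ℕ, ∀ m n : ℕ, n < m →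
      ∃ (s : ℕ) (c : RevCircuit ((Fin m ⊕ Fin n) ⊕ Fin m ⊕ Fin s)),
      c.length ≤ A * m * (Nat.log 2 m + 1) ^ a ∧
      ∀ (F : Type*) [Field F] [Finite F] [DecidableEq F] (α : Fin m → F),
        Function.Injective α → ∀ e : Fin m → F,
        2 * hammingNorm e < codeMinDist (vandermondeDualCode α n) →
        c.Computes (Sum.elim α ((vandermondeMatrix α n).transpose.mulVec e)) e) := by
  obtain ⟨A₁, a₁, h₁⟩ := exists_multipointEvaluation
  obtain ⟨A₂, a₂, h₂⟩ := exists_wordDecoding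
  obtain ⟨A₃, a₃, h₃⟩ := exists_syndromeDecoding
  refine ⟨⟨A₁, a₁, fun m => ?_⟩, ⟨A₂, a₂, fun m k hk hkm => ?_⟩, ⟨A₃, a₃, fun m n hnm => ?_⟩⟩
  · obtain ⟨s, c, hc, h⟩ := h₁ m
    exact ⟨s, c, hc, fun F _ _ => h F⟩
  · obtain ⟨s, c, hc, h⟩ := h₂ m k hk hkm
    exact ⟨s, c, hc, fun F _ _ _ => h F⟩
  · obtain ⟨s, c, hc, h⟩ := h₃ m n hnm
    exact ⟨s, c, hc, fun F _ _ _ => h F⟩
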